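/- \textbf{Setting.} Let $k,l\ge 1$ and let $J$ be a linear map from $\mathcal Z=\mathbb R^l$ to the skew endomorphisms of $\mathcal X=\mathbb R^k$ with $J_Z^2=-|Z|^2\,\mathrm{id}$. On the Heisenberg-type group $\mathcal X\times\mathcal Z$ with product $(X,Z)(X',Z')=(X+X',Z+Z'+\frac12[X,X'])$, where $\langle[X,Y],Z\rangle=\langle J_ZX,Y\rangle$, let $\Delta$ be the Laplacian (on functions) of the left-invariant metric that extends the Euclidean inner product. Write $D_K\bullet$ for the derivative of functions of $X$ along the field $X\mapsto J_KX$. For vectors $B_1,\dots,B_\kappa\in\mathcal X$ and a unit vector $u\in\mathcal Z$ put $z_i=\langle B_i+\mathbf iJ_uB_i,X\rangle$ (bilinear extension of $\langle\,,\rangle$), and let $\Pi_X^{(n)}$ be the projection of the homogeneous polynomials of degree $n$ in $X$ onto the harmonic ones, along the multiples of $|X|^2$. For $n\ge 0$, $m\in\mathbb Z$ let $\mathcal A^{(n,m)}$ be the complex span of the functions $$\beta(u)\,\Pi_X^{(n)}\Big(\prod_{i}z_i^{p_i}\bar z_i^{\,q_i}\Big)(X),\qquad \sum_i(p_i+q_i)=n,\quad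 \sum_ip_i-\sum_iq_i=m,$$ with $\beta$ continuous on the unit sphere of $\mathcal Z$ and with all $\kappa$, $B_i$, $p_i$, $q_i$ allowed. Let $R>0$ and $(a,b)\in\mathbb R^2\setminus\{0\}$, and consider the boundary condition $a\,w+b\,\partial_\nu w=0$ on $|Z|=R$, with $\partial_\nu$ the radial derivative in $Z$ (Dirichlet: $b=0$, Neumann: $a=0$, mixed otherwise). Let $\lambda=\lambda^{(s)}_i\ge 0$ be an eigenvalue of $-\Delta_{\mathbb R^l}$ on the ball $B_R\subset\mathbb R^l$ under this condition that has an eigenfunction (of class $C^2$ up to the boundary) of the form $y(|Z|)h(Z/|Z|)$ with $h$ a spherical harmonic of order $s$. Let $\pi^{(s)}$ be the $L^2$-orthogonal projection of functions of $u$ to the spherical harmonics of order $s$. For an amplitude $G(X,u)$ let $$T[G](X,Z)=\oint e^{\mathbf i\sqrt\lambda\langle Z,u\rangle}\big(\pi^{(s)}G(X,\cdot)\big)(u)\,du$$ (normalized integral over the unit sphere; that is, the integral over the sphere of radius $\sqrt\lambda$ with $K=\sqrt\lambda\,u$). The orbital and the intrinsic spin operators and the exterior operator are defined on twisted functions in terms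 of their amplitudes by $$\mathbf L[G]=\mathbf i\oint e^{\mathbf i\langle Z,K\rangle}\pi^{(s)}(D_K\bullet G)\,du,\qquad \mathbf S[G]=\mathbf i\oint e^{\mathbf i\langle Z,K\rangle}[D_K\bullet,\pi^{(s)}]G\,du,$$ $$\mathrm{OE}[G]=\Delta_XT[G]+\big(1+\tfrac14|X|^2\big)\Delta_ZT[G]+\mathbf L[G].$$ Let $0\le\rho\le\infty$ and let $M=\{|X|<\rho,\ |Z|<R\}$ be the $Z$-ball bundle of constant radius $R$. Let $F\in\mathcal A^{(n,m)}$, let $\phi$ be a complex-valued function that is $C^2$ near $|X|^2$ for each $X$ with $|X|<\rho$, and put $G=\phi(|X|^2)F(X,u)$. \textbf{Theorem.} (1) For each $X$ with $|X|<\rho$ the function $T[G](X,\cdot)$ satisfies the boundary condition on $|Z|=R$. (2) $\Delta T[G]=\mathrm{OE}[G]+\mathbf S[G]$ on $M$. (3) On $M$ the exterior operator reduces to a radial operator: $\mathrm{OE}[\phi(|X|^2)F]=T[(\Diamond_\lambda\phi)(|X|^2)F]$, where $$(\Diamond_{\lambda}f)(t)=4tf''(t)+(2k+4n)f'(t)-\Big(2m\sqrt{\tfrac{\lambda}{4}}+4\,\tfrac{\lambda}{4}\big(1+\tfrac14t\big)\Big)f(t).$$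 (4) If $T[F]$ does not vanish identically on $M$, then for each $\nu\in\mathbb C$: $\mathrm{OE}[G]=\nu\,T[G]$ on $M$ if and only if $(\Diamond_\lambda\phi)(|X|^2)=\nu\,\phi(|X|^2)$ for all $X$ with $|X|<\rho$. (5) With $\mu=\sqrt{\lambda/4}$, the operator $\Diamond_\lambda$ is the radial Ginsburg-Landau-Zeeman operator $$(\Diamond^{GLZ}_\mu f)(t)=4tf''(t)+(2k+4n)f'(t)-\big(2m\mu+4\mu^2(1+\tfrac14t)\big)f(t).$$ (6) This operator is the one obtained on $Z$-crystals: for all $\mu>0$, unit vectors $u\in\mathcal Z$, with $Z_\gamma=(\mu/\pi)u$, and all $|X|<\rho$, $Z\in\mathcal Z$, $$\Delta\Big(\phi(|X|^2)F(X,u)\,e^{2\pi\mathbf i\langle Z_\gamma,Z\rangle}\Big)=(\Diamond^{GLZ}_\mu\phi)(|X|^2)\,F(X,u)\,e^{2\pi\mathbf i\langle Z_\gamma,Z\rangle}.$$ -/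

import Mathlib

open MeasureTheory

noncomputable section

/-- The X-space `ℝᵏ` and the Z-space `ℝˡ` are Euclidean spaces. -/
abbrev Vec (d : ℕ) : Type := EuclideanSpace ℝ (Fin d)

/-- The unit sphere of the Z-space, over which the unit directions `K_u` range. -/
abbrev USphere (l : ℕ) : Type := Metric.sphere (0 : Vec l) 1

/-- The standard orthonormal basis. -/
def stdVec {d : ℕ} (i : Fin d) : Vec d := EuclideanSpace.single i 1

/-! ### Heisenberg-type groups -/

/-- The endomorphism space of a Heisenberg-type group on `ℝᵏ × ℝˡ`: a linear family of skew
endomorphisms `J_Z` of the X-space with the Clifford condition `J_Z² = -|Z|² id`. -/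
structure HType (k l : ℕ) where
  J : Vec l →ₗ[ℝ] Vec k →ₗ[ℝ] Vec k
  skew : ∀ (z : Vec l) (x y : Vec k), inner ℝ (J z x) y = -inner ℝ x (J z y)
  clifford : ∀ (z : Vec l) (x : Vec k), J z (J z x) = -(‖z‖ ^ 2) • x

namespace HType

variable {k l : ℕ} (N : HType k l)

/-- The Lie bracket `[X, Y] ∈ 𝒵` of two X-vectors, determined by `⟨[X, Y], Z⟩ = ⟨J_Z X, Y⟩`. -/
def bracket (x y : Vec k) : Vec l :=
  WithLp.toLp 2 fun α => inner ℝ (N.J (stdVec α) x) y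

theorem inner_bracket (x y : Vec k) (z : Vec l) :
    inner ℝ (N.bracket x y) z = inner ℝ (N.J z x) y := by
  have hz : z = ∑ α, z α • stdVec α := by
    ext i
    simp [stdVec, Finset.sum_apply, Pi.single_apply]
  conv_rhs => rw [hz]
  simp only [map_sum, map_smul, LinearMap.sum_apply, LinearMap.smul_apply, sum_inner,
    real_inner_smul_left, PiLp.inner_apply (𝕜 := ℝ) (N.bracket x y) z]
  rfl

/-- The group multiplication
`(X, Z) (X', Z') = (X + X', Z + Z' + ½ [X, X'])` in exponential coordinates. -/
def mul (g h : Vec k × Vec l) : Vec k × Vec l :=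
  (g.1 + h.1, g.2 + h.2 + (1 / 2 : ℝ) • N.bracket g.1 h.1)

/-- The Laplacian of the left-invariant metric for which the standard basis of the Lie algebra
`ℝᵏ ⊕ ℝˡ` is orthonormal. The group is unimodular, so this is the sum of the squares of the
left-invariant fields of an orthonormal basis; the square of such a field `E` at `g` is the second
derivative at `t = 0` along `g · exp (t E)`. -/
def laplacian (f : Vec k → Vec l → ℂ) (X : Vec k) (Z : Vec l) : ℂ :=
  (∑ i : Fin k, iteratedDeriv 2
      (fun t : ℝ => f (N.mul (X, Z) (t • stdVec i, 0)).1 (N.mul (X, Z) (t • stdVec i, 0)).2) 0) +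
    ∑ α : Fin l, iteratedDeriv 2
      (fun t : ℝ => f (N.mul (X, Z) (0, t • stdVec α)).1 (N.mul (X, Z) (0, t • stdVec α)).2) 0

/-- `D_K •`: the derivative of a function of the X-variable along the field `X ↦ J_K X`. -/
def D (K : Vec l) (f : Vec k → ℂ) (X : Vec k) : ℂ :=
  fderiv ℝ f X (N.J K X)

end HType

/-! ### Polynomials, harmonic projections, spherical harmonics -/

/-- The Laplacian on polynomials. -/
def polyLaplacian {d : ℕ} (P : MvPolynomial (Fin d) ℂ) : MvPolynomial (Fin d) ℂ :=
  ∑ i, MvPolynomial.pderiv i (MvPolynomial.pderiv i P)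

/-- The value of a complex polynomial at a real vector. -/
def evalAt {d : ℕ} (x : Vec d) (P : MvPolynomial (Fin d) ℂ) : ℂ :=
  MvPolynomial.eval (fun i => (x i : ℂ)) P

/-- The coefficients `C_s` of the harmonic projection in dimension `d` and degree `n`:
`C_0 = 1` and `2 s (2 (n - s) + d - 2) C_s + C_{s-1} = 0`. -/
def projCoeff (d n : ℕ) : ℕ → ℝ
  | 0 => 1
  | s + 1 => -projCoeff d n s / (2 * (s + 1) * (2 * (n - (s + 1)) + d - 2))

/-- The projection `Π⁽ⁿ⁾ = ∑ₛ Cₛ ⟨X, X⟩ˢ Δˢ` of the homogeneous polynomials of degree `n` onto the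
harmonic ones (along the multiples of `⟨X, X⟩`). -/
def harmonicProj {d : ℕ} (n : ℕ) (P : MvPolynomial (Fin d) ℂ) : MvPolynomial (Fin d) ℂ :=
  ∑ s ∈ Finset.range (n / 2 + 1),
    MvPolynomial.C (projCoeff d n s : ℂ) * (∑ j, MvPolynomial.X j ^ 2) ^ s * polyLaplacian^[s] P

/-- The spherical harmonics of order `s`: restrictions to the unit sphere of the harmonic
homogeneous polynomials of degree `s`. -/
def sphericalHarmonics (l s : ℕ) : Set (USphere l → ℂ) :=
  {h | ∃ P : MvPolynomial (Fin l) ℂ, P.IsHomogeneous s ∧ polyLaplacian P = 0 ∧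
    h = fun u : USphere l => evalAt (u : Vec l) P}

/-- The rotation invariant surface measure of the unit sphere of `ℝˡ` (not normalized). -/
def sphereMeasure (l : ℕ) : Measure (USphere l) := (volume : Measure (Vec l)).toSphere

/-- `h` is the orthogonal projection of `g` to the spherical harmonics of order `s`. -/
def IsSphereProj (l s : ℕ) (g h : USphere l → ℂ) : Prop :=
  h ∈ sphericalHarmonics l s ∧ ∀ h' ∈ sphericalHarmonics l s,
    ∫ u, (g u - h u) * (starRingEnd ℂ) (h' u) ∂sphereMeasure l = 0

theorem continuous_evalAt {l : ℕ} (P : MvPolynomial (Fin l) ℂ) :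
    Continuous fun u : USphere l => evalAt (u : Vec l) P := by
  unfold evalAt
  exact (MvPolynomial.continuous_eval P).comp (by fun_prop)

instance (l : ℕ) : IsFiniteMeasure (sphereMeasure l) := by
  unfold sphereMeasure; infer_instance

instance (l : ℕ) : (sphereMeasure l).IsOpenPosMeasure := by
  unfold sphereMeasure; infer_instance

theorem sphericalHarmonics_sub {l s : ℕ} {h h' : USphere l → ℂ} (hh : h ∈ sphericalHarmonics l s)
    (hh' : h' ∈ sphericalHarmonics l s) : (fun u => h u - h' u) ∈ sphericalHarmonics l s := by
  obtain ⟨P, hP, hP0, rfl⟩ := hh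
  obtain ⟨P', hP', hP0', rfl⟩ := hh'
  refine ⟨P - P', ?_, ?_, ?_⟩
  · exact (MvPolynomial.homogeneousSubmodule (Fin l) ℂ s).sub_mem hP hP'
  · simp only [polyLaplacian, map_sub, Finset.sum_sub_distrib] at *
    rw [hP0, hP0', sub_zero]
  · simp [evalAt]

/-- On continuous functions the projection exists and is unique. -/
theorem existsUnique_isSphereProj (l s : ℕ) (g : USphere l → ℂ) (hg : Continuous g) :
    ∃! h, IsSphereProj l s g h := by
  have hcont : ∀ h ∈ sphericalHarmonics l s, Continuous h := by
    rintro h ⟨P, -, -, rfl⟩; exact continuous_evalAt P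
  have hint : ∀ f : USphere l → ℂ, Continuous f → Integrable f (sphereMeasure l) := fun f hf =>
    hf.integrable_of_hasCompactSupport (HasCompactSupport.of_compactSpace f)
  have hmem : ∀ f : USphere l → ℂ, Continuous f → MemLp f 2 (sphereMeasure l) := fun f hf =>
    hf.memLp_of_hasCompactSupport (HasCompactSupport.of_compactSpace f)
  have hinner : ∀ a b : USphere l → ℂ, ∀ (ha : Continuous a) (hb : Continuous b),
      inner ℂ ((hmem b hb).toLp b) ((hmem a ha).toLp a) =
        ∫ u, a u * (starRingEnd ℂ) (b u) ∂sphereMeasure l := by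
    intro a b ha hb
    rw [L2.inner_def]
    refine integral_congr_ae ?_
    filter_upwards [(hmem a ha).coeFn_toLp, (hmem b hb).coeFn_toLp] with u h1 h2
    rw [h1, h2]; simp
  let T : MvPolynomial (Fin l) ℂ →ₗ[ℂ] Lp ℂ 2 (sphereMeasure l) :=
    { toFun := fun P => (hmem _ (continuous_evalAt P)).toLp _
      map_add' := fun P Q => by
        rw [← MemLp.toLp_add]; congr 1; ext u; simp [evalAt]
      map_smul' := fun c P => by
        rw [RingHom.id_apply, ← MemLp.toLp_const_smul]; congr 1; ext u; simp [evalAt] }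
  let H : Submodule ℂ (MvPolynomial (Fin l) ℂ) :=
    { carrier := {P | P.IsHomogeneous s ∧ polyLaplacian P = 0}
      add_mem' := fun {P Q} hP hQ => ⟨hP.1.add hQ.1, by
        have h1 := hP.2
        have h2 := hQ.2
        simp only [polyLaplacian, map_add, Finset.sum_add_distrib] at *
        rw [h1, h2, add_zero]⟩
      zero_mem' := ⟨MvPolynomial.isHomogeneous_zero _ _ _, by simp [polyLaplacian]⟩
      smul_mem' := fun c P hP =>
        ⟨(MvPolynomial.homogeneousSubmodule (Fin l) ℂ s).smul_mem c hP.1, by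
          have h1 := hP.2
          simp only [polyLaplacian, Derivation.map_smul, ← Finset.smul_sum] at *
          rw [h1, smul_zero]⟩ }
  have hle : H ≤ MvPolynomial.homogeneousSubmodule (Fin l) ℂ s := fun P hP => hP.1
  have : FiniteDimensional ℂ (MvPolynomial.homogeneousSubmodule (Fin l) ℂ s) :=
    Module.Finite.iff_fg.2 (MvPolynomial.homogeneousSubmodule_fg _ _ s)
  have : FiniteDimensional ℂ H := Submodule.finiteDimensional_of_le hle
  have : FiniteDimensional ℂ (H.map T) := inferInstance
  have hproj : ∃ h, IsSphereProj l s g h := by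
    have hm := Submodule.starProjection_apply_mem (H.map T) ((hmem g hg).toLp g)
    obtain ⟨P, hP, hPe⟩ := hm
    refine ⟨fun u => evalAt (u : Vec l) P, ⟨P, hP.1, hP.2, rfl⟩, ?_⟩
    rintro _ ⟨Q, hQ, hQ0, rfl⟩
    rw [← hinner (fun u => g u - evalAt (u : Vec l) P) _ (hg.sub (continuous_evalAt P))
      (continuous_evalAt Q)]
    have := Submodule.sub_starProjection_mem_orthogonal (K := H.map T) ((hmem g hg).toLp g)
    have h2 := (Submodule.mem_orthogonal _ _).1 this (T Q) (Submodule.mem_map_of_mem ⟨hQ, hQ0⟩)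
    rw [← hPe] at h2
    rw [← h2]
    congr 1
  obtain ⟨h, hh⟩ := hproj
  refine ⟨h, hh, fun h' hh' => ?_⟩
  have hd := sphericalHarmonics_sub hh'.1 hh.1
  have hc := hcont _ hd
  have e1 := hh.2 _ hd
  have e2 := hh'.2 _ hd
  have i1 : Integrable (fun u => (g u - h u) * (starRingEnd ℂ) (h' u - h u)) (sphereMeasure l) :=
    hint _ ((hg.sub (hcont _ hh.1)).mul (Complex.continuous_conj.comp hc))
  have i2 : Integrable (fun u => (g u - h' u) * (starRingEnd ℂ) (h' u - h u)) (sphereMeasure l) :=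
    hint _ ((hg.sub (hcont _ hh'.1)).mul (Complex.continuous_conj.comp hc))
  have e3 : ∫ u, ((‖h' u - h u‖ ^ 2 : ℝ) : ℂ) ∂sphereMeasure l = 0 := by
    rw [← sub_eq_zero.2 (e1.trans e2.symm), ← integral_sub i1 i2]
    refine integral_congr_ae (Filter.Eventually.of_forall fun u => ?_)
    simp only
    rw [← sub_mul, Complex.ofReal_pow, ← Complex.mul_conj']
    ring
  rw [integral_complex_ofReal] at e3
  have e4 := Complex.ofReal_eq_zero.1 e3
  have hc2 : Continuous fun u => ‖h' u - h u‖ ^ 2 := by fun_prop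
  have e5 := (integral_eq_zero_iff_of_nonneg (fun u => sq_nonneg ‖h' u - h u‖)
    (hc2.integrable_of_hasCompactSupport (HasCompactSupport.of_compactSpace _))).1 e4
  have e6 := (Continuous.ae_eq_iff_eq _ hc2 continuous_zero).1 e5
  ext u
  have := congrFun e6 u
  simpa [sub_eq_zero] using this

/-- The projection `π_K⁽ˢ⁾` of a function of `K_u` to the spherical harmonics of order `s`. On
continuous functions it is well defined, see `existsUnique_isSphereProj`. -/
def sphereProj (l s : ℕ) (g : USphere l → ℂ) : USphere l → ℂ :=
  Classical.epsilon (IsSphereProj l s g)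


/-! ### Dirichlet, Neumann and mixed conditions on the Z-ball -/

/-- The boundary condition `a w + b ∂w/∂ν = 0` on the sphere of radius `R` (Dirichlet for
`(a, b) = (1, 0)`, Neumann for `(a, b) = (0, 1)`, mixed in general). -/
def BoundaryCond {l : ℕ} (a b R : ℝ) (w : Vec l → ℂ) : Prop :=
  ∀ u : USphere l, a * w (R • (u : Vec l)) + b * fderiv ℝ w (R • (u : Vec l)) (u : Vec l) = 0

/-- `lam` belongs to the `s`-th order spectrum `{λ_i⁽ˢ⁾}` of the Euclidean ball of radius `R` in
`ℝˡ`: there is an eigenfunction of `-Δ`, smooth up to the boundary, with eigenvalue `lam`, that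
satisfies the boundary condition and is the product of a radial function with a spherical harmonic
of order `s`. -/
def IsBallEigenvalue (l s : ℕ) (a b R lam : ℝ) : Prop :=
  ∃ w : Vec l → ℂ,
    (∀ Z ∈ Metric.closedBall (0 : Vec l) R, ContDiffAt ℝ 2 w Z) ∧
    (∃ Z ∈ Metric.ball (0 : Vec l) R, w Z ≠ 0) ∧
    (∀ Z ∈ Metric.ball (0 : Vec l) R, -Laplacian.laplacian w Z = lam * w Z) ∧
    BoundaryCond a b R w ∧
    ∃ y : ℝ → ℂ, ∃ h ∈ sphericalHarmonics l s, ∀ r ∈ Set.Icc 0 R, ∀ u : USphere l,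
      w (r • (u : Vec l)) = y r * h u

/-! ### Twisted functions and the exterior operator -/

/-- The Z-ball bundle of constant radius `R` over the X-ball of radius `ρ` (`ρ = ∞` allowed). -/
def zBallBundle (k l : ℕ) (ρ : ENNReal) (R : ℝ) : Set (Vec k × Vec l) :=
  {x | ENNReal.ofReal ‖x.1‖ < ρ ∧ ‖x.2‖ < R}

/-- `∮ e^{i⟨Z, K⟩} g(K_u) dK_no` over the sphere of radius `√lam`, where `K = √lam K_u`. -/
def zFourier {l : ℕ} (lam : ℝ) (g : USphere l → ℂ) (Z : Vec l) : ℂ :=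
  ⨍ u : USphere l, Complex.exp (Complex.I * (inner ℝ Z (Real.sqrt lam • (u : Vec l)) : ℝ)) * g u
    ∂sphereMeasure l

/-- The twisted function `∮ e^{i⟨Z, K⟩} π⁽ˢ⁾(G)(X, K_u) dK_no` of an amplitude `G(X, K_u)`. -/
def twisted {k l : ℕ} (s : ℕ) (lam : ℝ) (G : Vec k → USphere l → ℂ) (X : Vec k) (Z : Vec l) : ℂ :=
  zFourier lam (sphereProj l s (G X)) Z

namespace HType

variable {k l : ℕ} (N : HType k l)

/-- The linear polynomial `Θ_Q(X, K_u) = ⟨Q + i J_{K_u} Q, X⟩` of the X-variable. -/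
def theta (Q : Vec k) (u : USphere l) : MvPolynomial (Fin k) ℂ :=
  ∑ j, MvPolynomial.C ((Q j : ℂ) + Complex.I * (N.J u Q j : ℝ)) * MvPolynomial.X j

/-- The conjugate `⟨Q - i J_{K_u} Q, X⟩` of `Θ_Q`. -/
def thetaBar (Q : Vec k) (u : USphere l) : MvPolynomial (Fin k) ℂ :=
  ∑ j, MvPolynomial.C ((Q j : ℂ) - Complex.I * (N.J u Q j : ℝ)) * MvPolynomial.X j

/-- The twisting polynomial `∏ᵢ z_{K_u i}^{pᵢ} z̄_{K_u i}^{qᵢ}` with `z_{K_u i} = Θ_{Bᵢ}(·, K_u)`. -/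
def twistPoly {κ : ℕ} (B : Fin κ → Vec k) (p q : Fin κ → ℕ) (u : USphere l) :
    MvPolynomial (Fin k) ℂ :=
  ∏ i, N.theta (B i) u ^ p i * N.thetaBar (B i) u ^ q i

/-- The span of the amplitudes `β(K_u) Π_X⁽ⁿ⁾(∏ᵢ zᵢ^{pᵢ} z̄ᵢ^{qᵢ})(X, K_u)` with
`∑ (pᵢ + qᵢ) = n` and `∑ pᵢ - ∑ qᵢ = m` (one pole `B = {Q}` or several poles). -/
def amplitudes (n : ℕ) (m : ℤ) : Submodule ℂ (Vec k → USphere l → ℂ) :=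
  Submodule.span ℂ {F | ∃ (κ : ℕ) (B : Fin κ → Vec k) (p q : Fin κ → ℕ) (β : USphere l → ℂ),
    Continuous β ∧ ∑ i, (p i + q i) = n ∧ ∑ i, (p i : ℤ) - ∑ i, (q i : ℤ) = m ∧
    F = fun X u => β u * evalAt X (harmonicProj n (N.twistPoly B p q u))}

/-- The orbital spin operator `L`: on the twisted function of the amplitude `G` it is
`i ∮ e^{i⟨Z, K⟩} π⁽ˢ⁾(D_K • G)(X, K_u) dK_no`. -/
def orbital (s : ℕ) (lam : ℝ) (G : Vec k → USphere l → ℂ) (X : Vec k) (Z : Vec l) : ℂ :=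
  Complex.I * zFourier lam
    (sphereProj l s fun u => N.D (Real.sqrt lam • (u : Vec l)) (fun X' => G X' u) X) Z

/-- The intrinsic spin operator `S`: on the twisted function of the amplitude `G` it is
`i ∮ e^{i⟨Z, K⟩} ([D_K •, π⁽ˢ⁾] G)(X, K_u) dK_no`. -/
def intrinsic (s : ℕ) (lam : ℝ) (G : Vec k → USphere l → ℂ) (X : Vec k) (Z : Vec l) : ℂ :=
  Complex.I * zFourier lam
    (fun u => N.D (Real.sqrt lam • (u : Vec l)) (fun X' => sphereProj l s (G X') u) X -
      sphereProj l s (fun v => N.D (Real.sqrt lam • (v : Vec l)) (fun X' => G X' v) X) u) Z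

/-- The exterior operator `Δ_X + (1 + |X|²/4) Δ_Z + L` on the twisted function of the
amplitude `G`. -/
def exterior (s : ℕ) (lam : ℝ) (G : Vec k → USphere l → ℂ) (X : Vec k) (Z : Vec l) : ℂ :=
  Laplacian.laplacian (fun X' => twisted s lam G X' Z) X +
    (1 + (1 / 4) * (‖X‖ : ℂ) ^ 2) * Laplacian.laplacian (twisted s lam G X) Z +
    N.orbital s lam G X Z

end HType

/-! ### The radial operators -/

/-- The radial Ginsburg-Landau-Zeeman operator of Z-crystals. -/
def radialGLZ (k n : ℕ) (m : ℤ) (μ : ℝ) (f : ℝ → ℂ) (t : ℝ) : ℂ :=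
  4 * t * iteratedDeriv 2 f t + (2 * k + 4 * n) * deriv f t -
    (2 * m * μ + 4 * (μ : ℂ) ^ 2 * (1 + (1 / 4) * t)) * f t

/-- The radial operator with the coefficients given by a ball eigenvalue `lam`. -/
def radialExterior (k n : ℕ) (m : ℤ) (lam : ℝ) (f : ℝ → ℂ) (t : ℝ) : ℂ :=
  4 * t * iteratedDeriv 2 f t + (2 * k + 4 * n) * deriv f t -
    (2 * m * (Real.sqrt (lam / 4) : ℂ) + 4 * ((lam : ℂ) / 4) * (1 + (1 / 4) * t)) * f t

end

noncomputable section

open Filter Topology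

/-! ### Second derivatives along lines -/

/-! Two facts about an amplitude `F` of type `(n, m)` carry the interior statements: for each
direction `u` it is a harmonic homogeneous polynomial of degree `n` in `X`, and the derivative along
`X ↦ J_u X` multiplies it by `i m`. The second holds because `J_u` is skew with square `-1`, so the
linear forms `⟨Q ± i J_u Q, X⟩` are eigenvectors with eigenvalues `± i`; eigenvalues add in
products, and the harmonic projection, being built from `⟨X, X⟩` and the Laplacian, commutes with
rotations. `IsHarmonicFamily` records this together with continuity in `u`.

For fixed `Z` the twisted function is a linear functional of the amplitude in the variable `u`,
hence commutes with linear operators on polynomials in `X`: `T[F](·, Z)` is again harmonic and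
homogeneous of degree `n` (`exists_twisted_poly`). So `Δ_X` acts on `φ T[F]` through `4tφ'' + (2k +
4n)φ'`, `Δ_Z` is multiplication by `-|K|² = -λ`, and `D_K` is the constant `i m √λ`, which passes
through the projection. Together these are the radial operator (`exterior_eq`). For the eigenvalue
problem, `T[F](·, Z)` is divided out along a ray on which it has no zero besides the origin, and the
origin is reached by continuity.

On a product `a(X) b(Z)` the group Laplacian is `Δ_X + (1 + |X|²/4) Δ_Z` plus a mixed term pairing
`J_β X`-derivatives with `∂_β` (`laplacian_mul`). A twisted function is a finite sum of such
products. As `∂_β` brings down `i K_β`, the mixed term is `i ∮ e^{i⟨Z,K⟩} D_K π⁽ˢ⁾ G`, which is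
orbital plus intrinsic spin. A plane wave in place of `b` gives the crystal statement.

The boundary condition is a statement about radial ODEs. Expanding the exponential and using that
the moments of a spherical harmonic are radial multiples of one of them (`momentPoly_eq`), the
Fourier integral of a harmonic of order `s` separates with a harmonic of the same order
(`zFourier_harmonic`). Its radial factor and that of the given eigenfunction solve the same Bessel
type equation and are both regular at `0`, so their Wronskian vanishes. The given Cauchy data at `R`
are not both zero by ODE uniqueness, so the boundary condition transfers
(`IsSeparatedEigen.boundaryCond`). -/

theorem iteratedDeriv_two_eq {g g' : ℝ → ℂ} {c : ℂ} {t : ℝ}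
    (h : ∀ᶠ x in 𝓝 t, HasDerivAt g (g' x) x) (h' : HasDerivAt g' c t) :
    iteratedDeriv 2 g t = c := by
  rw [iteratedDeriv_succ, iteratedDeriv_one]
  have : deriv g =ᶠ[𝓝 t] g' := h.mono fun x hx => hx.deriv
  rw [this.deriv_eq, h'.deriv]

section line

variable {E : Type*} [NormedAddCommGroup E] [NormedSpace ℝ E]

theorem hasDerivAt_line (x v : E) (t : ℝ) : HasDerivAt (fun t : ℝ => x + t • v) v t := by
  simpa using ((hasDerivAt_id t).smul_const v).const_add x

theorem ContDiffAt.hasDerivAt_line {f : E → ℂ} {x : E} {n : WithTop ℕ∞} (hf : ContDiffAt ℝ n f x)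
    (hn : n ≠ 0) (v : E) : HasDerivAt (fun t : ℝ => f (x + t • v)) (fderiv ℝ f x v) 0 := by
  have h : HasFDerivAt f (fderiv ℝ f x) (x + (0 : ℝ) • v) := by
    simpa using (hf.differentiableAt hn).hasFDerivAt
  exact h.comp_hasDerivAt (0 : ℝ) (_root_.hasDerivAt_line x v 0)

theorem tendsto_line (x v : E) : Tendsto (fun t : ℝ => x + t • v) (𝓝 0) (𝓝 x) := by
  have h : Continuous fun t : ℝ => x + t • v := by fun_prop
  simpa using h.tendsto 0

theorem ContDiffAt.eventually_hasDerivAt_line {f : E → ℂ} {x : E} (hf : ContDiffAt ℝ 2 f x)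
    (v : E) : ∀ᶠ t in 𝓝 (0 : ℝ),
      HasDerivAt (fun t : ℝ => f (x + t • v)) (fderiv ℝ f (x + t • v) v) t := by
  filter_upwards [(tendsto_line x v).eventually (hf.eventually (by simp))] with t ht
  exact (ht.differentiableAt (by simp)).hasFDerivAt.comp_hasDerivAt t (_root_.hasDerivAt_line x v t)

theorem ContDiffAt.hasDerivAt_fderiv_line {f : E → ℂ} {x : E} (hf : ContDiffAt ℝ 2 f x)
    (v w : E) : HasDerivAt (fun t : ℝ => fderiv ℝ f (x + t • v) w)
      (fderiv ℝ (fderiv ℝ f) x v w) 0 := by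
  have h1 : DifferentiableAt ℝ (fderiv ℝ f) x :=
    (hf.fderiv_right (m := 1) (by norm_num)).differentiableAt (by simp)
  have h : HasFDerivAt (fderiv ℝ f) (fderiv ℝ (fderiv ℝ f) x) (x + (0 : ℝ) • v) := by
    simpa using h1.hasFDerivAt
  have h2 := h.comp_hasDerivAt (0 : ℝ) (_root_.hasDerivAt_line x v 0)
  exact h2.clm_apply (hasDerivAt_const _ w) |>.congr_deriv (by simp)

theorem ContDiffAt.iteratedDeriv_two_line {f : E → ℂ} {x : E} (hf : ContDiffAt ℝ 2 f x)
    (v : E) : iteratedDeriv 2 (fun t : ℝ => f (x + t • v)) 0 = fderiv ℝ (fderiv ℝ f) x v v :=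
  iteratedDeriv_two_eq (hf.eventually_hasDerivAt_line v) (hf.hasDerivAt_fderiv_line v v)

end line

theorem ContDiffAt.hasDerivAt_deriv {f : ℝ → ℂ} {t : ℝ} (hf : ContDiffAt ℝ 2 f t) :
    HasDerivAt (deriv f) (iteratedDeriv 2 f t) t := by
  rw [iteratedDeriv_succ, iteratedDeriv_one]
  have h1 : DifferentiableAt ℝ (fderiv ℝ f) t :=
    (hf.fderiv_right (m := 1) (by norm_num)).differentiableAt (by simp)
  exact (h1.clm_apply (differentiableAt_const (1 : ℝ))).hasDerivAt

theorem ContDiffAt.deriv_one {f : ℝ → ℂ} {t : ℝ} (hf : ContDiffAt ℝ 2 f t) :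
    ContDiffAt ℝ 1 (deriv f) t :=
  (hf.fderiv_right (m := 1) (by norm_num)).clm_apply (contDiffAt_const (c := (1 : ℝ)))

theorem ContDiffAt.continuousAt_iteratedDeriv_two {f : ℝ → ℂ} {t : ℝ} (hf : ContDiffAt ℝ 2 f t) :
    ContinuousAt (iteratedDeriv 2 f) t := by
  rw [iteratedDeriv_succ, iteratedDeriv_one]
  exact ((hf.deriv_one.fderiv_right (m := 0) (by norm_num)).clm_apply
    (contDiffAt_const (c := (1 : ℝ)))).continuousAt

theorem ContDiffAt.eventually_hasDerivAt {f : ℝ → ℂ} {t : ℝ} (hf : ContDiffAt ℝ 2 f t) :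
    ∀ᶠ x in 𝓝 t, HasDerivAt f (deriv f x) x :=
  (hf.eventually (by simp)).mono fun x hx => (hx.differentiableAt (by simp)).hasDerivAt

theorem iteratedDeriv_two_mul {g h : ℝ → ℂ} {t : ℝ} (hg : ContDiffAt ℝ 2 g t)
    (hh : ContDiffAt ℝ 2 h t) :
    iteratedDeriv 2 (fun x => g x * h x) t =
      iteratedDeriv 2 g t * h t + 2 * (deriv g t * deriv h t) + g t * iteratedDeriv 2 h t := by
  have g1 := hg.eventually_hasDerivAt
  have h1 := hh.eventually_hasDerivAt
  have := iteratedDeriv_two_eq (g := fun x => g x * h x)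
    (g' := fun x => deriv g x * h x + g x * deriv h x)
    (by filter_upwards [g1, h1] with x a b using a.mul b)
    ((hg.hasDerivAt_deriv.mul h1.self_of_nhds).add (g1.self_of_nhds.mul hh.hasDerivAt_deriv))
  rw [this]; ring

theorem inner_stdVec {d : ℕ} (x : Vec d) (i : Fin d) : inner ℝ x (stdVec i) = x i := by
  simp [stdVec, EuclideanSpace.inner_single_right]

theorem norm_stdVec {d : ℕ} (i : Fin d) : ‖(stdVec i : Vec d)‖ = 1 := by
  simp [stdVec]

theorem sum_smul_stdVec {d : ℕ} (x : Vec d) : ∑ i, x i • stdVec i = x := by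
  ext i
  simp [stdVec, Finset.sum_apply, Pi.single_apply]

theorem sum_sq_eq_norm_sq {d : ℕ} (x : Vec d) : ∑ i, x i ^ 2 = ‖x‖ ^ 2 := by
  rw [EuclideanSpace.norm_sq_eq]; simp

theorem laplacian_eq_sum_fderiv {d : ℕ} (f : Vec d → ℂ) (x : Vec d) :
    Laplacian.laplacian f x = ∑ i, fderiv ℝ (fderiv ℝ f) x (stdVec i) (stdVec i) := by
  rw [InnerProductSpace.laplacian_eq_iteratedFDeriv_orthonormalBasis f
    (EuclideanSpace.basisFun (Fin d) ℝ)]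
  refine Finset.sum_congr rfl fun i _ => ?_
  rw [iteratedFDeriv_two_apply]
  simp [stdVec]

theorem laplacian_eq_sum_line {d : ℕ} {f : Vec d → ℂ} {x : Vec d} (hf : ContDiffAt ℝ 2 f x) :
    Laplacian.laplacian f x = ∑ i, iteratedDeriv 2 (fun t : ℝ => f (x + t • stdVec i)) 0 := by
  rw [laplacian_eq_sum_fderiv]
  exact Finset.sum_congr rfl fun i _ => (hf.iteratedDeriv_two_line _).symm

/-! ### Derivatives of polynomial and radial functions -/

theorem evalAt_add {d : ℕ} (x : Vec d) (P Q : MvPolynomial (Fin d) ℂ) :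
    evalAt x (P + Q) = evalAt x P + evalAt x Q := by simp [evalAt]

theorem evalAt_mul {d : ℕ} (x : Vec d) (P Q : MvPolynomial (Fin d) ℂ) :
    evalAt x (P * Q) = evalAt x P * evalAt x Q := by simp [evalAt]

theorem evalAt_sum {d : ℕ} {ι : Type*} (x : Vec d) (s : Finset ι)
    (P : ι → MvPolynomial (Fin d) ℂ) : evalAt x (∑ i ∈ s, P i) = ∑ i ∈ s, evalAt x (P i) := by
  simp [evalAt]

theorem evalAt_C {d : ℕ} (x : Vec d) (c : ℂ) : evalAt x (MvPolynomial.C c) = c := by simp [evalAt]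

theorem evalAt_X {d : ℕ} (x : Vec d) (i : Fin d) : evalAt x (MvPolynomial.X i) = x i := by
  simp [evalAt]

/-- The differential of a polynomial function. -/
def evalAtDeriv {d : ℕ} (P : MvPolynomial (Fin d) ℂ) (x : Vec d) : Vec d →L[ℝ] ℂ :=
  ∑ i, (EuclideanSpace.proj i : Vec d →L[ℝ] ℝ).smulRight (evalAt x (MvPolynomial.pderiv i P))

theorem evalAtDeriv_apply {d : ℕ} (P : MvPolynomial (Fin d) ℂ) (x v : Vec d) :
    evalAtDeriv P x v = ∑ i, (v i : ℂ) * evalAt x (MvPolynomial.pderiv i P) := by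
  simp [evalAtDeriv]

theorem evalAtDeriv_stdVec {d : ℕ} (P : MvPolynomial (Fin d) ℂ) (x : Vec d) (i : Fin d) :
    evalAtDeriv P x (stdVec i) = evalAt x (MvPolynomial.pderiv i P) := by
  simp [evalAtDeriv_apply, stdVec, apply_ite Complex.ofReal]

theorem hasFDerivAt_evalAt {d : ℕ} (P : MvPolynomial (Fin d) ℂ) (x : Vec d) :
    HasFDerivAt (fun x => evalAt x P) (evalAtDeriv P x) x := by
  induction P using MvPolynomial.induction_on with
  | C a =>
    have : evalAtDeriv (MvPolynomial.C a) x = 0 := by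
      ext v; simp [evalAtDeriv_apply, evalAt]
    rw [this]; simp only [evalAt_C]; exact hasFDerivAt_const _ _
  | add p q hp hq =>
    have : evalAtDeriv (p + q) x = evalAtDeriv p x + evalAtDeriv q x := by
      ext v; simp [evalAtDeriv_apply, evalAt_add, mul_add, Finset.sum_add_distrib]
    rw [this]; simp only [evalAt_add]; exact hp.add hq
  | mul_X p i hp =>
    have h1 : HasFDerivAt (fun x : Vec d => evalAt x (MvPolynomial.X i : MvPolynomial (Fin d) ℂ))
        (Complex.ofRealCLM.comp (EuclideanSpace.proj i : Vec d →L[ℝ] ℝ)) x := by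
      simp only [evalAt_X]
      exact (Complex.ofRealCLM.comp (EuclideanSpace.proj i : Vec d →L[ℝ] ℝ)).hasFDerivAt
    have h2 := hp.mul h1
    simp only [evalAt_mul]
    refine h2.congr_fderiv ?_
    ext v
    simp [evalAtDeriv_apply, Derivation.leibniz, evalAt_add, evalAt_mul, evalAt_X, mul_add,
      Finset.sum_add_distrib, MvPolynomial.pderiv_X, Pi.single_apply, Finset.mul_sum, mul_ite]
    have e : ∀ j, evalAt x (if i = j then p else 0) = if i = j then evalAt x p else 0 := fun j => by
      split_ifs <;> simp [evalAt]
    simp only [e, mul_ite, mul_zero, Finset.sum_ite_eq, Finset.mem_univ, if_true]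
    rw [mul_comm]
    congr 1
    exact Finset.sum_congr rfl fun j _ => by ring

theorem contDiff_evalAt {d : ℕ} (P : MvPolynomial (Fin d) ℂ) {n : WithTop ℕ∞} :
    ContDiff ℝ n fun x : Vec d => evalAt x P := by
  induction P using MvPolynomial.induction_on with
  | C a => simp only [evalAt_C]; fun_prop
  | add p q hp hq => simp only [evalAt_add]; exact hp.add hq
  | mul_X p i hp =>
    simp only [evalAt_mul, evalAt_X]
    exact hp.mul (Complex.ofRealCLM.comp (EuclideanSpace.proj i : Vec d →L[ℝ] ℝ)).contDiff

theorem fderiv_evalAt_stdVec {d : ℕ} (P : MvPolynomial (Fin d) ℂ) (x : Vec d) (i : Fin d) :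
    fderiv ℝ (fun x => evalAt x P) x (stdVec i) = evalAt x (MvPolynomial.pderiv i P) := by
  rw [(hasFDerivAt_evalAt P x).fderiv, evalAtDeriv_stdVec]

theorem iteratedDeriv_two_evalAt {d : ℕ} (P : MvPolynomial (Fin d) ℂ) (x : Vec d) (i : Fin d) :
    iteratedDeriv 2 (fun t : ℝ => evalAt (x + t • stdVec i) P) 0 =
      evalAt x (MvPolynomial.pderiv i (MvPolynomial.pderiv i P)) := by
  rw [(contDiff_evalAt P).contDiffAt.iteratedDeriv_two_line]
  rw [← fderiv_evalAt_stdVec]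
  have h := (contDiff_evalAt P (n := 2)).contDiffAt.hasDerivAt_fderiv_line (x := x)
    (stdVec i) (stdVec i)
  have h2 := (contDiff_evalAt (MvPolynomial.pderiv i P) (n := 2)).contDiffAt.hasDerivAt_line
    (x := x) (by simp) (stdVec i)
  simp only [fderiv_evalAt_stdVec] at h
  exact h.unique h2

theorem hasFDerivAt_radial {d : ℕ} {φ : ℝ → ℂ} {x : Vec d}
    (hφ : DifferentiableAt ℝ φ (‖x‖ ^ 2)) :
    HasFDerivAt (fun x : Vec d => φ (‖x‖ ^ 2))
      ((2 • innerSL ℝ x).smulRight (deriv φ (‖x‖ ^ 2))) x :=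
  (hφ.hasDerivAt.hasFDerivAt.comp x (hasStrictFDerivAt_norm_sq x).hasFDerivAt).congr_fderiv (by
    ext v; simp; ring)

theorem fderiv_radial {d : ℕ} {φ : ℝ → ℂ} {x : Vec d}
    (hφ : DifferentiableAt ℝ φ (‖x‖ ^ 2)) (v : Vec d) :
    fderiv ℝ (fun x : Vec d => φ (‖x‖ ^ 2)) x v = 2 * (inner ℝ x v : ℝ) * deriv φ (‖x‖ ^ 2) := by
  rw [(hasFDerivAt_radial hφ).fderiv]
  simp [mul_assoc]

theorem contDiffAt_radial {d : ℕ} {φ : ℝ → ℂ} {x : Vec d} (hφ : ContDiffAt ℝ 2 φ (‖x‖ ^ 2)) :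
    ContDiffAt ℝ 2 (fun x : Vec d => φ (‖x‖ ^ 2)) x :=
  ContDiffAt.comp x hφ (contDiff_norm_sq ℝ).contDiffAt

/-- Along a line `‖x + t • v‖ ^ 2` is a quadratic polynomial in `t`, and the chain rule applies to
it. -/
theorem iteratedDeriv_two_radial {d : ℕ} {φ : ℝ → ℂ} {x : Vec d}
    (hφ : ContDiffAt ℝ 2 φ (‖x‖ ^ 2)) (v : Vec d) :
    iteratedDeriv 2 (fun t : ℝ => φ (‖x + t • v‖ ^ 2)) 0 =
      4 * (inner ℝ x v : ℝ) ^ 2 * iteratedDeriv 2 φ (‖x‖ ^ 2) +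
        2 * (‖v‖ : ℂ) ^ 2 * deriv φ (‖x‖ ^ 2) := by
  set c : ℝ → ℝ := fun t => ‖x + t • v‖ ^ 2
  have hc : ∀ t, c t = ‖x‖ ^ 2 + 2 * inner ℝ x v * t + ‖v‖ ^ 2 * t ^ 2 := fun t => by
    simp only [c]
    rw [norm_add_sq_real, norm_smul, mul_pow, inner_smul_right, Real.norm_eq_abs, sq_abs]; ring
  have hd : ∀ t, HasDerivAt c (2 * inner ℝ x v + ‖v‖ ^ 2 * (2 * t)) t := fun t => by
    rw [show c = _ from funext hc]
    have := ((hasDerivAt_id t).const_mul (2 * inner ℝ x v)).const_add (‖x‖ ^ 2) |>.add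
      (((hasDerivAt_id t).pow 2).const_mul (‖v‖ ^ 2))
    exact this.congr_deriv (by simp)
  have hc0 : c 0 = ‖x‖ ^ 2 := by simp [c]
  rw [← hc0] at hφ ⊢
  have h1 : ∀ᶠ t in 𝓝 (0 : ℝ), HasDerivAt (fun t => φ (c t))
      ((2 * inner ℝ x v + ‖v‖ ^ 2 * (2 * t) : ℝ) • deriv φ (c t)) t := by
    filter_upwards [(hd 0).continuousAt.eventually hφ.eventually_hasDerivAt] with t ht
    exact ht.scomp t (hd t)
  have h2 : HasDerivAt (fun t : ℝ => 2 * inner ℝ x v + ‖v‖ ^ 2 * (2 * t)) (2 * ‖v‖ ^ 2) 0 := by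
    have := (((hasDerivAt_id (0 : ℝ)).const_mul 2).const_mul (‖v‖ ^ 2)).const_add (2 * inner ℝ x v)
    exact this.congr_deriv (by simp; ring)
  have h3 := h2.smul (hφ.hasDerivAt_deriv.scomp (0 : ℝ) (hd 0))
  rw [iteratedDeriv_two_eq h1 h3]
  simp
  ring

theorem contDiffAt_radial_mul_evalAt {d : ℕ} {φ : ℝ → ℂ} {x : Vec d}
    (hφ : ContDiffAt ℝ 2 φ (‖x‖ ^ 2)) (P : MvPolynomial (Fin d) ℂ) :
    ContDiffAt ℝ 2 (fun x : Vec d => φ (‖x‖ ^ 2) * evalAt x P) x :=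
  (contDiffAt_radial hφ).mul (contDiff_evalAt P).contDiffAt

/-- The Laplacian of a radial multiple of a harmonic homogeneous polynomial. -/
theorem laplacian_radial_mul_evalAt {d n : ℕ} {φ : ℝ → ℂ} {x : Vec d}
    (hφ : ContDiffAt ℝ 2 φ (‖x‖ ^ 2)) {P : MvPolynomial (Fin d) ℂ} (hP : P.IsHomogeneous n)
    (hP0 : polyLaplacian P = 0) :
    Laplacian.laplacian (fun x : Vec d => φ (‖x‖ ^ 2) * evalAt x P) x =
      (4 * (‖x‖ : ℂ) ^ 2 * iteratedDeriv 2 φ (‖x‖ ^ 2) +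
        (2 * d + 4 * n) * deriv φ (‖x‖ ^ 2)) * evalAt x P := by
  rw [laplacian_eq_sum_line (contDiffAt_radial_mul_evalAt hφ P)]
  have h : ∀ i : Fin d, iteratedDeriv 2
      (fun t : ℝ => φ (‖x + t • stdVec i‖ ^ 2) * evalAt (x + t • stdVec i) P) 0 =
      4 * iteratedDeriv 2 φ (‖x‖ ^ 2) * evalAt x P * ((x i ^ 2 : ℝ) : ℂ) +
        2 * deriv φ (‖x‖ ^ 2) * evalAt x P +
        4 * deriv φ (‖x‖ ^ 2) * ((x i : ℂ) * evalAt x (MvPolynomial.pderiv i P)) +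
        φ (‖x‖ ^ 2) * evalAt x (MvPolynomial.pderiv i (MvPolynomial.pderiv i P)) := fun i => by
    have hl : ContDiffAt ℝ 2 (fun t : ℝ => x + t • (stdVec i : Vec d)) 0 := by fun_prop
    have hx : x + (0 : ℝ) • (stdVec i : Vec d) = x := by simp
    have c1 : ContDiffAt ℝ 2 (fun t : ℝ => φ (‖x + t • (stdVec i : Vec d)‖ ^ 2)) 0 :=
      ContDiffAt.comp (g := fun x : Vec d => φ (‖x‖ ^ 2)) (0 : ℝ)
        (contDiffAt_radial (by rw [hx]; exact hφ)) hl
    have c2 : ContDiffAt ℝ 2 (fun t : ℝ => evalAt (x + t • (stdVec i : Vec d)) P) 0 :=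
      ContDiffAt.comp (g := fun x : Vec d => evalAt x P) (0 : ℝ) (contDiff_evalAt P).contDiffAt hl
    rw [iteratedDeriv_two_mul c1 c2, iteratedDeriv_two_radial hφ, iteratedDeriv_two_evalAt,
      ((contDiffAt_radial hφ).hasDerivAt_line (by simp) (stdVec i)).deriv,
      ((contDiff_evalAt P (n := 2)).contDiffAt.hasDerivAt_line (by simp) (stdVec i)).deriv,
      fderiv_radial (hφ.differentiableAt (by simp)), fderiv_evalAt_stdVec, inner_stdVec,
      norm_stdVec, hx]
    push_cast
    ring
  -- Euler's identity, applied to the cross terms; it is the source of `4 * n` in the radial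
  -- operator.
  have e1 : ∑ i, (x i : ℂ) * evalAt x (MvPolynomial.pderiv i P) = n * evalAt x P := by
    have := congrArg (evalAt x) hP.sum_X_mul_pderiv
    simpa [evalAt_sum, evalAt_mul, evalAt_X, evalAt] using this
  have e2 : ∑ i, evalAt x (MvPolynomial.pderiv i (MvPolynomial.pderiv i P)) = 0 := by
    rw [← evalAt_sum]
    have : ∑ i, MvPolynomial.pderiv i (MvPolynomial.pderiv i P) = 0 := hP0
    rw [this]; simp [evalAt]
  simp only [h, Finset.sum_add_distrib, ← Finset.mul_sum, e1, e2, ← Complex.ofReal_sum,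
    sum_sq_eq_norm_sq, Finset.sum_const, Finset.card_univ, Fintype.card_fin, nsmul_eq_mul]
  push_cast
  ring

/-! ### The polynomial Laplacian and rotations -/

section algebra

open MvPolynomial

variable {d : ℕ}

/-- The Laplacian on polynomials as a linear map. -/
def polyLaplacianLin (d : ℕ) : MvPolynomial (Fin d) ℂ →ₗ[ℂ] MvPolynomial (Fin d) ℂ :=
  ∑ i, (pderiv i).toLinearMap ∘ₗ (pderiv i).toLinearMap

theorem polyLaplacianLin_apply (P : MvPolynomial (Fin d) ℂ) :
    polyLaplacianLin d P = polyLaplacian P := by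
  simp [polyLaplacianLin, polyLaplacian]

theorem polyLaplacianLin_pow_apply (s : ℕ) (P : MvPolynomial (Fin d) ℂ) :
    (polyLaplacianLin d ^ s) P = polyLaplacian^[s] P := by
  rw [Module.End.coe_pow]
  rw [show ⇑(polyLaplacianLin d) = polyLaplacian from _root_.funext polyLaplacianLin_apply]

/-- The quadratic form `⟨X, X⟩` as a polynomial. -/
def normSqPoly (d : ℕ) : MvPolynomial (Fin d) ℂ := ∑ j, X j ^ 2

theorem evalAt_normSqPoly (x : Vec d) : evalAt x (normSqPoly d) = (‖x‖ : ℂ) ^ 2 := by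
  rw [← Complex.ofReal_pow, ← sum_sq_eq_norm_sq]
  simp [normSqPoly, evalAt]

theorem isHomogeneous_normSqPoly : (normSqPoly d).IsHomogeneous 2 :=
  IsHomogeneous.sum _ _ _ fun j _ => isHomogeneous_X_pow j 2

/-- The harmonic projection as a linear map. -/
def harmonicProjLin (d n : ℕ) : MvPolynomial (Fin d) ℂ →ₗ[ℂ] MvPolynomial (Fin d) ℂ :=
  ∑ s ∈ Finset.range (n / 2 + 1),
    LinearMap.mulLeft ℂ (C (projCoeff d n s : ℂ) * normSqPoly d ^ s) ∘ₗ polyLaplacianLin d ^ s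

theorem harmonicProjLin_apply (n : ℕ) (P : MvPolynomial (Fin d) ℂ) :
    harmonicProjLin d n P = harmonicProj n P := by
  simp [harmonicProjLin, harmonicProj, polyLaplacianLin_pow_apply, normSqPoly, mul_assoc]

theorem pderiv_normSqPoly (i : Fin d) : pderiv i (normSqPoly d) = 2 * X i := by
  simp [normSqPoly, pderiv_X, Pi.single_apply, Derivation.leibniz_pow]

theorem polyLaplacian_isHomogeneous {n : ℕ} {P : MvPolynomial (Fin d) ℂ}
    (hP : P.IsHomogeneous n) : (polyLaplacian P).IsHomogeneous (n - 2) :=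
  IsHomogeneous.sum _ _ _ fun _ _ => hP.pderiv.pderiv

theorem polyLaplacian_iterate_isHomogeneous {n : ℕ} {P : MvPolynomial (Fin d) ℂ}
    (hP : P.IsHomogeneous n) (s : ℕ) : (polyLaplacian^[s] P).IsHomogeneous (n - 2 * s) := by
  induction s with
  | zero => simpa
  | succ s ih =>
    rw [Function.iterate_succ_apply']
    rw [show n - 2 * (s + 1) = n - 2 * s - 2 by omega]
    exact polyLaplacian_isHomogeneous ih

/-- The degree `n - 2` of `polyLaplacian_isHomogeneous` is truncated to `0` here and does not show
vanishing by itself; first derivatives are constant in this range. -/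
theorem polyLaplacian_eq_zero_of_isHomogeneous {n : ℕ} (hn : n ≤ 1) {P : MvPolynomial (Fin d) ℂ}
    (hP : P.IsHomogeneous n) : polyLaplacian P = 0 := by
  refine Finset.sum_eq_zero fun i _ => ?_
  have h : (pderiv i P).IsHomogeneous 0 := by
    have := hP.pderiv (i := i)
    rwa [show n - 1 = 0 by omega] at this
  rw [totalDegree_eq_zero_iff_eq_C.1 ((totalDegree_zero_iff_isHomogeneous _).2 h), pderiv_C]

/-- The Laplacian of a multiple of `⟨X, X⟩`. -/
theorem polyLaplacian_normSqPoly_mul {n : ℕ} {P : MvPolynomial (Fin d) ℂ}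
    (hP : P.IsHomogeneous n) :
    polyLaplacian (normSqPoly d * P) =
      C (2 * d + 4 * n : ℂ) * P + normSqPoly d * polyLaplacian P := by
  have h : ∀ i, pderiv i (pderiv i (normSqPoly d * P)) =
      2 * P + 4 * (X i * pderiv i P) + normSqPoly d * pderiv i (pderiv i P) := fun i => by
    simp only [Derivation.leibniz, smul_eq_mul, map_add, pderiv_normSqPoly, pderiv_X_self]
    have : pderiv i (2 : MvPolynomial (Fin d) ℂ) = 0 := by
      rw [show (2 : MvPolynomial (Fin d) ℂ) = C 2 from (map_ofNat C 2).symm, pderiv_C]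
    rw [this]
    ring
  simp only [polyLaplacian, h, Finset.sum_add_distrib, ← Finset.mul_sum, hP.sum_X_mul_pderiv]
  simp only [Finset.sum_const, Finset.card_univ, Fintype.card_fin, nsmul_eq_mul, map_add, map_mul,
    map_natCast, map_ofNat]
  ring

/-- Each factor `⟨X, X⟩` raises the degree by two, so the constants of
`polyLaplacian_normSqPoly_mul` add up to `∑_{j ≤ s} (2d + 4(n + 2j)) = 2(s + 1)(2s + d + 2n)`. -/
theorem polyLaplacian_normSqPoly_pow_mul {n : ℕ} {P : MvPolynomial (Fin d) ℂ}
    (hP : P.IsHomogeneous n) (s : ℕ) :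
    polyLaplacian (normSqPoly d ^ (s + 1) * P) =
      C (2 * (s + 1) * (2 * s + d + 2 * n) : ℂ) * (normSqPoly d ^ s * P) +
        normSqPoly d ^ (s + 1) * polyLaplacian P := by
  induction s with
  | zero =>
    simp only [zero_add, pow_one, pow_zero, one_mul]
    rw [polyLaplacian_normSqPoly_mul hP]
    congr 3; push_cast; ring
  | succ s ih =>
    have h := polyLaplacian_normSqPoly_mul ((isHomogeneous_normSqPoly (d := d)).pow (s + 1) |>.mul hP)
    rw [pow_succ', mul_assoc, h, ih]
    push_cast
    simp only [map_add, map_mul, map_natCast, map_ofNat, map_one]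
    ring

/-- The harmonic projection is harmonic. -/
theorem polyLaplacian_harmonicProj {n : ℕ} {P : MvPolynomial (Fin d) ℂ} (hd : 0 < d)
    (hP : P.IsHomogeneous n) : polyLaplacian (harmonicProj n P) = 0 := by
  -- The sum telescopes: the coefficient `C_{N+1}` is chosen so that the lower term of the Laplacian
  -- of its summand cancels what the earlier summands leave. The remainder at `N = n / 2` vanishes
  -- by degree.
  have key : ∀ N, N ≤ n / 2 → polyLaplacian (∑ s ∈ Finset.range (N + 1),
      C (projCoeff d n s : ℂ) * normSqPoly d ^ s * polyLaplacian^[s] P) =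
      C (projCoeff d n N : ℂ) * normSqPoly d ^ N * polyLaplacian^[N + 1] P := by
    intro N hN
    induction N with
    | zero => simp [projCoeff]
    | succ N ih =>
      have hlin : ∀ A B : MvPolynomial (Fin d) ℂ,
          polyLaplacian (A + B) = polyLaplacian A + polyLaplacian B := fun A B => by
        simp only [← polyLaplacianLin_apply, map_add]
      have hC : ∀ (c : ℂ) (A : MvPolynomial (Fin d) ℂ),
          polyLaplacian (C c * A) = C c * polyLaplacian A := fun c A => by
        simp only [← polyLaplacianLin_apply, C_mul', map_smul]
      rw [Finset.sum_range_succ, hlin, ih (by omega), mul_assoc (C _) (_ ^ (N + 1)), hC,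
        polyLaplacian_normSqPoly_pow_mul (polyLaplacian_iterate_isHomogeneous hP (N + 1)),
        ← Function.iterate_succ_apply' polyLaplacian]
      have hc : (projCoeff d n (N + 1) : ℂ) *
          (2 * (N + 1) * (2 * N + d + 2 * ((n - 2 * (N + 1) : ℕ) : ℂ))) = -projCoeff d n N := by
        have h2 : 2 * (N + 1) ≤ n := by omega
        -- In the range `2 (N + 1) ≤ n` this is at least `2 N + d`, so the recursion never divides
        -- by zero once `d > 0`.
        have h3 : (2 * (n - (N + 1)) + d - 2 : ℝ) > 0 := by
          have h4 : (2 * (N + 1) : ℝ) ≤ n := by exact_mod_cast h2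
          have h5 : (0 : ℝ) < d := by exact_mod_cast hd
          have h6 : (0 : ℝ) ≤ N := Nat.cast_nonneg N
          linarith
        have h7 : projCoeff d n (N + 1) * (2 * (N + 1) * (2 * (n - (N + 1)) + d - 2)) =
            -projCoeff d n N := by
          rw [projCoeff]
          have h8 : (2 * ((N : ℝ) + 1) * (2 * (n - (N + 1)) + d - 2)) ≠ 0 := by positivity
          field_simp
        rw [Nat.cast_sub h2]
        have h9 := congrArg (fun x : ℝ => (x : ℂ)) h7
        push_cast at h9 ⊢
        rw [← h9]; ring
      rw [mul_add, ← mul_assoc (C _) (C _), ← C_mul, hc, C_neg]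
      ring
  have h := key (n / 2) le_rfl
  have h0 : polyLaplacian^[n / 2 + 1] P = 0 := by
    rw [Function.iterate_succ_apply']
    exact polyLaplacian_eq_zero_of_isHomogeneous (by omega)
      (polyLaplacian_iterate_isHomogeneous hP (n / 2))
  rw [h0, mul_zero] at h
  exact h

theorem harmonicProj_isHomogeneous {n : ℕ} {P : MvPolynomial (Fin d) ℂ}
    (hP : P.IsHomogeneous n) : (harmonicProj n P).IsHomogeneous n := by
  refine IsHomogeneous.sum _ _ _ fun s hs => ?_
  have h := ((isHomogeneous_C (Fin d) (projCoeff d n s : ℂ)).mul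
    ((isHomogeneous_normSqPoly (d := d)).pow s)).mul (polyLaplacian_iterate_isHomogeneous hP s)
  have hs' := Finset.mem_range.1 hs
  rwa [show 0 + 2 * s + (n - 2 * s) = n by omega] at h

/-- The derivation of polynomials along the linear vector field `x ↦ A x`. -/
def rotDeriv (A : Vec d →ₗ[ℝ] Vec d) :
    Derivation ℂ (MvPolynomial (Fin d) ℂ) (MvPolynomial (Fin d) ℂ) :=
  mkDerivation ℂ fun j => ∑ i, C ((A (stdVec i) j : ℝ) : ℂ) * X i

theorem derivation_sum_apply {ι : Type*} (s : Finset ι)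
    (D : ι → Derivation ℂ (MvPolynomial (Fin d) ℂ) (MvPolynomial (Fin d) ℂ))
    (P : MvPolynomial (Fin d) ℂ) : (∑ i ∈ s, D i) P = ∑ i ∈ s, D i P := by
  classical
  induction s using Finset.induction_on with
  | empty => simp
  | insert a s ha ih => simp [Finset.sum_insert ha, ih]

theorem rotDeriv_apply (A : Vec d →ₗ[ℝ] Vec d) (P : MvPolynomial (Fin d) ℂ) :
    rotDeriv A P = ∑ j, (∑ i, C ((A (stdVec i) j : ℝ) : ℂ) * X i) * pderiv j P := by
  have : rotDeriv A = ∑ j, (∑ i, C ((A (stdVec i) j : ℝ) : ℂ) * X i) • pderiv j := by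
    refine derivation_ext fun k => ?_
    simp [rotDeriv, mkDerivation_X, derivation_sum_apply, pderiv_X, Pi.single_apply]
  rw [this]
  simp [derivation_sum_apply]

theorem evalAt_rotDeriv (A : Vec d →ₗ[ℝ] Vec d) (P : MvPolynomial (Fin d) ℂ) (x : Vec d) :
    evalAt x (rotDeriv A P) = ∑ j, (A x j : ℂ) * evalAt x (pderiv j P) := by
  rw [rotDeriv_apply, evalAt_sum]
  refine Finset.sum_congr rfl fun j _ => ?_
  rw [evalAt_mul, evalAt_sum]
  congr 1
  conv_rhs => rw [← sum_smul_stdVec x]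
  simp [evalAt_mul, evalAt_X, evalAt_C, mul_comm]

/-- The commutator of two derivations is a derivation, so it is enough to test it on the variables.
-/
theorem pderiv_comm (i j : Fin d) (P : MvPolynomial (Fin d) ℂ) :
    pderiv i (pderiv j P) = pderiv j (pderiv i P) := by
  have : ⁅(pderiv i : Derivation ℂ (MvPolynomial (Fin d) ℂ) (MvPolynomial (Fin d) ℂ)),
      (pderiv j : Derivation ℂ (MvPolynomial (Fin d) ℂ) (MvPolynomial (Fin d) ℂ))⁆ = 0 := by
    refine derivation_ext fun k => ?_
    simp [Derivation.commutator_apply, pderiv_X, Pi.single_apply, apply_ite]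
  have h := congrArg (fun D => D P) this
  simpa [Derivation.commutator_apply, sub_eq_zero] using h

theorem pderiv_rotDeriv (A : Vec d →ₗ[ℝ] Vec d) (i : Fin d) (P : MvPolynomial (Fin d) ℂ) :
    pderiv i (rotDeriv A P) =
      rotDeriv A (pderiv i P) + ∑ j, C ((A (stdVec i) j : ℝ) : ℂ) * pderiv j P := by
  simp only [rotDeriv_apply, map_sum, Derivation.leibniz, smul_eq_mul, Finset.sum_add_distrib,
    pderiv_comm i]
  congr 1
  refine Finset.sum_congr rfl fun j _ => ?_
  simp [pderiv_X, Pi.single_apply, mul_comm]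

theorem skew_coeff {A : Vec d →ₗ[ℝ] Vec d} (hA : ∀ x y, inner ℝ (A x) y = -inner ℝ x (A y))
    (i j : Fin d) : A (stdVec i) j = -A (stdVec j) i := by
  have := hA (stdVec i) (stdVec j)
  rwa [inner_stdVec, real_inner_comm, inner_stdVec] at this

theorem sum_skew_mul_symm {a b : Fin d → Fin d → MvPolynomial (Fin d) ℂ}
    (ha : ∀ i j, a i j = -a j i) (hb : ∀ i j, b i j = b j i) :
    ∑ i, ∑ j, a i j * b i j = 0 := by
  have h : ∑ i, ∑ j, a i j * b i j = -∑ i, ∑ j, a i j * b i j := by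
    conv_lhs => rw [Finset.sum_comm]
    rw [← Finset.sum_neg_distrib]
    refine Finset.sum_congr rfl fun i _ => ?_
    rw [← Finset.sum_neg_distrib]
    refine Finset.sum_congr rfl fun j _ => ?_
    rw [ha, hb]; ring
  exact self_eq_neg.1 h

/-- Commuting the Laplacian past the field leaves `2 ∑ A_{ij} ∂_i ∂_j`, the contraction of a skew
matrix with the symmetric Hessian. -/
theorem polyLaplacian_rotDeriv {A : Vec d →ₗ[ℝ] Vec d}
    (hA : ∀ x y, inner ℝ (A x) y = -inner ℝ x (A y)) (P : MvPolynomial (Fin d) ℂ) :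
    polyLaplacian (rotDeriv A P) = rotDeriv A (polyLaplacian P) := by
  have h : ∀ i, pderiv i (pderiv i (rotDeriv A P)) = rotDeriv A (pderiv i (pderiv i P)) +
      2 * ∑ j, C ((A (stdVec i) j : ℝ) : ℂ) * pderiv i (pderiv j P) := fun i => by
    rw [pderiv_rotDeriv, map_add, pderiv_rotDeriv]
    simp only [map_sum, pderiv_C_mul, pderiv_comm i]
    ring
  simp only [polyLaplacian, h, Finset.sum_add_distrib, map_sum, ← Finset.mul_sum]
  rw [sum_skew_mul_symm (fun i j => by rw [skew_coeff hA i j]; simp) fun i j => pderiv_comm i j P]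
  simp

theorem rotDeriv_normSqPoly {A : Vec d →ₗ[ℝ] Vec d}
    (hA : ∀ x y, inner ℝ (A x) y = -inner ℝ x (A y)) : rotDeriv A (normSqPoly d) = 0 := by
  rw [rotDeriv_apply]
  simp only [pderiv_normSqPoly]
  have := sum_skew_mul_symm (a := fun i j : Fin d => C ((A (stdVec i) j : ℝ) : ℂ))
    (b := fun i j => 2 * (X i * X j)) (fun i j => by rw [skew_coeff hA i j]; simp)
    fun i j => by ring
  rw [← this, Finset.sum_comm]
  refine Finset.sum_congr rfl fun j _ => ?_
  rw [Finset.sum_mul]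
  exact Finset.sum_congr rfl fun i _ => by ring

/-- The projection is a combination of powers of `⟨X, X⟩` and of the Laplacian; a skew field
annihilates the former and commutes with the latter. -/
theorem rotDeriv_harmonicProj {A : Vec d →ₗ[ℝ] Vec d}
    (hA : ∀ x y, inner ℝ (A x) y = -inner ℝ x (A y)) (n : ℕ) (P : MvPolynomial (Fin d) ℂ) :
    rotDeriv A (harmonicProj n P) = harmonicProj n (rotDeriv A P) := by
  have hit : ∀ s, polyLaplacian^[s] (rotDeriv A P) = rotDeriv A (polyLaplacian^[s] P) := fun s => by
    induction s with
    | zero => rfl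
    | succ s ih =>
      rw [Function.iterate_succ_apply', ih, polyLaplacian_rotDeriv hA, Function.iterate_succ_apply']
  simp only [harmonicProj, map_sum, hit]
  refine Finset.sum_congr rfl fun s _ => ?_
  have h0 : rotDeriv A (∑ j, X j ^ 2) = 0 := rotDeriv_normSqPoly hA
  have h1 : rotDeriv A (C (projCoeff d n s : ℂ)) = 0 := by
    rw [rotDeriv_apply]; simp
  simp only [Derivation.leibniz, Derivation.leibniz_pow, h0, h1]
  simp

end algebra

/-! ### Families of polynomials with continuous coefficients -/

section families

open MvPolynomial

variable {d n : ℕ} {S : Type*} [TopologicalSpace S]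

/-- A family of polynomials all of whose coefficients are continuous in the parameter. -/
def ContCoeff (p : S → MvPolynomial (Fin d) ℂ) : Prop := ∀ α, Continuous fun u => coeff α (p u)

theorem ContCoeff.add {p q : S → MvPolynomial (Fin d) ℂ} (hp : ContCoeff p) (hq : ContCoeff q) :
    ContCoeff fun u => p u + q u := fun α => by
  simp only [coeff_add]; exact (hp α).add (hq α)

theorem ContCoeff.mul {p q : S → MvPolynomial (Fin d) ℂ} (hp : ContCoeff p) (hq : ContCoeff q) :
    ContCoeff fun u => p u * q u := fun α => by
  simp only [coeff_mul]
  exact continuous_finsetSum _ fun i _ => (hp i.1).mul (hq i.2)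

theorem contCoeff_const (P : MvPolynomial (Fin d) ℂ) : ContCoeff fun _ : S => P :=
  fun _ => continuous_const

theorem ContCoeff.pow {p : S → MvPolynomial (Fin d) ℂ} (hp : ContCoeff p) (k : ℕ) :
    ContCoeff fun u => p u ^ k := by
  induction k with
  | zero => simpa using contCoeff_const (1 : MvPolynomial (Fin d) ℂ)
  | succ k ih => simpa only [pow_succ] using ih.mul hp

theorem ContCoeff.sum {ι : Type*} (s : Finset ι) {p : ι → S → MvPolynomial (Fin d) ℂ}
    (hp : ∀ i ∈ s, ContCoeff (p i)) : ContCoeff fun u => ∑ i ∈ s, p i u := fun α => by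
  simp only [coeff_sum]
  exact continuous_finsetSum _ fun i hi => hp i hi α

theorem ContCoeff.prod {ι : Type*} (s : Finset ι) {p : ι → S → MvPolynomial (Fin d) ℂ}
    (hp : ∀ i ∈ s, ContCoeff (p i)) : ContCoeff fun u => ∏ i ∈ s, p i u := by
  classical
  induction s using Finset.induction_on with
  | empty => simpa using contCoeff_const (1 : MvPolynomial (Fin d) ℂ)
  | insert a s ha ih =>
    simp only [Finset.prod_insert ha]
    exact (hp a (Finset.mem_insert_self a s)).mul
      (ih fun i hi => hp i (Finset.mem_insert_of_mem hi))

theorem contCoeff_C {c : S → ℂ} (hc : Continuous c) :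
    ContCoeff fun u => (C (c u) : MvPolynomial (Fin d) ℂ) := fun α => by
  simp only [coeff_C]
  split_ifs
  · exact hc
  · exact continuous_const

/-- The exponents of the monomials of degree `n`. -/
def degreeExps (d n : ℕ) : Finset (Fin d →₀ ℕ) := Finset.finsuppAntidiag Finset.univ n

theorem mem_degreeExps {α : Fin d →₀ ℕ} : α ∈ degreeExps d n ↔ α.degree = n := by
  simp [degreeExps, Finset.mem_finsuppAntidiag, Finsupp.degree_eq_sum]

theorem MvPolynomial.IsHomogeneous.eq_sum_degreeExps {P : MvPolynomial (Fin d) ℂ}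
    (hP : P.IsHomogeneous n) : P = ∑ α ∈ degreeExps d n, coeff α P • monomial α (1 : ℂ) := by
  conv_lhs => rw [P.as_sum]
  rw [Finset.sum_subset (s₂ := degreeExps d n)]
  · simp [smul_monomial]
  · intro α hα
    rw [mem_degreeExps]
    by_contra h
    exact (mem_support_iff.1 hα) (hP.coeff_eq_zero h)
  · intro α _ hα
    rw [notMem_support_iff.1 hα, monomial_zero]

/-- A fixed degree confines the family to a finite-dimensional space, where `T` is a constant matrix
in the monomial basis. -/
theorem ContCoeff.linearMap {p : S → MvPolynomial (Fin d) ℂ} (hp : ContCoeff p)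
    (hn : ∀ u, (p u).IsHomogeneous n)
    (T : MvPolynomial (Fin d) ℂ →ₗ[ℂ] MvPolynomial (Fin d) ℂ) : ContCoeff fun u => T (p u) := by
  intro β
  have h : ∀ u, coeff β (T (p u)) =
      ∑ α ∈ degreeExps d n, coeff α (p u) * coeff β (T (monomial α 1)) := fun u => by
    conv_lhs => rw [(hn u).eq_sum_degreeExps]
    simp [coeff_sum]
  simp only [h]
  exact continuous_finsetSum _ fun α _ => (hp α).mul continuous_const

theorem ContCoeff.continuous_evalAt {p : S → MvPolynomial (Fin d) ℂ} (hp : ContCoeff p)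
    (hn : ∀ u, (p u).IsHomogeneous n) (x : Vec d) : Continuous fun u => evalAt x (p u) := by
  have h : ∀ u, evalAt x (p u) =
      ∑ α ∈ degreeExps d n, coeff α (p u) * evalAt x (monomial α 1) := fun u => by
    conv_lhs => rw [(hn u).eq_sum_degreeExps]
    rw [evalAt_sum]
    simp [evalAt]
  simp only [h]
  exact continuous_finsetSum _ fun α _ => (hp α).mul continuous_const

/-- The image of a family of homogeneous polynomials under a linear functional of the parameter. -/
def applyCoeff (n : ℕ) (ℓ : C(S, ℂ) →ₗ[ℂ] ℂ) {p : S → MvPolynomial (Fin d) ℂ}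
    (hp : ContCoeff p) : MvPolynomial (Fin d) ℂ :=
  ∑ α ∈ degreeExps d n, ℓ ⟨fun u => coeff α (p u), hp α⟩ • monomial α (1 : ℂ)

theorem applyCoeff_isHomogeneous (ℓ : C(S, ℂ) →ₗ[ℂ] ℂ) {p : S → MvPolynomial (Fin d) ℂ}
    (hp : ContCoeff p) : (applyCoeff n ℓ hp).IsHomogeneous n :=
  IsHomogeneous.sum _ _ _ fun α hα => by
    rw [smul_monomial]
    exact isHomogeneous_monomial _ (mem_degreeExps.1 hα)

/-- A linear functional of the parameter commutes with linear operators on polynomials. -/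
theorem evalAt_linearMap_applyCoeff (ℓ : C(S, ℂ) →ₗ[ℂ] ℂ) {p : S → MvPolynomial (Fin d) ℂ}
    (hp : ContCoeff p) (hn : ∀ u, (p u).IsHomogeneous n)
    (T : MvPolynomial (Fin d) ℂ →ₗ[ℂ] MvPolynomial (Fin d) ℂ) (x : Vec d) (g : C(S, ℂ))
    (hg : ∀ u, g u = evalAt x (T (p u))) : evalAt x (T (applyCoeff n ℓ hp)) = ℓ g := by
  have h : g = ∑ α ∈ degreeExps d n,
      evalAt x (T (monomial α 1)) • (⟨fun u => coeff α (p u), hp α⟩ : C(S, ℂ)) := by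
    ext u
    rw [hg]
    conv_lhs => rw [(hn u).eq_sum_degreeExps]
    simp [evalAt, ContinuousMap.sum_apply, mul_comm]
  rw [h]
  simp [applyCoeff, evalAt, mul_comm]

theorem evalAt_applyCoeff (ℓ : C(S, ℂ) →ₗ[ℂ] ℂ) {p : S → MvPolynomial (Fin d) ℂ}
    (hp : ContCoeff p) (hn : ∀ u, (p u).IsHomogeneous n) (x : Vec d) (g : C(S, ℂ))
    (hg : ∀ u, g u = evalAt x (p u)) : evalAt x (applyCoeff n ℓ hp) = ℓ g :=
  evalAt_linearMap_applyCoeff ℓ hp hn LinearMap.id x g hg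

theorem evalAt_smul_homogeneous {P : MvPolynomial (Fin d) ℂ} (hP : P.IsHomogeneous n) (t : ℝ)
    (x : Vec d) : evalAt (t • x) P = (t : ℂ) ^ n * evalAt x P := by
  rw [hP.eq_sum_degreeExps]
  simp only [evalAt_sum, Finset.mul_sum]
  refine Finset.sum_congr rfl fun α hα => ?_
  have h := mem_degreeExps.1 hα
  rw [Finsupp.degree_eq_sum] at h
  simp only [evalAt, smul_eval, eval_monomial, one_mul, PiLp.smul_apply, smul_eq_mul,
    Complex.ofReal_mul, mul_pow]
  rw [Finsupp.prod_fintype _ _ fun i => by simp, Finsupp.prod_fintype _ _ fun i => by simp]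
  simp only [Finset.prod_mul_distrib, Finset.prod_pow_eq_pow_sum, h]
  ring

/-- Real points suffice because `ℝ` is an infinite subset of `ℂ` in every coordinate. -/
theorem evalAt_ext {P Q : MvPolynomial (Fin d) ℂ} (h : ∀ x : Vec d, evalAt x P = evalAt x Q) :
    P = Q := by
  refine funext_set (fun _ => Set.range (Complex.ofReal)) (fun _ => ?_) ?_
  · exact Set.infinite_range_of_injective Complex.ofReal_injective
  · intro x hx
    choose y hy using fun i => hx i (Set.mem_univ i)
    have := h (WithLp.toLp 2 y)
    simpa [evalAt, hy] using this

/-- A linear functional of the parameter maps harmonic families to harmonic polynomials. -/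
theorem polyLaplacian_applyCoeff (ℓ : C(S, ℂ) →ₗ[ℂ] ℂ) {p : S → MvPolynomial (Fin d) ℂ}
    (hp : ContCoeff p) (hn : ∀ u, (p u).IsHomogeneous n) (h0 : ∀ u, polyLaplacian (p u) = 0) :
    polyLaplacian (applyCoeff n ℓ hp) = 0 := by
  refine evalAt_ext fun x => ?_
  rw [← polyLaplacianLin_apply, evalAt_linearMap_applyCoeff ℓ hp hn _ x 0 fun u => by
    rw [polyLaplacianLin_apply, h0]; simp [evalAt]]
  simp [evalAt]

end families

/-! ### The structure of the amplitudes -/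

namespace HType

open MvPolynomial

variable {k l : ℕ} (N : HType k l)

theorem norm_J_sq (z : Vec l) (x : Vec k) : ‖N.J z x‖ ^ 2 = ‖z‖ ^ 2 * ‖x‖ ^ 2 := by
  rw [← real_inner_self_eq_norm_sq, N.skew, N.clifford, inner_smul_right,
    real_inner_self_eq_norm_sq]
  ring

theorem inner_J_J (z w : Vec l) (x : Vec k) :
    inner ℝ (N.J z x) (N.J w x) = inner ℝ z w * ‖x‖ ^ 2 := by
  have h1 := N.norm_J_sq (z + w) x
  rw [map_add, LinearMap.add_apply, norm_add_sq_real, norm_add_sq_real, N.norm_J_sq, N.norm_J_sq]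
    at h1
  linarith

theorem inner_self_J (z : Vec l) (x : Vec k) : inner ℝ x (N.J z x) = 0 := by
  have h := N.skew z x x
  rw [real_inner_comm] at h
  linarith

theorem continuous_J (x : Vec k) (j : Fin k) : Continuous fun u : USphere l => N.J u x j := by
  have h : Continuous fun z : Vec l => N.J z x j :=
    ((EuclideanSpace.proj j : Vec k →L[ℝ] ℝ).toLinearMap ∘ₗ N.J.flip x).continuous_of_finiteDimensional
  exact h.comp continuous_subtype_val

/-- By skewness the derivative is `⟨Q + i J_u Q, J_u X⟩ = -⟨J_u Q + i J_u² Q, X⟩`, and `J_u² = -1`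
turns this into `i ⟨Q + i J_u Q, X⟩`. -/
theorem rotDeriv_theta (Q : Vec k) (u : USphere l) :
    rotDeriv (N.J u) (N.theta Q u) = C Complex.I * N.theta Q u := by
  have hu : ‖(u : Vec l)‖ = 1 := by simp
  have h : ∀ i, ∑ j, ((Q j : ℂ) + Complex.I * (N.J u Q j : ℝ)) * (N.J u (stdVec i) j : ℝ) =
      Complex.I * ((Q i : ℂ) + Complex.I * (N.J u Q i : ℝ)) := fun i => by
    have e1 : ∑ j, Q j * N.J u (stdVec i) j = -N.J u Q i := by
      have := N.skew u Q (stdVec i)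
      rw [inner_stdVec, PiLp.inner_apply] at this
      rw [this, neg_neg]
      exact Finset.sum_congr rfl fun j _ => by simp [mul_comm]
    have e2 : ∑ j, N.J u Q j * N.J u (stdVec i) j = Q i := by
      have := N.skew u (N.J u Q) (stdVec i)
      rw [inner_stdVec, N.clifford, hu, PiLp.inner_apply] at this
      have h2 : Q i = ∑ j, inner ℝ (N.J u Q j) (N.J u (stdVec i) j) := by
        simp at this ⊢; linarith
      rw [h2]
      exact Finset.sum_congr rfl fun j _ => by simp [mul_comm]
    simp only [add_mul, Finset.sum_add_distrib, mul_assoc, ← Finset.mul_sum]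
    rw [show (Q i : ℂ) = ((Q i : ℝ) : ℂ) from rfl, ← e2]
    have e1' := congrArg (fun x : ℝ => (x : ℂ)) e1
    push_cast at e1' ⊢
    rw [e1']
    linear_combination (-(N.J u Q i : ℂ)) * Complex.I_sq
  simp only [theta, map_sum]
  have e : ∀ (a : ℂ) (j : Fin k), rotDeriv (N.J u) (C a * X j) =
      ∑ i, C (a * (N.J u (stdVec i) j : ℝ)) * X i := fun a j => by
    rw [← MvPolynomial.smul_eq_C_mul, Derivation.map_smul, rotDeriv, mkDerivation_X,
      Finset.smul_sum]
    exact Finset.sum_congr rfl fun i _ => by rw [smul_eq_C_mul, C_mul, mul_assoc]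
  simp only [e]
  rw [Finset.sum_comm, Finset.mul_sum]
  refine Finset.sum_congr rfl fun i _ => ?_
  rw [← Finset.sum_mul, ← map_sum, h, C_mul, mul_assoc]

/-- The conjugate form is the form of the direction `-u`, and `J_{-u} = -J_u` reverses the sign of
the eigenvalue. -/
theorem rotDeriv_thetaBar (Q : Vec k) (u : USphere l) :
    rotDeriv (N.J u) (N.thetaBar Q u) = C (-Complex.I) * N.thetaBar Q u := by
  have e : N.thetaBar Q u = N.theta Q (-u) := by
    simp [theta, thetaBar, sub_eq_add_neg]
  have h := N.rotDeriv_theta Q (-u)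
  rw [rotDeriv_apply] at h
  rw [e, rotDeriv_apply, C_neg, neg_mul, ← h, ← Finset.sum_neg_distrib]
  refine Finset.sum_congr rfl fun j _ => ?_
  rw [← neg_mul, ← Finset.sum_neg_distrib]
  congr 1
  refine Finset.sum_congr rfl fun i _ => ?_
  simp

theorem rotDeriv_pow_of_eigen (A : Vec k →ₗ[ℝ] Vec k) {P : MvPolynomial (Fin k) ℂ} {c : ℂ}
    (h : rotDeriv A P = C c * P) (p : ℕ) : rotDeriv A (P ^ p) = C (p * c) * P ^ p := by
  induction p with
  | zero => simp
  | succ p ih =>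
    rw [pow_succ, Derivation.leibniz, ih, h, smul_eq_mul, smul_eq_mul]
    push_cast
    simp only [map_add, map_mul, map_natCast, map_one]
    ring

theorem rotDeriv_mul_of_eigen (A : Vec k →ₗ[ℝ] Vec k) {P Q : MvPolynomial (Fin k) ℂ} {c c' : ℂ}
    (h : rotDeriv A P = C c * P) (h' : rotDeriv A Q = C c' * Q) :
    rotDeriv A (P * Q) = C (c + c') * (P * Q) := by
  rw [Derivation.leibniz, h, h', smul_eq_mul, smul_eq_mul, C_add]
  ring

theorem rotDeriv_prod_of_eigen {ι : Type*} (A : Vec k →ₗ[ℝ] Vec k) (s : Finset ι)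
    {P : ι → MvPolynomial (Fin k) ℂ} {c : ι → ℂ} (h : ∀ i, rotDeriv A (P i) = C (c i) * P i) :
    rotDeriv A (∏ i ∈ s, P i) = C (∑ i ∈ s, c i) * ∏ i ∈ s, P i := by
  classical
  induction s using Finset.induction_on with
  | empty => simp
  | insert a s ha ih =>
    rw [Finset.prod_insert ha, Finset.sum_insert ha]
    exact rotDeriv_mul_of_eigen A (h a) ih

theorem rotDeriv_twistPoly {κ : ℕ} (B : Fin κ → Vec k) (p q : Fin κ → ℕ) (u : USphere l) {m : ℤ}
    (hm : ∑ i, (p i : ℤ) - ∑ i, (q i : ℤ) = m) :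
    rotDeriv (N.J u) (N.twistPoly B p q u) = C (Complex.I * m) * N.twistPoly B p q u := by
  have h := rotDeriv_prod_of_eigen (N.J u) Finset.univ fun i : Fin κ => rotDeriv_mul_of_eigen (N.J u)
    (rotDeriv_pow_of_eigen _ (N.rotDeriv_theta (B i) u) (p i))
    (rotDeriv_pow_of_eigen _ (N.rotDeriv_thetaBar (B i) u) (q i))
  rw [twistPoly, h]
  congr 2
  rw [← hm, Finset.sum_add_distrib, ← Finset.sum_mul, ← Finset.sum_mul]
  push_cast
  ring

theorem isHomogeneous_theta (Q : Vec k) (u : USphere l) : (N.theta Q u).IsHomogeneous 1 :=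
  IsHomogeneous.sum _ _ _ fun j _ => isHomogeneous_C_mul_X _ j

theorem isHomogeneous_thetaBar (Q : Vec k) (u : USphere l) : (N.thetaBar Q u).IsHomogeneous 1 :=
  IsHomogeneous.sum _ _ _ fun j _ => isHomogeneous_C_mul_X _ j

theorem isHomogeneous_twistPoly {κ n : ℕ} (B : Fin κ → Vec k) (p q : Fin κ → ℕ) (u : USphere l)
    (hn : ∑ i, (p i + q i) = n) : (N.twistPoly B p q u).IsHomogeneous n := by
  rw [← hn]
  refine IsHomogeneous.prod _ _ _ fun i _ => ?_
  simpa using ((N.isHomogeneous_theta (B i) u).pow (p i)).mul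
    ((N.isHomogeneous_thetaBar (B i) u).pow (q i))

theorem contCoeff_theta (Q : Vec k) : ContCoeff fun u : USphere l => N.theta Q u :=
  ContCoeff.sum _ fun j _ => (contCoeff_C (continuous_const.add (continuous_const.mul
    (Complex.continuous_ofReal.comp (N.continuous_J Q j))))).mul (contCoeff_const _)

theorem contCoeff_thetaBar (Q : Vec k) : ContCoeff fun u : USphere l => N.thetaBar Q u :=
  ContCoeff.sum _ fun j _ => (contCoeff_C (continuous_const.sub (continuous_const.mul
    (Complex.continuous_ofReal.comp (N.continuous_J Q j))))).mul (contCoeff_const _)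

theorem contCoeff_twistPoly {κ : ℕ} (B : Fin κ → Vec k) (p q : Fin κ → ℕ) :
    ContCoeff fun u : USphere l => N.twistPoly B p q u :=
  ContCoeff.prod _ fun i _ => ((N.contCoeff_theta (B i)).pow (p i)).mul
    ((N.contCoeff_thetaBar (B i)).pow (q i))

/-- A family of polynomials, continuous in the direction `u`, consisting of harmonic homogeneous
polynomials of degree `n` on which the rotation `J_u` acts with the weight `i m`. -/
structure IsHarmonicFamily (n : ℕ) (m : ℤ) (p : USphere l → MvPolynomial (Fin k) ℂ) : Prop where
  contCoeff : ContCoeff p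
  isHomogeneous : ∀ u, (p u).IsHomogeneous n
  harmonic : ∀ u, polyLaplacian (p u) = 0
  weight : ∀ u : USphere l, rotDeriv (N.J u) (p u) = C (Complex.I * m) * p u

/-- The defining properties of a harmonic family are linear, so checking them on the generators of
the span is enough. The concrete shape of the amplitudes is used only here. -/
theorem exists_isHarmonicFamily (hk : 0 < k) {n : ℕ} {m : ℤ} {F : Vec k → USphere l → ℂ}
    (hF : F ∈ N.amplitudes n m) :
    ∃ p, N.IsHarmonicFamily n m p ∧ F = fun X u => evalAt X (p u) := by
  induction hF using Submodule.span_induction with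
  | mem F hF =>
    obtain ⟨κ, B, p, q, β, hβ, hn, hm, rfl⟩ := hF
    have hh := fun u : USphere l => N.isHomogeneous_twistPoly B p q u hn
    refine ⟨fun u => C (β u) * harmonicProj n (N.twistPoly B p q u), ⟨?_, ?_, ?_, ?_⟩, ?_⟩
    · refine (contCoeff_C hβ).mul ?_
      simpa only [harmonicProjLin_apply] using
        (N.contCoeff_twistPoly B p q).linearMap hh (harmonicProjLin k n)
    · exact fun u => (harmonicProj_isHomogeneous (hh u)).C_mul _
    · intro u
      rw [← polyLaplacianLin_apply, C_mul', map_smul, polyLaplacianLin_apply,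
        polyLaplacian_harmonicProj hk (hh u), smul_zero]
    · intro u
      rw [C_mul', Derivation.map_smul, rotDeriv_harmonicProj (N.skew u),
        N.rotDeriv_twistPoly B p q u hm, ← harmonicProjLin_apply, ← harmonicProjLin_apply, C_mul',
        map_smul, C_mul', smul_comm]
    · ext X u
      rw [evalAt_mul, evalAt_C]
  | zero =>
    refine ⟨fun _ => 0, ⟨contCoeff_const _, fun _ => isHomogeneous_zero _ _ _,
      fun _ => by simp [polyLaplacian], fun _ => by simp⟩, ?_⟩
    ext X u; simp [evalAt]
  | add F G _ _ hF hG =>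
    obtain ⟨p, hp, rfl⟩ := hF
    obtain ⟨q, hq, rfl⟩ := hG
    refine ⟨fun u => p u + q u, ⟨hp.1.add hq.1, fun u => (hp.2 u).add (hq.2 u), fun u => ?_,
      fun u => ?_⟩, ?_⟩
    · rw [← polyLaplacianLin_apply, map_add, polyLaplacianLin_apply, polyLaplacianLin_apply,
        hp.3, hq.3, add_zero]
    · rw [map_add, hp.4, hq.4, mul_add]
    · ext X u; simp [evalAt_add]
  | smul c F _ hF =>
    obtain ⟨p, hp, rfl⟩ := hF
    refine ⟨fun u => C c * p u, ⟨(contCoeff_const _).mul hp.1, fun u => (hp.2 u).C_mul _,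
      fun u => ?_, fun u => ?_⟩, ?_⟩
    · rw [← polyLaplacianLin_apply, C_mul', map_smul, polyLaplacianLin_apply, hp.3, smul_zero]
    · rw [C_mul', Derivation.map_smul, hp.4, C_mul', C_mul', smul_comm]
    · ext X u; simp [evalAt_mul, evalAt_C]

end HType

/-! ### Fourier integrals over the sphere -/

section fourier

variable {l : ℕ}

theorem integrable_sphere {E : Type*} [NormedAddCommGroup E] {g : USphere l → E}
    (hg : Continuous g) : Integrable g (sphereMeasure l) :=
  hg.integrable_of_hasCompactSupport (HasCompactSupport.of_compactSpace g)

/-- The phase `e^{i⟨Z, K⟩}` with `K = √lam u`. -/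
def phase (lam : ℝ) (Z : Vec l) (u : USphere l) : ℂ :=
  Complex.exp (Complex.I * (inner ℝ Z (Real.sqrt lam • (u : Vec l)) : ℝ))

theorem continuous_phase (lam : ℝ) (Z : Vec l) : Continuous (phase lam Z) := by
  unfold phase
  fun_prop

theorem norm_phase (lam : ℝ) (Z : Vec l) (u : USphere l) : ‖phase lam Z u‖ = 1 := by
  rw [phase, mul_comm, Complex.norm_exp_ofReal_mul_I]

theorem zFourier_eq (lam : ℝ) (g : USphere l → ℂ) (Z : Vec l) : zFourier lam g Z =
    ((sphereMeasure l).real Set.univ)⁻¹ • ∫ u, phase lam Z u * g u ∂sphereMeasure l :=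
  average_eq _ _

theorem zFourier_add (lam : ℝ) {g h : USphere l → ℂ} (hg : Continuous g) (hh : Continuous h)
    (Z : Vec l) : zFourier lam (fun u => g u + h u) Z = zFourier lam g Z + zFourier lam h Z := by
  simp only [zFourier_eq, mul_add]
  have h1 := integrable_sphere ((continuous_phase lam Z).mul hg)
  have h2 := integrable_sphere ((continuous_phase lam Z).mul hh)
  simp only [Pi.mul_def] at h1 h2
  rw [integral_add h1 h2, smul_add]

theorem zFourier_const_mul (lam : ℝ) (c : ℂ) (g : USphere l → ℂ) (Z : Vec l) :
    zFourier lam (fun u => c * g u) Z = c * zFourier lam g Z := by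
  simp only [zFourier_eq, mul_left_comm _ c, integral_const_mul]
  rw [mul_smul_comm]

/-- The Fourier integral as a linear functional of the continuous density. -/
def zFourierLin (lam : ℝ) (Z : Vec l) : C(USphere l, ℂ) →ₗ[ℂ] ℂ where
  toFun g := zFourier lam g Z
  map_add' g h := zFourier_add lam g.continuous h.continuous Z
  map_smul' c g := zFourier_const_mul lam c g Z

theorem zFourier_sum {ι : Type*} (lam : ℝ) (s : Finset ι) {g : ι → USphere l → ℂ}
    (hg : ∀ i ∈ s, Continuous (g i)) (Z : Vec l) :
    zFourier lam (fun u => ∑ i ∈ s, g i u) Z = ∑ i ∈ s, zFourier lam (g i) Z := by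
  classical
  induction s using Finset.induction_on with
  | empty => simpa using zFourier_const_mul lam 0 (fun _ => 0) Z
  | insert a s ha ih =>
    simp only [Finset.sum_insert ha]
    rw [zFourier_add lam (hg a (Finset.mem_insert_self a s))
      (continuous_finsetSum _ fun i hi => hg i (Finset.mem_insert_of_mem hi)),
      ih fun i hi => hg i (Finset.mem_insert_of_mem hi)]

theorem hasFDerivAt_phase_mul (lam : ℝ) (g : USphere l → ℂ) (Z : Vec l) (u : USphere l) :
    HasFDerivAt (fun Z => phase lam Z u * g u)
      ((innerSL ℝ (Real.sqrt lam • (u : Vec l))).smulRight (Complex.I * phase lam Z u * g u)) Z := by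
  have h1 : HasFDerivAt (fun Z : Vec l => Complex.I * (inner ℝ Z (Real.sqrt lam • (u : Vec l)) : ℝ))
      (Complex.I • Complex.ofRealCLM.comp (innerSL ℝ (Real.sqrt lam • (u : Vec l)))) Z := by
    have h2 := (Complex.I • Complex.ofRealCLM.comp
      (innerSL ℝ (Real.sqrt lam • (u : Vec l)))).hasFDerivAt (x := Z)
    convert h2 using 1
    ext Z
    simp [real_inner_comm, inner_smul_right]
  refine (h1.cexp.mul_const (g u)).congr_fderiv ?_
  ext v
  simp [phase]
  ring

/-- Differentiation under the integral: the phase has modulus one, so `√lam * ‖g u‖` dominates the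
derivative uniformly in `Z`. -/
theorem hasFDerivAt_zFourier (lam : ℝ) {g : USphere l → ℂ} (hg : Continuous g) (Z : Vec l) :
    HasFDerivAt (zFourier lam g) (((sphereMeasure l).real Set.univ)⁻¹ •
      ∫ u, (innerSL ℝ (Real.sqrt lam • (u : Vec l))).smulRight (Complex.I * phase lam Z u * g u)
        ∂sphereMeasure l) Z := by
  rw [show zFourier lam g = fun Z => _ from funext (zFourier_eq lam g)]
  have hc : ∀ Z, Continuous fun u : USphere l =>
      (innerSL ℝ (Real.sqrt lam • (u : Vec l))).smulRight (Complex.I * phase lam Z u * g u) :=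
    fun Z => by
      have := continuous_phase lam Z
      fun_prop
  refine HasFDerivAt.const_smul (f := fun Z : Vec l =>
    ∫ u, phase lam Z u * g u ∂sphereMeasure l) ?_ ((sphereMeasure l).real Set.univ)⁻¹
  refine hasFDerivAt_integral_of_dominated_of_fderiv_le (𝕜 := ℝ) (s := Set.univ)
    (μ := sphereMeasure l) (F := fun Z u => phase lam Z u * g u)
    (F' := fun Z u => (innerSL ℝ (Real.sqrt lam • (u : Vec l))).smulRight
      (Complex.I * phase lam Z u * g u))
    (bound := fun u => Real.sqrt lam * ‖g u‖) univ_mem ?_ ?_ ?_ ?_ ?_ ?_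
  · exact Eventually.of_forall fun Z =>
      (integrable_sphere ((continuous_phase lam Z).mul hg)).aestronglyMeasurable
  · exact integrable_sphere ((continuous_phase lam Z).mul hg)
  · exact (integrable_sphere (hc Z)).aestronglyMeasurable
  · refine Eventually.of_forall fun u Z _ => ?_
    rw [ContinuousLinearMap.norm_smulRight_apply, innerSL_apply_norm, norm_smul]
    simp [norm_phase, abs_of_nonneg (Real.sqrt_nonneg lam)]
  · exact integrable_sphere (by fun_prop)
  · exact Eventually.of_forall fun u Z _ => hasFDerivAt_phase_mul lam g Z u

theorem fderiv_zFourier (lam : ℝ) {g : USphere l → ℂ} (hg : Continuous g) (Z v : Vec l) :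
    fderiv ℝ (zFourier lam g) Z v =
      zFourier lam (fun u => Complex.I * (inner ℝ v (Real.sqrt lam • (u : Vec l)) : ℝ) * g u) Z := by
  have hc : Continuous fun u : USphere l =>
      (innerSL ℝ (Real.sqrt lam • (u : Vec l))).smulRight (Complex.I * phase lam Z u * g u) := by
    have := continuous_phase lam Z
    fun_prop
  rw [(hasFDerivAt_zFourier lam hg Z).fderiv, zFourier_eq, smul_apply,
    ContinuousLinearMap.integral_apply (integrable_sphere hc)]
  congr 1
  refine integral_congr_ae (Eventually.of_forall fun u => ?_)
  simp [real_inner_comm, inner_smul_right]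
  ring

/-- A directional derivative is again a Fourier integral with a continuous density, so the induction
runs over all densities at once. -/
theorem contDiff_zFourier (lam : ℝ) {g : USphere l → ℂ} (hg : Continuous g) (n : ℕ) :
    ContDiff ℝ n (zFourier lam g) := by
  induction n generalizing g with
  | zero =>
    exact contDiff_zero.2 (continuous_iff_continuousAt.2 fun Z =>
      (hasFDerivAt_zFourier lam hg Z).continuousAt)
  | succ n ih =>
    push_cast
    rw [contDiff_succ_iff_fderiv_apply]
    refine ⟨fun Z => (hasFDerivAt_zFourier lam hg Z).differentiableAt, by simp, fun v => ?_⟩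
    rw [show (fun Z => fderiv ℝ (zFourier lam g) Z v) = _ from
      funext fun Z => fderiv_zFourier lam hg Z v]
    exact ih (by fun_prop)

/-- Two derivatives in direction `i` bring down `-lam * u_i²`, and `∑ u_i² = 1` on the sphere. -/
theorem laplacian_zFourier {lam : ℝ} (hlam : 0 ≤ lam) {g : USphere l → ℂ} (hg : Continuous g)
    (Z : Vec l) : Laplacian.laplacian (zFourier lam g) Z = -lam * zFourier lam g Z := by
  rw [laplacian_eq_sum_fderiv]
  have h : ∀ i : Fin l, fderiv ℝ (fderiv ℝ (zFourier lam g)) Z (stdVec i) (stdVec i) =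
      zFourier lam (fun u => -lam * ((u : Vec l) i : ℂ) ^ 2 * g u) Z := fun i => by
    have h1 := ((contDiff_zFourier lam hg 2).contDiffAt (x := Z)).hasDerivAt_fderiv_line
      (stdVec i) (stdVec i)
    have hc : Continuous fun u : USphere l =>
        Complex.I * (inner ℝ (stdVec i) (Real.sqrt lam • (u : Vec l)) : ℝ) * g u := by fun_prop
    have h2 := (((contDiff_zFourier lam hc 1).contDiffAt (x := Z)).hasDerivAt_line
      (by simp) (stdVec i))
    simp only [fderiv_zFourier lam hg] at h1
    rw [h1.unique h2, fderiv_zFourier lam hc]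
    congr 1
    ext u
    have h3 : (inner ℝ (stdVec i) (Real.sqrt lam • (u : Vec l)) : ℝ) =
        Real.sqrt lam * (u : Vec l) i := by
      rw [inner_smul_right, real_inner_comm, inner_stdVec]
    have h4 : (Real.sqrt lam : ℂ) ^ 2 = lam := by
      rw [← Complex.ofReal_pow, Real.sq_sqrt hlam]
    rw [h3, ← h4]
    push_cast
    linear_combination (Real.sqrt lam : ℂ) ^ 2 * ((u : Vec l) i : ℂ) ^ 2 * g u * Complex.I_sq
  simp only [h]
  rw [← zFourier_sum lam _ (fun i _ => by fun_prop), ← zFourier_const_mul]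
  congr 1
  ext u
  rw [← Finset.sum_mul, ← Finset.mul_sum]
  have h5 : ∑ i, ((u : Vec l) i : ℂ) ^ 2 = 1 := by
    have := sum_sq_eq_norm_sq (u : Vec l)
    rw [norm_eq_of_mem_sphere] at this
    exact_mod_cast (by simpa using this)
  rw [h5, mul_one]

end fourier

/-! ### The projection to spherical harmonics -/

section proj

variable {l s : ℕ}

theorem isSphereProj_sphereProj {g : USphere l → ℂ} (hg : Continuous g) :
    IsSphereProj l s g (sphereProj l s g) :=
  Classical.epsilon_spec (existsUnique_isSphereProj l s g hg).exists

theorem continuous_of_mem_sphericalHarmonics {h : USphere l → ℂ}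
    (hh : h ∈ sphericalHarmonics l s) : Continuous h := by
  obtain ⟨P, -, -, rfl⟩ := hh
  exact continuous_evalAt P

theorem sphereProj_mem {g : USphere l → ℂ} (hg : Continuous g) :
    sphereProj l s g ∈ sphericalHarmonics l s := (isSphereProj_sphereProj hg).1

theorem continuous_sphereProj {g : USphere l → ℂ} (hg : Continuous g) :
    Continuous (sphereProj l s g) := continuous_of_mem_sphericalHarmonics (sphereProj_mem hg)

theorem sphereProj_eq {g h : USphere l → ℂ} (hg : Continuous g) (hh : IsSphereProj l s g h) :
    sphereProj l s g = h :=
  (existsUnique_isSphereProj l s g hg).unique (isSphereProj_sphereProj hg) hh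

theorem sphereProj_add {g h : USphere l → ℂ} (hg : Continuous g) (hh : Continuous h) :
    sphereProj l s (fun u => g u + h u) = fun u => sphereProj l s g u + sphereProj l s h u := by
  refine sphereProj_eq (hg.add hh) ⟨?_, fun h' hh' => ?_⟩
  · obtain ⟨P, hP, hP0, eP⟩ := sphereProj_mem (s := s) hg
    obtain ⟨Q, hQ, hQ0, eQ⟩ := sphereProj_mem (s := s) hh
    refine ⟨P + Q, hP.add hQ, ?_, ?_⟩
    · rw [← polyLaplacianLin_apply, map_add, polyLaplacianLin_apply, polyLaplacianLin_apply,
        hP0, hQ0, add_zero]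
    · ext u; rw [eP, eQ, evalAt_add]
  · have hc := Complex.continuous_conj.comp (continuous_of_mem_sphericalHarmonics hh')
    have e1 := (isSphereProj_sphereProj (s := s) hg).2 h' hh'
    have e2 := (isSphereProj_sphereProj (s := s) hh).2 h' hh'
    rw [← add_zero (0 : ℂ)]
    nth_rw 1 [← e1]
    rw [← e2, ← integral_add]
    · congr 1; ext u; ring
    · exact integrable_sphere ((hg.sub (continuous_sphereProj hg)).mul hc)
    · exact integrable_sphere ((hh.sub (continuous_sphereProj hh)).mul hc)

theorem sphereProj_const_mul (c : ℂ) {g : USphere l → ℂ} (hg : Continuous g) :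
    sphereProj l s (fun u => c * g u) = fun u => c * sphereProj l s g u := by
  refine sphereProj_eq (continuous_const.mul hg) ⟨?_, fun h' hh' => ?_⟩
  · obtain ⟨P, hP, hP0, eP⟩ := sphereProj_mem (s := s) hg
    refine ⟨MvPolynomial.C c * P, hP.C_mul _, ?_, ?_⟩
    · rw [← polyLaplacianLin_apply, MvPolynomial.C_mul', map_smul, polyLaplacianLin_apply, hP0,
        smul_zero]
    · ext u; rw [eP, evalAt_mul, evalAt_C]
  · have e1 := (isSphereProj_sphereProj (s := s) hg).2 h' hh'
    rw [← mul_zero c, ← e1, ← integral_const_mul]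
    congr 1; ext u; ring

/-- The projection to the spherical harmonics as a linear map. -/
def sphereProjLin (l s : ℕ) : C(USphere l, ℂ) →ₗ[ℂ] C(USphere l, ℂ) where
  toFun g := ⟨sphereProj l s g, continuous_sphereProj g.continuous⟩
  map_add' g h := ContinuousMap.ext fun u => congrFun (sphereProj_add g.continuous h.continuous) u
  map_smul' c g := ContinuousMap.ext fun u => congrFun (sphereProj_const_mul c g.continuous) u

/-- The twisted function as a linear functional of the amplitude. -/
def twistLin (s : ℕ) (lam : ℝ) (Z : Vec l) : C(USphere l, ℂ) →ₗ[ℂ] ℂ :=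
  zFourierLin lam Z ∘ₗ sphereProjLin l s

theorem twisted_eq {k : ℕ} (s : ℕ) (lam : ℝ) (G : Vec k → USphere l → ℂ) (X : Vec k) :
    twisted s lam G X = zFourier lam (sphereProj l s (G X)) := rfl

theorem twisted_mul {k : ℕ} (s : ℕ) (lam : ℝ) (ψ : Vec k → ℂ) {F : Vec k → USphere l → ℂ}
    {X : Vec k} (hF : Continuous (F X)) (Z : Vec l) :
    twisted s lam (fun X u => ψ X * F X u) X Z = ψ X * twisted s lam F X Z := by
  rw [twisted_eq, twisted_eq, sphereProj_const_mul _ hF, zFourier_const_mul]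

end proj

/-! ### The group Laplacian on products -/

theorem contDiffAt_comp_line {E : Type*} [NormedAddCommGroup E] [NormedSpace ℝ E] {f : E → ℂ}
    {x : E} (hf : ContDiffAt ℝ 2 f x) (v : E) :
    ContDiffAt ℝ 2 (fun t : ℝ => f (x + t • v)) 0 :=
  ContDiffAt.comp (g := f) (0 : ℝ) (by simpa using hf) (by fun_prop)

theorem laplacian_sum_mul_const {d : ℕ} {ι : Type*} (s : Finset ι) {a : ι → Vec d → ℂ} {x : Vec d}
    (ha : ∀ j ∈ s, ContDiffAt ℝ 2 (a j) x) (c : ι → ℂ) :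
    Laplacian.laplacian (fun x => ∑ j ∈ s, a j x * c j) x =
      ∑ j ∈ s, Laplacian.laplacian (a j) x * c j := by
  have h : ∀ j ∈ s, ContDiffAt ℝ 2 (fun x => a j x * c j) x := fun j hj =>
    (ha j hj).mul contDiffAt_const
  rw [laplacian_eq_sum_line (ContDiffAt.sum h)]
  have h2 : ∀ i, iteratedDeriv 2 (fun t : ℝ => ∑ j ∈ s, a j (x + t • stdVec i) * c j) 0 =
      ∑ j ∈ s, iteratedDeriv 2 (fun t : ℝ => a j (x + t • stdVec i)) 0 * c j := fun i => by
    rw [iteratedDeriv_fun_sum fun j hj => contDiffAt_comp_line (h j hj) (stdVec i)]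
    refine Finset.sum_congr rfl fun j hj => ?_
    rw [iteratedDeriv_two_mul (contDiffAt_comp_line (ha j hj) _) contDiffAt_const]
    simp [iteratedDeriv_const]
  simp only [h2]
  rw [Finset.sum_comm]
  refine Finset.sum_congr rfl fun j hj => ?_
  rw [laplacian_eq_sum_line (ha j hj), Finset.sum_mul]

namespace HType

variable {k l : ℕ} (N : HType k l)

theorem bracket_smul (x y : Vec k) (t : ℝ) : N.bracket x (t • y) = t • N.bracket x y := by
  ext α
  simp [bracket, inner_smul_right]

/-- The bracket is linear in its second argument, so the curves `g · exp (t E)` are straight lines,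
with direction `(E_i, ½ [X, E_i])` for the X-basis and `(0, E_α)` for the Z-basis. -/
theorem laplacian_eq_lines (f : Vec k → Vec l → ℂ) (X : Vec k) (Z : Vec l) :
    N.laplacian f X Z = (∑ i : Fin k, iteratedDeriv 2
      (fun t : ℝ => f (X + t • stdVec i) (Z + t • ((1 / 2 : ℝ) • N.bracket X (stdVec i)))) 0) +
    ∑ α : Fin l, iteratedDeriv 2 (fun t : ℝ => f X (Z + t • stdVec α)) 0 := by
  have h0 : N.bracket X 0 = 0 := by simpa using N.bracket_smul X 0 0
  simp only [HType.laplacian, HType.mul, bracket_smul, h0, smul_zero, add_zero,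
    smul_comm (1 / 2 : ℝ)]

theorem bracket_stdVec (X : Vec k) (i : Fin k) :
    N.bracket X (stdVec i) = ∑ β, (N.J (stdVec β) X i) • stdVec β := by
  conv_lhs => rw [← sum_smul_stdVec (N.bracket X (stdVec i))]
  refine Finset.sum_congr rfl fun β _ => ?_
  rw [← inner_stdVec (N.bracket X (stdVec i)), N.inner_bracket, inner_stdVec]

/-- The vectors `J_β X` are orthogonal of length `‖X‖`, so `[X, ·]` composed with its transpose is
`‖X‖² id`. This is the Heisenberg-type property that makes the second-order Z-part a multiple of
`Δ_Z`. -/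
theorem sum_bracket_bilin (X : Vec k) (B : Vec l →L[ℝ] Vec l →L[ℝ] ℂ) :
    ∑ i, B (N.bracket X (stdVec i)) (N.bracket X (stdVec i)) =
      (‖X‖ : ℂ) ^ 2 * ∑ β, B (stdVec β) (stdVec β) := by
  have h : ∀ β γ : Fin l, ∑ i, N.J (stdVec β) X i * N.J (stdVec γ) X i =
      if β = γ then ‖X‖ ^ 2 else 0 := fun β γ => by
    have := N.inner_J_J (stdVec β) (stdVec γ) X
    rw [inner_stdVec, PiLp.inner_apply] at this
    have h2 : (stdVec β : Vec l) γ = if β = γ then 1 else 0 := by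
      simp [stdVec, eq_comm]
    rw [h2] at this
    rw [show (if β = γ then ‖X‖ ^ 2 else 0) = (if β = γ then (1 : ℝ) else 0) * ‖X‖ ^ 2 by simp,
      ← this]
    exact Finset.sum_congr rfl fun i _ => by simp [mul_comm]
  have e : ∀ i, B (N.bracket X (stdVec i)) (N.bracket X (stdVec i)) = ∑ β, ∑ γ,
      ((N.J (stdVec β) X i * N.J (stdVec γ) X i : ℝ) : ℂ) * B (stdVec β) (stdVec γ) := fun i => by
    rw [bracket_stdVec]
    simp only [map_sum, map_smul, sum_apply, smul_apply, Complex.real_smul, Complex.ofReal_mul,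
      Finset.mul_sum, mul_assoc]
    rw [Finset.sum_comm]
    refine Finset.sum_congr rfl fun β _ => Finset.sum_congr rfl fun γ _ => ?_
    ring
  simp only [e]
  rw [Finset.sum_comm, Finset.mul_sum]
  refine Finset.sum_congr rfl fun β _ => ?_
  rw [Finset.sum_comm]
  simp only [← Finset.sum_mul, ← Complex.ofReal_sum, h]
  rw [Finset.sum_eq_single β (by intro γ _ hγ; simp [hγ.symm]) (by simp)]
  simp

/-- The maps `Y ↦ [X, Y]` and `Z ↦ J_Z X` are adjoint, which converts the sum over the X-basis into
one over the Z-basis. -/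
theorem sum_fderiv_bracket (X : Vec k) (A : Vec k →L[ℝ] ℂ) (B : Vec l →L[ℝ] ℂ) :
    ∑ i, A (stdVec i) * B (N.bracket X (stdVec i)) =
      ∑ β, A (N.J (stdVec β) X) * B (stdVec β) := by
  simp only [bracket_stdVec, map_sum, map_smul, Finset.mul_sum]
  rw [Finset.sum_comm]
  refine Finset.sum_congr rfl fun β _ => ?_
  conv_rhs => rw [← sum_smul_stdVec (N.J (stdVec β) X)]
  simp only [map_sum, map_smul, Finset.sum_mul]
  refine Finset.sum_congr rfl fun i _ => ?_
  simp only [Complex.real_smul]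
  ring

/-- The Laplacian of a product of a function of `X` and a function of `Z`. -/
theorem laplacian_mul {a : Vec k → ℂ} {b : Vec l → ℂ} {X : Vec k} {Z : Vec l}
    (ha : ContDiffAt ℝ 2 a X) (hb : ContDiffAt ℝ 2 b Z) :
    N.laplacian (fun X Z => a X * b Z) X Z = Laplacian.laplacian a X * b Z +
      (1 + (1 / 4) * (‖X‖ : ℂ) ^ 2) * (a X * Laplacian.laplacian b Z) +
      ∑ β, fderiv ℝ a X (N.J (stdVec β) X) * fderiv ℝ b Z (stdVec β) := by
  rw [laplacian_eq_lines]
  -- The factor `½` in the direction `½ [X, E_i]` gives the cross term the coefficient `2 · ½ = 1`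
  -- and the second Z-derivative the coefficient `¼`.
  have h1 : ∀ i, iteratedDeriv 2 (fun t : ℝ => a (X + t • stdVec i) *
      b (Z + t • ((1 / 2 : ℝ) • N.bracket X (stdVec i)))) 0 =
      iteratedDeriv 2 (fun t : ℝ => a (X + t • stdVec i)) 0 * b Z +
      fderiv ℝ a X (stdVec i) * fderiv ℝ b Z (N.bracket X (stdVec i)) +
      1 / 4 * a X * fderiv ℝ (fderiv ℝ b) Z (N.bracket X (stdVec i)) (N.bracket X (stdVec i)) :=
    fun i => by
    rw [iteratedDeriv_two_mul (contDiffAt_comp_line ha _) (contDiffAt_comp_line hb _),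
      hb.iteratedDeriv_two_line, (ha.hasDerivAt_line (by simp) _).deriv,
      (hb.hasDerivAt_line (by simp) _).deriv]
    simp
    ring
  have h2 : ∀ α, iteratedDeriv 2 (fun t : ℝ => a X * b (Z + t • stdVec α)) 0 =
      a X * iteratedDeriv 2 (fun t : ℝ => b (Z + t • stdVec α)) 0 := fun α => by
    rw [iteratedDeriv_two_mul contDiffAt_const (contDiffAt_comp_line hb _)]
    simp [iteratedDeriv_const]
  simp only [h1, h2, Finset.sum_add_distrib, ← Finset.sum_mul, ← Finset.mul_sum,
    ← laplacian_eq_sum_line ha, ← laplacian_eq_sum_line hb, sum_fderiv_bracket, sum_bracket_bilin,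
    ← laplacian_eq_sum_fderiv]
  ring

theorem laplacian_sum_mul {ι : Type*} (s : Finset ι) {a : ι → Vec k → ℂ} {b : ι → Vec l → ℂ}
    {X : Vec k} {Z : Vec l} (ha : ∀ j ∈ s, ContDiffAt ℝ 2 (a j) X)
    (hb : ∀ j ∈ s, ContDiffAt ℝ 2 (b j) Z) :
    N.laplacian (fun X Z => ∑ j ∈ s, a j X * b j Z) X Z =
      ∑ j ∈ s, N.laplacian (fun X Z => a j X * b j Z) X Z := by
  simp only [laplacian_eq_lines, Finset.sum_add_distrib]
  congr 1
  · rw [Finset.sum_comm]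
    refine Finset.sum_congr rfl fun i _ => ?_
    rw [iteratedDeriv_fun_sum]
    exact fun j hj => (contDiffAt_comp_line (ha j hj) _).mul (contDiffAt_comp_line (hb j hj) _)
  · rw [Finset.sum_comm]
    refine Finset.sum_congr rfl fun i _ => ?_
    rw [iteratedDeriv_fun_sum]
    exact fun j hj => contDiffAt_const.mul (contDiffAt_comp_line (hb j hj) _)

/-! ### Harmonic families times radial functions -/

section family

variable {N} {n : ℕ} {m : ℤ} {p : USphere l → MvPolynomial (Fin k) ℂ}

theorem IsHarmonicFamily.continuous_evalAt (hp : N.IsHarmonicFamily n m p) (X : Vec k) :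
    Continuous fun u => evalAt X (p u) := hp.contCoeff.continuous_evalAt hp.isHomogeneous X

/-- The field `J_u X` is tangent to the spheres `‖X‖ = const`, so the radial factor is not
differentiated. -/
theorem IsHarmonicFamily.fderiv_J (hp : N.IsHarmonicFamily n m p) {φ : ℝ → ℂ} {X : Vec k}
    (hφ : ContDiffAt ℝ 2 φ (‖X‖ ^ 2)) (u : USphere l) :
    fderiv ℝ (fun X => φ (‖X‖ ^ 2) * evalAt X (p u)) X (N.J u X) =
      Complex.I * m * (φ (‖X‖ ^ 2) * evalAt X (p u)) := by
  have h1 := hasFDerivAt_radial (hφ.differentiableAt (by simp))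
  have h2 := hasFDerivAt_evalAt (p u) X
  have h3 : evalAtDeriv (p u) X (N.J u X) = Complex.I * m * evalAt X (p u) := by
    rw [evalAtDeriv_apply, ← evalAt_rotDeriv, hp.weight, evalAt_mul, evalAt_C]
  rw [(h1.fun_mul h2).fderiv]
  simp [h3, N.inner_self_J]
  ring

theorem IsHarmonicFamily.D_eq (hp : N.IsHarmonicFamily n m p) {φ : ℝ → ℂ} {X : Vec k}
    (hφ : ContDiffAt ℝ 2 φ (‖X‖ ^ 2)) (c : ℝ) (u : USphere l) :
    N.D (c • (u : Vec l)) (fun X => φ (‖X‖ ^ 2) * evalAt X (p u)) X =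
      Complex.I * m * c * (φ (‖X‖ ^ 2) * evalAt X (p u)) := by
  rw [D, map_smul, LinearMap.smul_apply, map_smul, hp.fderiv_J hφ, Complex.real_smul]
  ring

/-- Expansion in monomials separates `X` from `u` with finitely many terms. Through it X-derivatives
pass the projection, and twisted functions become finite sums of products `a(X) b(Z)`. -/
theorem IsHarmonicFamily.sphereProj_eq_sum (hp : N.IsHarmonicFamily n m p) (s : ℕ) (ψ : Vec k → ℂ)
    (X : Vec k) (u : USphere l) : sphereProj l s (fun u => ψ X * evalAt X (p u)) u =
      ∑ α ∈ degreeExps k n, ψ X * evalAt X (MvPolynomial.monomial α 1) *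
        sphereProj l s (fun u => (p u).coeff α) u := by
  have h : (⟨fun u => ψ X * evalAt X (p u), continuous_const.mul (hp.continuous_evalAt X)⟩ :
      C(USphere l, ℂ)) = ∑ α ∈ degreeExps k n, (ψ X * evalAt X (MvPolynomial.monomial α 1)) •
        (⟨fun u => (p u).coeff α, hp.contCoeff α⟩ : C(USphere l, ℂ)) := by
    ext u
    simp only [ContinuousMap.coe_mk, ContinuousMap.sum_apply, ContinuousMap.smul_apply, smul_eq_mul]
    conv_lhs => rw [(hp.isHomogeneous u).eq_sum_degreeExps, evalAt_sum, Finset.mul_sum]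
    refine Finset.sum_congr rfl fun α _ => ?_
    simp [evalAt]
    ring
  have h2 := congrArg (fun g => sphereProjLin l s g u) h
  simpa [sphereProjLin, ContinuousMap.sum_apply] using h2

theorem IsHarmonicFamily.twisted_eq_sum (hp : N.IsHarmonicFamily n m p) (s : ℕ) (lam : ℝ)
    (ψ : Vec k → ℂ) (X : Vec k) (Z : Vec l) :
    twisted s lam (fun X u => ψ X * evalAt X (p u)) X Z =
      ∑ α ∈ degreeExps k n, ψ X * evalAt X (MvPolynomial.monomial α 1) *
        zFourier lam (sphereProj l s (fun u => (p u).coeff α)) Z := by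
  rw [twisted_eq, show sphereProj l s (fun u => ψ X * evalAt X (p u)) = _ from
    funext fun u => hp.sphereProj_eq_sum s ψ X u, zFourier_sum]
  · simp only [zFourier_const_mul]
  · exact fun α _ => continuous_const.mul (continuous_sphereProj (hp.contCoeff α))

/-- Applying `twistLin` to the coefficients in `u` commutes with the Laplacian in `X`, so
harmonicity and degree survive the projection and the integration. This makes `Δ_X` computable on
twisted functions. -/
theorem IsHarmonicFamily.exists_twisted_poly (hp : N.IsHarmonicFamily n m p) (s : ℕ) (lam : ℝ)
    (Z : Vec l) : ∃ P : MvPolynomial (Fin k) ℂ, P.IsHomogeneous n ∧ polyLaplacian P = 0 ∧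
      ∀ X, twisted s lam (fun X u => evalAt X (p u)) X Z = evalAt X P :=
  ⟨applyCoeff n (twistLin s lam Z) hp.contCoeff, applyCoeff_isHomogeneous _ _,
    polyLaplacian_applyCoeff _ _ hp.isHomogeneous hp.harmonic, fun X =>
      (evalAt_applyCoeff (twistLin s lam Z) hp.contCoeff hp.isHomogeneous X
        ⟨fun u => evalAt X (p u), hp.continuous_evalAt X⟩ fun _ => rfl).symm⟩

theorem IsHarmonicFamily.twisted_mul (hp : N.IsHarmonicFamily n m p) (s : ℕ) (lam : ℝ)
    (ψ : Vec k → ℂ) (X : Vec k) (Z : Vec l) :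
    twisted s lam (fun X u => ψ X * evalAt X (p u)) X Z =
      ψ X * twisted s lam (fun X u => evalAt X (p u)) X Z :=
  _root_.twisted_mul s lam ψ (hp.continuous_evalAt X) Z

/-- The exterior operator acts on the radial factor only. -/
theorem IsHarmonicFamily.exterior_eq (hp : N.IsHarmonicFamily n m p) {φ : ℝ → ℂ} {X : Vec k}
    (hφ : ContDiffAt ℝ 2 φ (‖X‖ ^ 2)) (s : ℕ) {lam : ℝ} (hlam : 0 ≤ lam) (Z : Vec l) :
    N.exterior s lam (fun X u => φ (‖X‖ ^ 2) * evalAt X (p u)) X Z =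
      radialExterior k n m lam φ (‖X‖ ^ 2) *
        twisted s lam (fun X u => evalAt X (p u)) X Z := by
  obtain ⟨P, hP, hP0, hPe⟩ := hp.exists_twisted_poly s lam Z
  have hT := hp.twisted_mul s lam fun X => φ (‖X‖ ^ 2)
  have hc : Continuous fun u => φ (‖X‖ ^ 2) * evalAt X (p u) :=
    continuous_const.mul (hp.continuous_evalAt X)
  have e1 : Laplacian.laplacian (twisted s lam (fun X u => φ (‖X‖ ^ 2) * evalAt X (p u)) X) Z =
      -lam * (φ (‖X‖ ^ 2) * evalAt X P) := by
    rw [twisted_eq, laplacian_zFourier hlam (continuous_sphereProj hc),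
      ← twisted_eq s lam (fun X u => φ (‖X‖ ^ 2) * evalAt X (p u)), hT, hPe]
  -- On this amplitude `D_K` is the scalar `i m √lam`, the same for all `u`, so it can be taken out
  -- of the projection.
  have e2 : N.orbital s lam (fun X u => φ (‖X‖ ^ 2) * evalAt X (p u)) X Z =
      -(m * Real.sqrt lam) * (φ (‖X‖ ^ 2) * evalAt X P) := by
    rw [orbital]
    simp only [hp.D_eq hφ]
    rw [sphereProj_const_mul _ hc, zFourier_const_mul, ← twisted_eq s lam
      (fun X u => φ (‖X‖ ^ 2) * evalAt X (p u)), hT, hPe]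
    linear_combination (m * Real.sqrt lam * (φ (‖X‖ ^ 2) * evalAt X P)) * Complex.I_sq
  rw [exterior, e1, e2]
  simp only [hT, hPe]
  rw [laplacian_radial_mul_evalAt hφ hP hP0, radialExterior]
  -- The radial operator is written in terms of `μ = √(lam / 4)`, whence `m √lam = 2 m μ`.
  have h4 : (Real.sqrt lam : ℂ) = 2 * (Real.sqrt (lam / 4) : ℂ) := by
    have : Real.sqrt lam = 2 * Real.sqrt (lam / 4) := by
      rw [Real.sqrt_div hlam, show (4 : ℝ) = 2 ^ 2 by norm_num, Real.sqrt_sq (by norm_num)]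
      ring
    rw [this]; push_cast; ring
  rw [h4]
  push_cast
  ring

/-- The Laplacian on twisted functions is the sum of the exterior and the intrinsic operator. -/
theorem IsHarmonicFamily.laplacian_twisted (hp : N.IsHarmonicFamily n m p) {φ : ℝ → ℂ} {X : Vec k}
    (hφ : ContDiffAt ℝ 2 φ (‖X‖ ^ 2)) (s : ℕ) (lam : ℝ) (Z : Vec l) :
    N.laplacian (twisted s lam fun X u => φ (‖X‖ ^ 2) * evalAt X (p u)) X Z =
      N.exterior s lam (fun X u => φ (‖X‖ ^ 2) * evalAt X (p u)) X Z +
        N.intrinsic s lam (fun X u => φ (‖X‖ ^ 2) * evalAt X (p u)) X Z := by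
  set S := degreeExps k n
  set a : (Fin k →₀ ℕ) → Vec k → ℂ := fun α X =>
    φ (‖X‖ ^ 2) * evalAt X (MvPolynomial.monomial α 1) with ha
  set c : (Fin k →₀ ℕ) → USphere l → ℂ := fun α => sphereProj l s fun u => (p u).coeff α with hc
  have hcc : ∀ α, Continuous (c α) := fun α => continuous_sphereProj (hp.contCoeff α)
  have hac : ∀ α, ContDiffAt ℝ 2 (a α) X := fun α => contDiffAt_radial_mul_evalAt hφ _
  have hbc : ∀ α, ContDiff ℝ 2 (zFourier lam (c α)) := fun α => contDiff_zFourier lam (hcc α) 2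
  have hT : (twisted s lam fun X u => φ (‖X‖ ^ 2) * evalAt X (p u)) =
      fun X Z => ∑ α ∈ S, a α X * zFourier lam (c α) Z :=
    funext fun X => funext fun Z => hp.twisted_eq_sum s lam (fun X => φ (‖X‖ ^ 2)) X Z
  have hP : ∀ X u, sphereProj l s (fun u => φ (‖X‖ ^ 2) * evalAt X (p u)) u =
      ∑ α ∈ S, a α X * c α u := hp.sphereProj_eq_sum s fun X => φ (‖X‖ ^ 2)
  have hD : ∀ u : USphere l, N.D (Real.sqrt lam • (u : Vec l)) (fun X' => ∑ α ∈ S, a α X' * c α u) X =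
      ∑ α ∈ S, ∑ β, fderiv ℝ (a α) X (N.J (stdVec β) X) *
        (inner ℝ (stdVec β) (Real.sqrt lam • (u : Vec l)) : ℝ) * c α u := fun u => by
    have h1 : HasFDerivAt (fun X' => ∑ α ∈ S, a α X' * c α u)
        (∑ α ∈ S, c α u • fderiv ℝ (a α) X) X :=
      HasFDerivAt.fun_sum fun α _ => ((hac α).differentiableAt (by simp)).hasFDerivAt.mul_const _
    rw [D, h1.fderiv, sum_apply]
    refine Finset.sum_congr rfl fun α _ => ?_
    conv_lhs => rw [← sum_smul_stdVec (Real.sqrt lam • (u : Vec l))]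
    simp only [map_sum, map_smul, LinearMap.sum_apply, LinearMap.smul_apply, smul_apply]
    refine Finset.sum_congr rfl fun β _ => ?_
    rw [real_inner_comm, inner_stdVec, smul_eq_mul, Complex.real_smul]
    ring
  have hDc : Continuous fun u : USphere l => ∑ α ∈ S, ∑ β, fderiv ℝ (a α) X (N.J (stdVec β) X) *
      (inner ℝ (stdVec β) (Real.sqrt lam • (u : Vec l)) : ℝ) * c α u := by fun_prop
  have hSc : Continuous fun u => φ (‖X‖ ^ 2) * evalAt X (p u) :=
    continuous_const.mul (hp.continuous_evalAt X)
  -- The two terms with `D_K` under the projection cancel, leaving `D_K` applied after it; the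
  -- factor `i ⟨E_β, K⟩` is then what `∂_β` brings down from the phase.
  have hspin : N.orbital s lam (fun X u => φ (‖X‖ ^ 2) * evalAt X (p u)) X Z +
      N.intrinsic s lam (fun X u => φ (‖X‖ ^ 2) * evalAt X (p u)) X Z =
      ∑ α ∈ S, ∑ β, fderiv ℝ (a α) X (N.J (stdVec β) X) *
        fderiv ℝ (zFourier lam (c α)) Z (stdVec β) := by
    have hQ : Continuous (sphereProj l s fun u : USphere l => Complex.I * m * Real.sqrt lam *
        (φ (‖X‖ ^ 2) * evalAt X (p u))) := continuous_sphereProj (continuous_const.mul hSc)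
    rw [orbital, intrinsic]
    simp only [hp.D_eq hφ, hP, hD]
    rw [← mul_add, ← zFourier_add lam hQ (hDc.fun_sub hQ)]
    simp only [add_sub_cancel]
    rw [zFourier_sum lam _ fun α _ => by fun_prop, Finset.mul_sum]
    refine Finset.sum_congr rfl fun α _ => ?_
    rw [zFourier_sum lam _ fun β _ => by fun_prop, Finset.mul_sum]
    refine Finset.sum_congr rfl fun β _ => ?_
    rw [fderiv_zFourier lam (hcc α), ← zFourier_const_mul, ← zFourier_const_mul]
    congr 1
    ext u
    ring
  rw [exterior, add_assoc, hspin, hT, N.laplacian_sum_mul S (fun α _ => hac α)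
    fun α _ => (hbc α).contDiffAt]
  simp only [N.laplacian_mul (hac _) (hbc _).contDiffAt]
  rw [Finset.sum_add_distrib, Finset.sum_add_distrib,
    laplacian_sum_mul_const S (fun α _ => hac α), ← Finset.mul_sum]
  congr 3
  have h2 := laplacian_sum_mul_const S (fun α _ => (hbc α).contDiffAt (x := Z)) fun α => a α X
  simp only [mul_comm] at h2 ⊢
  rw [h2]

end family

end HType

/-! ### Plane waves -/

section wave

variable {l : ℕ}

/-- The plane wave `e^{i⟨w, Z⟩}`. -/
def planeWave (w Z : Vec l) : ℂ := Complex.exp (Complex.I * (inner ℝ w Z : ℝ))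

theorem hasFDerivAt_planeWave (w Z : Vec l) : HasFDerivAt (planeWave w)
    ((innerSL ℝ w).smulRight (Complex.I * planeWave w Z)) Z := by
  have h1 := (Complex.I • Complex.ofRealCLM.comp (innerSL ℝ w)).hasFDerivAt (x := Z)
  refine h1.cexp.congr_fderiv ?_
  ext v
  simp [planeWave]
  ring

theorem contDiff_planeWave (w : Vec l) {n : WithTop ℕ∞} : ContDiff ℝ n (planeWave w) :=
  ContDiff.cexp (contDiff_const.mul (Complex.ofRealCLM.contDiff.comp (innerSL ℝ w).contDiff))

theorem fderiv_planeWave (w Z v : Vec l) :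
    fderiv ℝ (planeWave w) Z v = Complex.I * (inner ℝ w v : ℝ) * planeWave w Z := by
  rw [(hasFDerivAt_planeWave w Z).fderiv]
  simp
  ring

theorem laplacian_planeWave (w Z : Vec l) :
    Laplacian.laplacian (planeWave w) Z = -(‖w‖ : ℂ) ^ 2 * planeWave w Z := by
  rw [laplacian_eq_sum_fderiv]
  have h : ∀ i : Fin l, fderiv ℝ (fderiv ℝ (planeWave w)) Z (stdVec i) (stdVec i) =
      -((w i ^ 2 : ℝ) : ℂ) * planeWave w Z := fun i => by
    have h1 := ((contDiff_planeWave w (n := 2)).contDiffAt (x := Z)).hasDerivAt_fderiv_line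
      (stdVec i) (stdVec i)
    simp only [fderiv_planeWave, inner_stdVec] at h1
    have h2 := (((contDiff_planeWave w (n := 2)).contDiffAt (x := Z)).hasDerivAt_line
      (by simp) (stdVec i)).const_mul (Complex.I * (w i : ℂ))
    rw [h1.unique h2, fderiv_planeWave, inner_stdVec]
    push_cast
    linear_combination (w i : ℂ) ^ 2 * planeWave w Z * Complex.I_sq
  simp only [h]
  rw [← Finset.sum_mul, Finset.sum_neg_distrib, ← Complex.ofReal_sum, sum_sq_eq_norm_sq]
  push_cast
  ring

end wave

namespace HType

variable {k l : ℕ} {N : HType k l} {n : ℕ} {m : ℤ} {p : USphere l → MvPolynomial (Fin k) ℂ}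

/-- The Laplacian on the functions of a Z-crystal. -/
theorem IsHarmonicFamily.laplacian_crystal (hp : N.IsHarmonicFamily n m p) {φ : ℝ → ℂ} {X : Vec k}
    (hφ : ContDiffAt ℝ 2 φ (‖X‖ ^ 2)) (μ : ℝ) (u : USphere l) (Z : Vec l) :
    N.laplacian (fun X' Z' => φ (‖X'‖ ^ 2) * evalAt X' (p u) *
        Complex.exp (2 * Real.pi * Complex.I *
          (inner ℝ ((μ / Real.pi) • (u : Vec l)) Z' : ℝ))) X Z =
      radialGLZ k n m μ φ (‖X‖ ^ 2) * evalAt X (p u) *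
        Complex.exp (2 * Real.pi * Complex.I *
          (inner ℝ ((μ / Real.pi) • (u : Vec l)) Z : ℝ)) := by
  -- Since `Z_γ = (μ / π) u`, the frequency `2π Z_γ` is `2μ u`, the counterpart of `K = √lam u`.
  have hw : ∀ Z' : Vec l, Complex.exp (2 * Real.pi * Complex.I *
      (inner ℝ ((μ / Real.pi) • (u : Vec l)) Z' : ℝ)) = planeWave ((2 * μ) • (u : Vec l)) Z' :=
    fun Z' => by
    rw [planeWave, real_inner_smul_left, real_inner_smul_left]
    congr 1
    have hpi : (Real.pi : ℂ) ≠ 0 := by exact_mod_cast Real.pi_ne_zero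
    push_cast
    field_simp
  simp only [hw]
  rw [N.laplacian_mul (contDiffAt_radial_mul_evalAt hφ (p u)) (contDiff_planeWave _).contDiffAt,
    laplacian_radial_mul_evalAt hφ (hp.isHomogeneous u) (hp.harmonic u), laplacian_planeWave]
  have h1 : ∑ β, fderiv ℝ (fun X => φ (‖X‖ ^ 2) * evalAt X (p u)) X (N.J (stdVec β) X) *
      fderiv ℝ (planeWave ((2 * μ) • (u : Vec l))) Z (stdVec β) =
      Complex.I * (2 * μ) * planeWave ((2 * μ) • (u : Vec l)) Z *
        (Complex.I * m * (φ (‖X‖ ^ 2) * evalAt X (p u))) := by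
    rw [← hp.fderiv_J hφ u]
    conv_rhs => rw [← sum_smul_stdVec (u : Vec l)]
    simp only [map_sum, map_smul, LinearMap.sum_apply, LinearMap.smul_apply, Finset.mul_sum]
    rw [sum_smul_stdVec]
    refine Finset.sum_congr rfl fun β _ => ?_
    rw [fderiv_planeWave, inner_stdVec, Complex.real_smul]
    simp
    ring
  have h2 : (‖(2 * μ) • (u : Vec l)‖ : ℂ) ^ 2 = 4 * (μ : ℂ) ^ 2 := by
    rw [norm_smul, norm_eq_of_mem_sphere, mul_one, Real.norm_eq_abs, ← Complex.ofReal_pow, sq_abs]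
    push_cast; ring
  rw [h1, h2, radialGLZ]
  push_cast
  linear_combination (2 * μ * m * planeWave ((2 * μ) • (u : Vec l)) Z * φ (‖X‖ ^ 2) *
    evalAt X (p u)) * Complex.I_sq

end HType

/-! ### The radial operators and the radial eigenvalue problem -/

theorem radialExterior_eq_radialGLZ (k n : ℕ) (m : ℤ) {lam : ℝ} (hlam : 0 ≤ lam) :
    radialExterior k n m lam = radialGLZ k n m (Real.sqrt (lam / 4)) := by
  ext f t
  have h : ((Real.sqrt (lam / 4) : ℝ) : ℂ) ^ 2 = (lam : ℂ) / 4 := by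
    rw [← Complex.ofReal_pow, Real.sq_sqrt (by positivity)]
    push_cast; ring
  rw [radialExterior, radialGLZ, h]

/-- The radial operator maps twice continuously differentiable functions to continuous ones. -/
theorem continuousAt_radialExterior (k n : ℕ) (m : ℤ) (lam : ℝ) {φ : ℝ → ℂ} {t : ℝ}
    (hφ : ContDiffAt ℝ 2 φ t) : ContinuousAt (radialExterior k n m lam φ) t := by
  have h1 := hφ.deriv_one
  have h2 := hφ.continuousAt_iteratedDeriv_two
  have h3 := h1.continuousAt
  have h4 := hφ.continuousAt
  unfold radialExterior
  fun_prop

namespace HType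

variable {k l : ℕ} {N : HType k l} {n : ℕ} {m : ℤ} {p : USphere l → MvPolynomial (Fin k) ℂ}

/-- The eigenvalue problem of the exterior operator reduces to the radial one. -/
theorem IsHarmonicFamily.exterior_eigen_iff (hp : N.IsHarmonicFamily n m p) (hk : 0 < k)
    {φ : ℝ → ℂ} {ρ : ENNReal} {R : ℝ}
    (hφ : ∀ X : Vec k, ENNReal.ofReal ‖X‖ < ρ → ContDiffAt ℝ 2 φ (‖X‖ ^ 2)) (s : ℕ) {lam : ℝ}
    (hlam : 0 ≤ lam) (hne : ∃ X Z, (X, Z) ∈ zBallBundle k l ρ R ∧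
      twisted s lam (fun X u => evalAt X (p u)) X Z ≠ 0) (ν : ℂ) :
    (∀ X Z, (X, Z) ∈ zBallBundle k l ρ R →
      N.exterior s lam (fun X u => φ (‖X‖ ^ 2) * evalAt X (p u)) X Z =
        ν * twisted s lam (fun X u => φ (‖X‖ ^ 2) * evalAt X (p u)) X Z) ↔
      ∀ X : Vec k, ENNReal.ofReal ‖X‖ < ρ →
        radialExterior k n m lam φ (‖X‖ ^ 2) = ν * φ (‖X‖ ^ 2) := by
  have hT := hp.twisted_mul s lam fun X => φ (‖X‖ ^ 2)
  constructor
  · intro h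
    obtain ⟨X₀, Z₀, ⟨hX₀, hZ₀⟩, hne⟩ := hne
    obtain ⟨P, hP, -, hPe⟩ := hp.exists_twisted_poly s lam Z₀
    rw [hPe] at hne
    have key : ∀ X : Vec k, ENNReal.ofReal ‖X‖ < ρ → evalAt X P ≠ 0 →
        radialExterior k n m lam φ (‖X‖ ^ 2) = ν * φ (‖X‖ ^ 2) := fun X hX hX0 => by
      have h1 := h X Z₀ ⟨hX, hZ₀⟩
      rw [hp.exterior_eq (hφ X hX) s hlam, hT, hPe, ← mul_assoc] at h1
      exact mul_right_cancel₀ hX0 h1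
    -- Homogeneity rescales a nonzero value to the unit sphere. A nonzero value at `X₀ = 0` forces
    -- `n = 0`; then `P` is constant and any unit vector serves.
    have hex : ∃ e : Vec k, ‖e‖ = 1 ∧ evalAt e P ≠ 0 := by
      by_cases h0 : X₀ = 0
      · refine ⟨stdVec ⟨0, hk⟩, norm_stdVec _, ?_⟩
        have hn : n = 0 := by
          by_contra hn
          apply hne
          have := evalAt_smul_homogeneous hP 0 X₀
          rw [h0] at this ⊢
          simpa [hn] using this
        subst hn
        have := evalAt_smul_homogeneous hP 0 (stdVec ⟨0, hk⟩)
        rw [zero_smul, ← h0] at this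
        simpa [this] using hne
      · refine ⟨‖X₀‖⁻¹ • X₀, by rw [norm_smul, norm_inv, norm_norm]; field_simp, ?_⟩
        rw [evalAt_smul_homogeneous hP]
        refine mul_ne_zero (pow_ne_zero _ ?_) hne
        simpa using h0
    obtain ⟨e, he, heP⟩ := hex
    -- The radial equation depends on `‖X‖` only, so the single ray through `e`, where `P` has no
    -- positive zero, yields every radius.
    have hpos : ∀ r : ℝ, 0 < r → ENNReal.ofReal r < ρ →
        radialExterior k n m lam φ (r ^ 2) = ν * φ (r ^ 2) := fun r hr hrρ => by
      have h1 : ‖r • e‖ = r := by rw [norm_smul, he, mul_one, Real.norm_eq_abs, abs_of_pos hr]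
      have h2 := key (r • e) (by rwa [h1]) (by
        rw [evalAt_smul_homogeneous hP]
        exact mul_ne_zero (pow_ne_zero _ (by exact_mod_cast hr.ne')) heP)
      rwa [h1] at h2
    intro X hX
    rcases (norm_nonneg X).eq_or_lt with h0 | h0
    -- At the origin `P` vanishes when `n > 0`; the equation is obtained as the limit `r → 0⁺`, both
    -- sides being continuous.
    · have hφ0 := hφ X hX
      rw [← h0] at hX hφ0 ⊢
      have hsq : Tendsto (fun r : ℝ => r ^ 2) (𝓝[>] 0) (𝓝 (0 ^ 2)) :=
        ((continuous_pow 2).tendsto 0).mono_left nhdsWithin_le_nhds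
      have t1 := (continuousAt_radialExterior k n m lam hφ0).tendsto.comp hsq
      have t2 := (hφ0.continuousAt.tendsto.const_mul ν).comp hsq
      refine tendsto_nhds_unique_of_eventuallyEq t1 t2 ?_
      have h3 : ∀ᶠ r in 𝓝[>] (0 : ℝ), ENNReal.ofReal r < ρ :=
        ((ENNReal.continuous_ofReal.tendsto 0).mono_left nhdsWithin_le_nhds).eventually
          (gt_mem_nhds hX)
      filter_upwards [h3, self_mem_nhdsWithin] with r hr hr0 using hpos r hr0 hr
    · exact hpos _ h0 hX
  · rintro h X Z ⟨hX, -⟩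
    rw [hp.exterior_eq (hφ X hX) s hlam, hT, h X hX, mul_assoc]

end HType

/-! ### Integration over spheres -/

section polar

variable {l : ℕ}

/-- Polar coordinates for products of a radial and an angular function. -/
theorem integral_polar (hl : 0 < l) (f : Vec l → ℂ) (g : ℝ → ℂ) (Q : USphere l → ℂ)
    (h : ∀ r : ℝ, 0 < r → ∀ u : USphere l, f (r • (u : Vec l)) = g r * Q u) :
    ∫ x, f x = (∫ r : Set.Ioi (0 : ℝ), g r ∂Measure.volumeIoiPow (Module.finrank ℝ (Vec l) - 1)) *
      ∫ u, Q u ∂sphereMeasure l := by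
  have : Nontrivial (Vec l) := ⟨stdVec ⟨0, hl⟩, 0, fun h0 => by
    have := norm_stdVec (⟨0, hl⟩ : Fin l)
    rw [h0, norm_zero] at this
    exact zero_ne_one this⟩
  calc
    ∫ x, f x = ∫ x : ({(0)}ᶜ : Set (Vec l)), f x ∂((volume : Measure (Vec l)).comap (↑)) := by
      rw [integral_subtype_comap (measurableSet_singleton _).compl f, restrict_compl_singleton]
    _ = ∫ x : ({(0)}ᶜ : Set (Vec l)), (fun z : USphere l × Set.Ioi (0 : ℝ) => Q z.1 * g z.2)
          (homeomorphUnitSphereProd (Vec l) x) ∂((volume : Measure (Vec l)).comap (↑)) := by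
      refine integral_congr_ae (Eventually.of_forall fun x => ?_)
      have hx : 0 < ‖(x : Vec l)‖ := norm_pos_iff.2 x.2
      have h1 := h ‖(x : Vec l)‖ hx (homeomorphUnitSphereProd (Vec l) x).1
      have h2 : ‖(x : Vec l)‖ • ((homeomorphUnitSphereProd (Vec l) x).1 : Vec l) = x := by
        simp [smul_smul, hx.ne']
      rw [h2] at h1
      simp only [h1, homeomorphUnitSphereProd_apply_snd_coe, mul_comm]
    _ = ∫ z, Q z.1 * g z.2 ∂((volume : Measure (Vec l)).toSphere.prod
          (Measure.volumeIoiPow (Module.finrank ℝ (Vec l) - 1))) :=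
      (volume : Measure (Vec l)).measurePreserving_homeomorphUnitSphereProd.integral_comp
        (Homeomorph.measurableEmbedding _) fun z : USphere l × Set.Ioi (0 : ℝ) => Q z.1 * g z.2
    _ = _ := by
      rw [integral_prod_mul Q fun r : Set.Ioi (0 : ℝ) => g r, mul_comm]
      rfl

/-- Integration by parts against the constant function `1`. -/
theorem integral_fderiv_eq_zero {f : Vec l → ℂ} (hf : ContDiff ℝ 1 f) (hc : HasCompactSupport f)
    (v : Vec l) : ∫ x, fderiv ℝ f x v = 0 := by
  have hi : Integrable (fun x => fderiv ℝ f x v) :=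
    ((hf.continuous_fderiv (by simp)).clm_apply continuous_const).integrable_of_hasCompactSupport
      (hc.fderiv_apply ℝ v)
  have h := integral_mul_fderiv_eq_neg_fderiv_mul_of_integrable (μ := (volume : Measure (Vec l)))
    (f := fun _ => (1 : ℂ)) (g := f) (v := v) (by simp) (by simpa using hi)
    (by simpa using hf.continuous.integrable_of_hasCompactSupport hc)
    (fun _ _ => differentiableAt_const _) fun x _ => hf.differentiable (by simp) x
  simpa using h

/-- A continuously differentiable cutoff function. -/
def cutoff (t : ℝ) : ℝ := (max 0 (1 - t)) ^ 2

theorem hasDerivAt_cutoff (t : ℝ) : HasDerivAt cutoff (-2 * max 0 (1 - t)) t := by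
  rcases lt_trichotomy t 1 with h | h | h
  · have h1 : cutoff =ᶠ[𝓝 t] fun t => (1 - t) ^ 2 := by
      filter_upwards [gt_mem_nhds h] with x hx
      rw [cutoff, max_eq_right (by linarith)]
    rw [max_eq_right (by linarith)]
    refine HasDerivAt.congr_of_eventuallyEq ?_ h1
    exact (((hasDerivAt_id t).const_sub 1).pow 2).congr_deriv (by simp)
  · subst h
    -- At the junction point the cutoff is bounded by `|x - 1|²`, which forces a zero derivative.
    have h1 : HasFDerivAt cutoff (0 : ℝ →L[ℝ] ℝ) 1 := by
      refine Asymptotics.IsBigO.hasFDerivAt (n := 2) (Asymptotics.IsBigO.of_bound 1 ?_) one_lt_two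
      refine Eventually.of_forall fun x => ?_
      rw [cutoff, one_mul, norm_pow, norm_pow, norm_norm]
      gcongr
      rw [Real.norm_eq_abs, Real.norm_eq_abs, abs_of_nonneg (le_max_left _ _)]
      exact max_le (abs_nonneg _) (by rw [abs_sub_comm]; exact le_abs_self _)
    simpa using h1.hasDerivAt
  · have h1 : cutoff =ᶠ[𝓝 t] fun _ => 0 := by
      filter_upwards [lt_mem_nhds h] with x hx
      rw [cutoff, max_eq_left (by linarith)]
      norm_num
    rw [max_eq_left (by linarith), mul_zero]
    exact (hasDerivAt_const t 0).congr_of_eventuallyEq h1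

theorem cutoff_eq_zero {t : ℝ} (h : 1 ≤ t) : cutoff t = 0 := by
  rw [cutoff, max_eq_left (by linarith)]; norm_num

/-- Spherical harmonics of different orders are orthogonal. -/
theorem integral_harmonic_mul_harmonic (hl : 0 < l) {i j : ℕ} (hij : i ≠ j)
    {p q : MvPolynomial (Fin l) ℂ} (hp : p.IsHomogeneous i) (hq : q.IsHomogeneous j)
    (hp0 : polyLaplacian p = 0) (hq0 : polyLaplacian q = 0) :
    ∫ u : USphere l, evalAt (u : Vec l) p * evalAt (u : Vec l) q ∂sphereMeasure l = 0 := by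
  set χ : ℝ → ℂ := fun t => (cutoff t : ℂ)
  have hχ : ∀ t, HasDerivAt χ ((-2 * max 0 (1 - t) : ℝ) : ℂ) t := fun t =>
    (hasDerivAt_cutoff t).ofReal_comp
  have hχd : deriv χ = fun t => ((-2 * max 0 (1 - t) : ℝ) : ℂ) := funext fun t => (hχ t).deriv
  have hχ1 : ContDiff ℝ 1 χ := by
    rw [contDiff_one_iff_deriv, hχd]
    exact ⟨fun t => (hχ t).differentiableAt, by fun_prop⟩
  -- Green's field `p ∇q - q ∇p`: it is divergence free since `p` and `q` are harmonic, and by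
  -- Euler's identity its product with the position vector is `(j - i) p q`.
  set W : Fin l → MvPolynomial (Fin l) ℂ := fun a =>
    p * MvPolynomial.pderiv a q - q * MvPolynomial.pderiv a p with hW
  have hW1 : ∑ a, MvPolynomial.pderiv a (W a) = 0 := by
    have : ∀ a, MvPolynomial.pderiv a (W a) =
        p * MvPolynomial.pderiv a (MvPolynomial.pderiv a q) -
          q * MvPolynomial.pderiv a (MvPolynomial.pderiv a p) := fun a => by
      simp only [hW, map_sub, Derivation.leibniz, smul_eq_mul]
      ring
    simp only [this, Finset.sum_sub_distrib, ← Finset.mul_sum]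
    unfold polyLaplacian at hp0 hq0
    rw [hp0, hq0, mul_zero, mul_zero, sub_zero]
  have hW2 : ∑ a, MvPolynomial.X a * W a = MvPolynomial.C ((j : ℂ) - i) * (p * q) := by
    have e1 := hp.sum_X_mul_pderiv
    have e2 := hq.sum_X_mul_pderiv
    have : ∀ a, MvPolynomial.X a * W a = p * (MvPolynomial.X a * MvPolynomial.pderiv a q) -
        q * (MvPolynomial.X a * MvPolynomial.pderiv a p) := fun a => by
      simp only [hW]; ring
    simp only [this, Finset.sum_sub_distrib, ← Finset.mul_sum, e1, e2]
    simp
    ring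
  have hsupp : ∀ P : MvPolynomial (Fin l) ℂ,
      HasCompactSupport fun x : Vec l => χ (‖x‖ ^ 2) * evalAt x P := fun P => by
    refine HasCompactSupport.of_support_subset_isCompact (isCompact_closedBall (0 : Vec l) 1) ?_
    intro x hx
    rw [mem_closedBall_zero_iff]
    by_contra hx1
    refine hx ?_
    simp only [χ]
    rw [cutoff_eq_zero (by nlinarith)]
    simp
  have hcd : ∀ P : MvPolynomial (Fin l) ℂ,
      ContDiff ℝ 1 fun x : Vec l => χ (‖x‖ ^ 2) * evalAt x P := fun P =>
    (hχ1.comp (contDiff_norm_sq ℝ)).mul (contDiff_evalAt P)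
  have hfd : ∀ a x, fderiv ℝ (fun x : Vec l => χ (‖x‖ ^ 2) * evalAt x (W a)) x (stdVec a) =
      2 * deriv χ (‖x‖ ^ 2) * evalAt x (MvPolynomial.X a * W a) +
        χ (‖x‖ ^ 2) * evalAt x (MvPolynomial.pderiv a (W a)) := fun a x => by
    rw [((hasFDerivAt_radial (hχ (‖x‖ ^ 2)).differentiableAt).fun_mul
      (hasFDerivAt_evalAt (W a) x)).fderiv]
    simp only [add_apply, smul_apply, evalAtDeriv_stdVec, ContinuousLinearMap.smulRight_apply,
      innerSL_apply_apply, inner_stdVec, evalAt_mul, evalAt_X, smul_eq_mul, nsmul_eq_mul,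
      Complex.real_smul]
    push_cast
    ring
  -- The divergence of the compactly supported field `χ(‖x‖²) W` integrates to zero, and only the
  -- derivative of the cutoff contributes.
  have hint : ∫ x : Vec l, 2 * ((j : ℂ) - i) * (deriv χ (‖x‖ ^ 2) * evalAt x (p * q)) = 0 := by
    have h0 : ∑ a, ∫ x, fderiv ℝ (fun x : Vec l => χ (‖x‖ ^ 2) * evalAt x (W a)) x (stdVec a) = 0 :=
      Finset.sum_eq_zero fun a _ => integral_fderiv_eq_zero (hcd _) (hsupp _) _
    rw [← h0, ← integral_finsetSum]
    · refine integral_congr_ae (Eventually.of_forall fun x => ?_)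
      simp only [hfd, Finset.sum_add_distrib, ← Finset.mul_sum, ← evalAt_sum, hW1, hW2]
      simp [evalAt]
      ring
    · exact fun a _ => (((hcd (W a)).continuous_fderiv (by simp)).clm_apply
        continuous_const).integrable_of_hasCompactSupport ((hsupp (W a)).fderiv_apply ℝ _)
  have hc0 : (2 * ((j : ℂ) - i)) ≠ 0 := by
    refine mul_ne_zero two_ne_zero (sub_ne_zero.2 ?_)
    exact_mod_cast hij.symm
  rw [integral_const_mul] at hint
  have hint2 := (mul_eq_zero.1 hint).resolve_left hc0
  have hpol := integral_polar hl (fun x : Vec l => deriv χ (‖x‖ ^ 2) * evalAt x (p * q))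
    (fun r => ((-2 * max 0 (1 - r ^ 2) : ℝ) : ℂ) * (r : ℂ) ^ (i + j))
    (fun u => evalAt (u : Vec l) p * evalAt (u : Vec l) q) fun r hr u => by
      rw [evalAt_smul_homogeneous (hp.mul hq), hχd, norm_smul, norm_eq_of_mem_sphere, mul_one,
        Real.norm_eq_abs, sq_abs, evalAt_mul]
      ring
  rw [hint2] at hpol
  refine (mul_eq_zero.1 hpol.symm).resolve_left fun hr => ?_
  -- If the radial integral were zero, polar coordinates with angular factor `1` would give `∫ f =
  -- 0` for a continuous nonnegative `f` that is not identically zero.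
  set f : Vec l → ℝ := fun x => 2 * max 0 (1 - ‖x‖ ^ 2) * ‖x‖ ^ (i + j) with hf
  have hpol2 := integral_polar hl (fun x : Vec l => -(f x : ℂ))
    (fun r => ((-2 * max 0 (1 - r ^ 2) : ℝ) : ℂ) * (r : ℂ) ^ (i + j))
    (fun u => 1) fun r hr u => by
      simp only [hf]
      rw [norm_smul, norm_eq_of_mem_sphere, mul_one, Real.norm_eq_abs, abs_of_pos hr]
      push_cast
      ring
  rw [hr, zero_mul, integral_neg, neg_eq_zero, integral_complex_ofReal,
    Complex.ofReal_eq_zero] at hpol2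
  have hfc : Continuous f := by fun_prop
  have hpos := hfc.integral_pos_of_hasCompactSupport_nonneg_nonzero (μ := volume)
    (x := (1 / 2 : ℝ) • stdVec ⟨0, hl⟩) ?_ (fun x => by simp only [hf, Pi.zero_apply]; positivity) ?_
  · exact hpos.ne' hpol2
  · refine HasCompactSupport.of_support_subset_isCompact (isCompact_closedBall (0 : Vec l) 1) ?_
    intro x hx
    rw [mem_closedBall_zero_iff]
    by_contra hx1
    refine hx ?_
    simp only [hf]
    rw [max_eq_left (by nlinarith)]
    simp
  · simp only [hf]
    rw [norm_smul, norm_stdVec, mul_one, Real.norm_eq_abs, abs_of_pos (by norm_num)]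
    refine mul_ne_zero ?_ (by positivity)
    norm_num

end polar

/-! ### Moments of spherical harmonics -/

section moments

open MvPolynomial

variable {l : ℕ}

/-- On the unit sphere `⟨X, X⟩ = 1`, so a polynomial agrees with its harmonic projection up to one
of degree two less; this drives a descent on the degree. The clause for `n < 2` is needed because `n
- 2` is truncated. -/
theorem harmonicProj_eq_add {d n : ℕ} {P : MvPolynomial (Fin d) ℂ} (hP : P.IsHomogeneous n) :
    ∃ Q : MvPolynomial (Fin d) ℂ, Q.IsHomogeneous (n - 2) ∧ (n < 2 → Q = 0) ∧
      harmonicProj n P = P + normSqPoly d * Q := by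
  refine ⟨∑ s ∈ Finset.range (n / 2), C (projCoeff d n (s + 1) : ℂ) * normSqPoly d ^ s *
    polyLaplacian^[s + 1] P, IsHomogeneous.sum _ _ _ fun s hs => ?_, fun h => ?_, ?_⟩
  · have h := ((isHomogeneous_C (Fin d) (projCoeff d n (s + 1) : ℂ)).mul
      ((isHomogeneous_normSqPoly (d := d)).pow s)).mul
        (polyLaplacian_iterate_isHomogeneous hP (s + 1))
    have hs' := Finset.mem_range.1 hs
    rwa [show 0 + 2 * s + (n - 2 * (s + 1)) = n - 2 by omega] at h
  · rw [show n / 2 = 0 by omega, Finset.range_zero, Finset.sum_empty]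
  · rw [harmonicProj, Finset.sum_range_succ', Finset.mul_sum, add_comm]
    congr 1
    · simp [projCoeff]
    · refine Finset.sum_congr rfl fun s _ => ?_
      rw [normSqPoly, pow_succ]
      ring

theorem evalAt_normSqPoly_sphere (u : USphere l) : evalAt (u : Vec l) (normSqPoly l) = 1 := by
  rw [evalAt_normSqPoly, norm_eq_of_mem_sphere]; simp

/-- Spherical harmonics are orthogonal to all polynomials of smaller degree. -/
theorem integral_mul_harmonic_of_lt (hl : 0 < l) {s : ℕ} {H : MvPolynomial (Fin l) ℂ}
    (hH : H.IsHomogeneous s) (hH0 : polyLaplacian H = 0) (j : ℕ) (hj : j < s)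
    {p : MvPolynomial (Fin l) ℂ} (hp : p.IsHomogeneous j) :
    ∫ u : USphere l, evalAt (u : Vec l) p * evalAt (u : Vec l) H ∂sphereMeasure l = 0 := by
  induction j using Nat.strong_induction_on generalizing p with
  | _ j ih =>
    obtain ⟨Q, hQ, hQ0, he⟩ := harmonicProj_eq_add hp
    have h1 := integral_harmonic_mul_harmonic hl hj.ne (harmonicProj_isHomogeneous hp) hH
      (polyLaplacian_harmonicProj hl hp) hH0
    have h2 : ∫ u : USphere l, evalAt (u : Vec l) Q * evalAt (u : Vec l) H ∂sphereMeasure l = 0 := by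
      by_cases h : j < 2
      · rw [hQ0 h]; simp [evalAt]
      · exact ih (j - 2) (by omega) (by omega) hQ
    have h3 : ∀ u : USphere l, evalAt (u : Vec l) p * evalAt (u : Vec l) H =
        evalAt (u : Vec l) (harmonicProj j p) * evalAt (u : Vec l) H -
          evalAt (u : Vec l) Q * evalAt (u : Vec l) H := fun u => by
      rw [he, evalAt_add, evalAt_mul, evalAt_normSqPoly_sphere]
      ring
    simp only [h3]
    rw [integral_sub, h1, h2, sub_zero]
    · exact integrable_sphere ((continuous_evalAt _).mul (continuous_evalAt _))
    · exact integrable_sphere ((continuous_evalAt _).mul (continuous_evalAt _))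

/-- The linear form `⟨u, X⟩` as a polynomial. -/
def linForm (u : USphere l) : MvPolynomial (Fin l) ℂ := ∑ i, C (((u : Vec l) i : ℝ) : ℂ) * X i

theorem evalAt_linForm (u : USphere l) (x : Vec l) :
    evalAt x (linForm u) = (inner ℝ x (u : Vec l) : ℝ) := by
  rw [linForm, evalAt_sum, PiLp.inner_apply]
  simp [evalAt]

theorem isHomogeneous_linForm_pow (j : ℕ) (u : USphere l) : (linForm u ^ j).IsHomogeneous j := by
  have h : (linForm u).IsHomogeneous 1 := IsHomogeneous.sum _ _ _ fun i _ => isHomogeneous_C_mul_X _ i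
  simpa using h.pow j

theorem contCoeff_linForm_pow (j : ℕ) : ContCoeff fun u : USphere l => linForm u ^ j :=
  ContCoeff.pow (ContCoeff.sum _ fun i _ =>
    (contCoeff_C (by fun_prop)).mul (contCoeff_const _)) j

/-- The gradient of the form is the unit vector `u`. For `j < 2` the truncated exponent is harmless,
as `j (j - 1) = 0`. -/
theorem polyLaplacian_linForm_pow (j : ℕ) (u : USphere l) :
    polyLaplacian (linForm u ^ j) = C (j * (j - 1) : ℂ) * linForm u ^ (j - 2) := by
  have h1 : ∀ i, pderiv i (linForm u) = C (((u : Vec l) i : ℝ) : ℂ) := fun i => by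
    simp [linForm, pderiv_X, Pi.single_apply]
  have h2 : ∀ i, pderiv i (pderiv i (linForm u ^ j)) =
      C (j * (j - 1) : ℂ) * linForm u ^ (j - 2) * C (((u : Vec l) i : ℂ) ^ 2) := fun i => by
    rcases j with _ | _ | j
    · simp
    · simp [h1]
    · simp [Derivation.leibniz_pow, h1]
      ring
  simp only [polyLaplacian, h2]
  rw [← Finset.mul_sum, ← map_sum]
  have h5 : ∑ i, ((u : Vec l) i : ℂ) ^ 2 = 1 := by
    have := sum_sq_eq_norm_sq (u : Vec l)
    rw [norm_eq_of_mem_sphere] at this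
    exact_mod_cast (by simpa using this)
  rw [h5, C_1, mul_one]

/-- Integration against a continuous density as a linear functional. -/
def densityLin (h : C(USphere l, ℂ)) : C(USphere l, ℂ) →ₗ[ℂ] ℂ where
  toFun g := ∫ u, g u * h u ∂sphereMeasure l
  map_add' g g' := by
    have h1 := integrable_sphere (l := l) (g.continuous.mul h.continuous)
    have h2 := integrable_sphere (l := l) (g'.continuous.mul h.continuous)
    simp only [Pi.mul_def] at h1 h2
    simp only [ContinuousMap.add_apply, add_mul]
    exact integral_add h1 h2
  map_smul' c g := by
    simp only [ContinuousMap.smul_apply, smul_eq_mul, mul_assoc, RingHom.id_apply]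
    exact integral_const_mul c _

/-- A polynomial as a continuous function on the sphere. -/
def evalSphere (P : MvPolynomial (Fin l) ℂ) : C(USphere l, ℂ) :=
  ⟨fun u => evalAt (u : Vec l) P, continuous_evalAt P⟩

/-- The moment `∫ ⟨x, u⟩ʲ H(u) du` as a polynomial in `x`. -/
def momentPoly (j : ℕ) (H : MvPolynomial (Fin l) ℂ) : MvPolynomial (Fin l) ℂ :=
  applyCoeff j (densityLin (evalSphere H)) (contCoeff_linForm_pow j)

theorem momentPoly_isHomogeneous (j : ℕ) (H : MvPolynomial (Fin l) ℂ) :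
    (momentPoly j H).IsHomogeneous j := applyCoeff_isHomogeneous _ _

theorem evalAt_momentPoly (j : ℕ) (H : MvPolynomial (Fin l) ℂ) (x : Vec l) :
    evalAt x (momentPoly j H) = ∫ u : USphere l,
      ((inner ℝ x (u : Vec l) : ℝ) : ℂ) ^ j * evalAt (u : Vec l) H ∂sphereMeasure l :=
  evalAt_applyCoeff (densityLin (evalSphere H)) (contCoeff_linForm_pow j)
    (isHomogeneous_linForm_pow j) x
    ⟨fun u => ((inner ℝ x (u : Vec l) : ℝ) : ℂ) ^ j, by fun_prop⟩ fun u => by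
      simp only [ContinuousMap.coe_mk]
      rw [← evalAt_linForm]; simp [evalAt]

/-- The Laplacian in `x` passes under the linear functional in `u`, where it acts on `⟨x, u⟩ʲ`. -/
theorem polyLaplacian_momentPoly (j : ℕ) (H : MvPolynomial (Fin l) ℂ) :
    polyLaplacian (momentPoly j H) = C (j * (j - 1) : ℂ) * momentPoly (j - 2) H := by
  refine evalAt_ext fun x => ?_
  rw [evalAt_mul, evalAt_C, evalAt_momentPoly, ← integral_const_mul, ← polyLaplacianLin_apply]
  rw [momentPoly, evalAt_linearMap_applyCoeff (densityLin (evalSphere H)) (contCoeff_linForm_pow j)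
    (isHomogeneous_linForm_pow j) (polyLaplacianLin l) x
    ⟨fun u => (j * (j - 1) : ℂ) * ((inner ℝ x (u : Vec l) : ℝ) : ℂ) ^ (j - 2), by fun_prop⟩]
  · refine integral_congr_ae (Eventually.of_forall fun u => ?_)
    simp only [ContinuousMap.coe_mk, evalSphere, mul_assoc]
  · intro u
    simp only [ContinuousMap.coe_mk]
    rw [polyLaplacianLin_apply, polyLaplacian_linForm_pow, evalAt_mul, evalAt_C, ← evalAt_linForm]
    simp [evalAt]

/-- For fixed `x` the kernel `⟨x, u⟩ʲ` is a polynomial in `u` of degree `j < s`. -/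
theorem momentPoly_eq_zero_of_lt (hl : 0 < l) {s : ℕ} {H : MvPolynomial (Fin l) ℂ}
    (hH : H.IsHomogeneous s) (hH0 : polyLaplacian H = 0) {j : ℕ} (hj : j < s) :
    momentPoly j H = 0 := by
  refine evalAt_ext fun x => ?_
  have h : (((∑ i, C ((x i : ℝ) : ℂ) * X i : MvPolynomial (Fin l) ℂ)) ^ j).IsHomogeneous j := by
    have h1 : (∑ i, C ((x i : ℝ) : ℂ) * X i : MvPolynomial (Fin l) ℂ).IsHomogeneous 1 :=
      IsHomogeneous.sum _ _ _ fun i _ => isHomogeneous_C_mul_X _ i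
    simpa using h1.pow j
  have h2 := integral_mul_harmonic_of_lt hl hH hH0 j hj h
  rw [evalAt_momentPoly]
  have h0 : evalAt x (0 : MvPolynomial (Fin l) ℂ) = 0 := by simp [evalAt]
  rw [h0, ← h2]
  refine integral_congr_ae (Eventually.of_forall fun u => ?_)
  simp only
  congr 1
  simp [evalAt, PiLp.inner_apply, mul_comm]

/-- Moments at the critical order are harmonic. -/
theorem polyLaplacian_momentPoly_self (hl : 0 < l) {s : ℕ} {H : MvPolynomial (Fin l) ℂ}
    (hH : H.IsHomogeneous s) (hH0 : polyLaplacian H = 0) : polyLaplacian (momentPoly s H) = 0 := by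
  rw [polyLaplacian_momentPoly]
  rcases s.eq_zero_or_pos with h | h
  · subst h; simp
  · rw [momentPoly_eq_zero_of_lt hl hH hH0 (by omega), mul_zero]

/-- The kernel `⟨x, u⟩ʲ` is symmetric, so by Fubini the moment operator is symmetric for the
bilinear pairing. -/
theorem integral_momentPoly_mul (j : ℕ) (H q : MvPolynomial (Fin l) ℂ) :
    ∫ x : USphere l, evalAt (x : Vec l) (momentPoly j H) * evalAt (x : Vec l) q ∂sphereMeasure l =
      ∫ u : USphere l, evalAt (u : Vec l) (momentPoly j q) * evalAt (u : Vec l) H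
        ∂sphereMeasure l := by
  simp only [evalAt_momentPoly, ← integral_mul_const]
  have hH := continuous_evalAt (l := l) H
  have hq := continuous_evalAt (l := l) q
  rw [integral_integral_swap]
  · refine integral_congr_ae (Eventually.of_forall fun x => ?_)
    refine integral_congr_ae (Eventually.of_forall fun u => ?_)
    simp only [real_inner_comm (x : Vec l)]
    ring
  · have hc : Continuous (Function.uncurry fun x u : USphere l =>
        ((inner ℝ (x : Vec l) (u : Vec l) : ℝ) : ℂ) ^ j * evalAt (u : Vec l) H *
          evalAt (x : Vec l) q) := by
      have h1 : Continuous fun z : USphere l × USphere l => evalAt (z.2 : Vec l) H :=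
        hH.comp continuous_snd
      have h2 : Continuous fun z : USphere l × USphere l => evalAt (z.1 : Vec l) q :=
        hq.comp continuous_fst
      unfold Function.uncurry
      fun_prop
    exact hc.integrable_of_hasCompactSupport (HasCompactSupport.of_compactSpace _)

/-- The conjugate polynomial. -/
def conjPoly (P : MvPolynomial (Fin l) ℂ) : MvPolynomial (Fin l) ℂ := map (starRingEnd ℂ) P

theorem evalAt_conjPoly (P : MvPolynomial (Fin l) ℂ) (x : Vec l) :
    evalAt x (conjPoly P) = starRingEnd ℂ (evalAt x P) := by
  have h := eval₂_comp_left (starRingEnd ℂ) (RingHom.id ℂ) (fun i => (x i : ℂ)) P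
  rw [evalAt, evalAt, conjPoly, eval_map, eval, coe_eval₂Hom, h]
  congr 1
  ext i
  simp

theorem polyLaplacian_conjPoly (P : MvPolynomial (Fin l) ℂ) :
    polyLaplacian (conjPoly P) = conjPoly (polyLaplacian P) := by
  simp [polyLaplacian, conjPoly, pderiv_map]

theorem exists_unit_smul (hl : 0 < l) (x : Vec l) : ∃ u : USphere l, x = ‖x‖ • (u : Vec l) := by
  by_cases hx : x = 0
  · exact ⟨⟨stdVec ⟨0, hl⟩, by simp [norm_stdVec]⟩, by simp [hx]⟩
  · refine ⟨⟨‖x‖⁻¹ • x, ?_⟩, ?_⟩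
    · rw [mem_sphere_zero_iff_norm, norm_smul, norm_inv, norm_norm,
        inv_mul_cancel₀ (norm_ne_zero_iff.2 hx)]
    · simp [smul_smul, norm_ne_zero_iff.2 hx]

/-- A homogeneous polynomial with vanishing square integral over the sphere vanishes. -/
theorem eq_zero_of_integral_conj (hl : 0 < l) {j : ℕ} {P : MvPolynomial (Fin l) ℂ}
    (hP : P.IsHomogeneous j)
    (h : ∫ u : USphere l, evalAt (u : Vec l) P * evalAt (u : Vec l) (conjPoly P)
      ∂sphereMeasure l = 0) : P = 0 := by
  have hc : Continuous fun u : USphere l => ‖evalAt (u : Vec l) P‖ ^ 2 :=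
    (continuous_evalAt P).norm.pow 2
  have h1 : ∫ u : USphere l, ‖evalAt (u : Vec l) P‖ ^ 2 ∂sphereMeasure l = 0 := by
    have h2 : ∫ u : USphere l, ((‖evalAt (u : Vec l) P‖ ^ 2 : ℝ) : ℂ) ∂sphereMeasure l = 0 := by
      rw [← h]
      refine integral_congr_ae (Eventually.of_forall fun u => ?_)
      simp only
      rw [evalAt_conjPoly, Complex.mul_conj']
      push_cast
      rfl
    rwa [integral_complex_ofReal, Complex.ofReal_eq_zero] at h2
  have h3 := (integral_eq_zero_iff_of_nonneg (fun u => by positivity) (integrable_sphere hc)).1 h1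
  have h4 := (Continuous.ae_eq_iff_eq _ hc continuous_zero).1 h3
  refine evalAt_ext fun x => ?_
  obtain ⟨u, hu⟩ := exists_unit_smul hl x
  have h5 : evalAt (u : Vec l) P = 0 := by simpa using congrFun h4 u
  rw [hu, evalAt_smul_homogeneous hP, h5, mul_zero]
  simp [evalAt]

/-- All moments of a spherical harmonic are radial multiples of the critical one. -/
theorem momentPoly_eq (hl : 0 < l) {s : ℕ} {H : MvPolynomial (Fin l) ℂ} (hH : H.IsHomogeneous s)
    (hH0 : polyLaplacian H = 0) (j : ℕ) : momentPoly j H = 0 ∨ ∃ i, 2 * i + s = j ∧ ∃ κ : ℂ,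
      momentPoly j H = C κ * (normSqPoly l ^ i * momentPoly s H) := by
  induction j using Nat.strong_induction_on with
  | _ j ih =>
    rcases lt_trichotomy j s with hj | rfl | hj
    · exact Or.inl (momentPoly_eq_zero_of_lt hl hH hH0 hj)
    · exact Or.inr ⟨0, by simp, 1, by simp⟩
    have hs0 := polyLaplacian_momentPoly_self hl hH hH0
    have hsh := momentPoly_isHomogeneous s H
    -- The moment is pinned down by its Laplacian and its pairings with harmonic polynomials of
    -- degree `j`. Those pairings vanish: moving the moment operator to `q` gives a harmonic
    -- polynomial of degree `j ≠ s` paired with `H`. The difference of two candidates is harmonic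
    -- and orthogonal to its own conjugate.
    have key : ∀ Q : MvPolynomial (Fin l) ℂ, Q.IsHomogeneous j →
        polyLaplacian Q = polyLaplacian (momentPoly j H) →
        (∀ q : MvPolynomial (Fin l) ℂ, q.IsHomogeneous j → polyLaplacian q = 0 →
          ∫ u : USphere l, evalAt (u : Vec l) Q * evalAt (u : Vec l) q ∂sphereMeasure l = 0) →
        momentPoly j H = Q := by
      intro Q hQ hQL hQ0
      have hD : (momentPoly j H - Q).IsHomogeneous j := (momentPoly_isHomogeneous j H).sub hQ
      have hD0 : polyLaplacian (momentPoly j H - Q) = 0 := by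
        rw [← polyLaplacianLin_apply, map_sub, polyLaplacianLin_apply, polyLaplacianLin_apply, hQL,
          sub_self]
      refine sub_eq_zero.1 (eq_zero_of_integral_conj hl hD ?_)
      have hq : (conjPoly (momentPoly j H - Q)).IsHomogeneous j := hD.map _
      have hq0 : polyLaplacian (conjPoly (momentPoly j H - Q)) = 0 := by
        rw [polyLaplacian_conjPoly, hD0]; simp [conjPoly]
      set q := conjPoly (momentPoly j H - Q)
      have e1 := hQ0 q hq hq0
      have e2 : ∫ u : USphere l, evalAt (u : Vec l) (momentPoly j H) * evalAt (u : Vec l) q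
          ∂sphereMeasure l = 0 := by
        rw [integral_momentPoly_mul]
        exact integral_harmonic_mul_harmonic hl hj.ne' (momentPoly_isHomogeneous j q) hH
          (polyLaplacian_momentPoly_self hl hq hq0) hH0
      have e3 : ∀ u : USphere l, evalAt (u : Vec l) (momentPoly j H - Q) * evalAt (u : Vec l) q =
          evalAt (u : Vec l) (momentPoly j H) * evalAt (u : Vec l) q -
            evalAt (u : Vec l) Q * evalAt (u : Vec l) q := fun u => by
        rw [← sub_mul]; simp [evalAt]
      simp only [e3]
      rw [integral_sub, e1, e2, sub_zero]
      · exact integrable_sphere ((continuous_evalAt _).mul (continuous_evalAt _))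
      · exact integrable_sphere ((continuous_evalAt _).mul (continuous_evalAt _))
    have hzero : polyLaplacian (momentPoly j H) = 0 → momentPoly j H = 0 := fun h =>
      key 0 (isHomogeneous_zero _ _ _) (by rw [h]; simp [polyLaplacian])
        fun q _ _ => by simp [evalAt]
    by_cases hj2 : j < 2
    · refine Or.inl (hzero (polyLaplacian_eq_zero_of_isHomogeneous (by omega)
        (momentPoly_isHomogeneous j H)))
    rcases ih (j - 2) (by omega) with h | ⟨i, hi, κ, h⟩
    · exact Or.inl (hzero (by rw [polyLaplacian_momentPoly, h, mul_zero]))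
    -- The constant solves `Δ(κ' ⟨x, x⟩^{i+1} M) = j (j - 1) κ ⟨x, x⟩^i M` for the harmonic critical
    -- moment `M`, by `polyLaplacian_normSqPoly_pow_mul`.
    · refine Or.inr ⟨i + 1, by omega, j * (j - 1) * κ / (2 * (i + 1) * (2 * i + l + 2 * s)), ?_⟩
      have hne : (2 * (i + 1) * (2 * i + l + 2 * s) : ℂ) ≠ 0 := by
        have : 2 * (i + 1) * (2 * i + l + 2 * s) ≠ 0 := by positivity
        exact_mod_cast this
      refine key _ ?_ ?_ ?_
      · have := (((isHomogeneous_normSqPoly (d := l)).pow (i + 1)).mul hsh).C_mul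
          (j * (j - 1) * κ / (2 * (i + 1) * (2 * i + l + 2 * s)))
        rwa [show 2 * (i + 1) + s = j by omega] at this
      · rw [polyLaplacian_momentPoly, h, ← polyLaplacianLin_apply, C_mul', map_smul,
          polyLaplacianLin_apply, polyLaplacian_normSqPoly_pow_mul hsh, hs0, mul_zero, add_zero,
          ← C_mul', ← mul_assoc, ← mul_assoc, ← C_mul, div_mul_cancel₀ _ hne, C_mul]
        ring
      · intro q hq hq0
        have := integral_harmonic_mul_harmonic hl hj.ne hsh hq hs0 hq0
        simp only [evalAt_mul, evalAt_C]
        have e : ∀ u : USphere l, evalAt (u : Vec l) (normSqPoly l ^ (i + 1)) = 1 := fun u => by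
          have := evalAt_normSqPoly_sphere u
          rw [evalAt] at this ⊢
          rw [map_pow, this, one_pow]
        simp only [e, one_mul, mul_assoc]
        rw [integral_const_mul, this, mul_zero]

theorem exists_momentPoly_sphere (hl : 0 < l) {s : ℕ} {H : MvPolynomial (Fin l) ℂ}
    (hH : H.IsHomogeneous s) (hH0 : polyLaplacian H = 0) (j : ℕ) : ∃ κ : ℂ, ∀ u : USphere l,
      evalAt (u : Vec l) (momentPoly j H) = κ * evalAt (u : Vec l) (momentPoly s H) := by
  rcases momentPoly_eq hl hH hH0 j with h | ⟨i, -, κ, h⟩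
  · exact ⟨0, fun u => by rw [h]; simp [evalAt]⟩
  · refine ⟨κ, fun u => ?_⟩
    have h1 := evalAt_normSqPoly_sphere u
    rw [h, evalAt_mul, evalAt_mul, evalAt_C]
    rw [evalAt] at h1 ⊢
    rw [map_pow, h1, one_pow, one_mul]

/-- The Fourier integral of a spherical harmonic is the product of a radial function and a spherical
harmonic of the same order. -/
theorem zFourier_harmonic (hl : 0 < l) {s : ℕ} (lam : ℝ) {h : USphere l → ℂ}
    (hh : h ∈ sphericalHarmonics l s) : ∃ y : ℝ → ℂ, ∃ h' ∈ sphericalHarmonics l s,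
      ∀ (r : ℝ) (u : USphere l), zFourier lam h (r • (u : Vec l)) = y r * h' u := by
  obtain ⟨H, hH, hH0, rfl⟩ := hh
  choose κ hκ using exists_momentPoly_sphere hl hH hH0
  -- The exponential series is integrated termwise: the `j`-th term is `(i r √lam)ʲ / j!` times the
  -- `j`-th moment at `u`, which is `κ j` times the critical one.
  refine ⟨fun r => ((sphereMeasure l).real Set.univ)⁻¹ •
    ∑' j : ℕ, (Complex.I * r * Real.sqrt lam) ^ j / (j.factorial : ℂ) * κ j, _,
    ⟨momentPoly s H, momentPoly_isHomogeneous s H, polyLaplacian_momentPoly_self hl hH hH0, rfl⟩,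
    fun r u => ?_⟩
  rw [zFourier_eq, smul_mul_assoc, ← tsum_mul_right]
  congr 1
  set z : USphere l → ℂ := fun v =>
    Complex.I * (inner ℝ (r • (u : Vec l)) (Real.sqrt lam • (v : Vec l)) : ℝ) with hz
  have hzc : Continuous z := by fun_prop
  have hHc := continuous_evalAt (l := l) H
  have hzn : ∀ v, ‖z v‖ ≤ |r| * Real.sqrt lam := fun v => by
    simp only [hz, norm_mul, Complex.norm_I, one_mul, Complex.norm_real]
    refine (norm_inner_le_norm _ _).trans ?_
    rw [norm_smul, norm_smul, norm_eq_of_mem_sphere, norm_eq_of_mem_sphere, mul_one, mul_one,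
      Real.norm_eq_abs, Real.norm_eq_abs, abs_of_nonneg (Real.sqrt_nonneg lam)]
  have hFc : ∀ j : ℕ, Continuous fun v => z v ^ j / (j.factorial : ℂ) * evalAt (v : Vec l) H :=
    fun j => by fun_prop
  have hS := (Real.summable_pow_div_factorial (|r| * Real.sqrt lam)).mul_right
    (∫ v : USphere l, ‖evalAt (v : Vec l) H‖ ∂sphereMeasure l)
  have hsum := hasSum_integral_of_summable_integral_norm (μ := sphereMeasure l)
    (F := fun (j : ℕ) v => z v ^ j / (j.factorial : ℂ) * evalAt (v : Vec l) H)
    (fun j => integrable_sphere (hFc j)) (by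
      refine Summable.of_nonneg_of_le (fun j => integral_nonneg fun v => norm_nonneg _)
        (fun j => ?_) hS
      rw [← integral_const_mul]
      refine integral_mono (integrable_sphere (hFc j).norm)
        (integrable_sphere (continuous_const.mul hHc.norm)) fun v => ?_
      simp only [norm_mul, norm_div, norm_pow, Complex.norm_natCast]
      gcongr
      exact hzn v)
  have hexp : ∀ v, ∑' j : ℕ, z v ^ j / (j.factorial : ℂ) * evalAt (v : Vec l) H =
      phase lam (r • (u : Vec l)) v * evalAt (v : Vec l) H := fun v => by
    rw [tsum_mul_right, (NormedSpace.expSeries_div_hasSum_exp (z v)).tsum_eq, phase,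
      Complex.exp_eq_exp_ℂ]
  simp only [hexp] at hsum
  rw [← hsum.tsum_eq]
  congr 1
  ext j
  rw [mul_assoc, ← hκ, evalAt_momentPoly, ← integral_const_mul]
  refine integral_congr_ae (Eventually.of_forall fun v => ?_)
  simp only [hz, real_inner_smul_left, real_inner_smul_right]
  push_cast
  ring

end moments

/-! ### Separated eigenfunctions on a ball -/

section ball

variable {l s : ℕ} {R lam : ℝ}

/-- An eigenfunction of `-Δ` on the ball of radius `R` that is the product of a radial function and
the spherical harmonic given by the polynomial `P`. -/
structure IsSeparatedEigen (l s : ℕ) (R lam : ℝ) (P : MvPolynomial (Fin l) ℂ) (w : Vec l → ℂ)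
    (y : ℝ → ℂ) : Prop where
  contDiffAt : ∀ Z ∈ Metric.closedBall (0 : Vec l) R, ContDiffAt ℝ 2 w Z
  eigen : ∀ Z ∈ Metric.ball (0 : Vec l) R, -Laplacian.laplacian w Z = lam * w Z
  isHomogeneous : P.IsHomogeneous s
  harmonic : polyLaplacian P = 0
  eq_mul : ∀ r ∈ Set.Icc 0 R, ∀ u : USphere l, w (r • (u : Vec l)) = y r * evalAt (u : Vec l) P

/-- The radial factor of a separated function, along the direction `u`. -/
def radialFactor (P : MvPolynomial (Fin l) ℂ) (w : Vec l → ℂ) (u : USphere l) (r : ℝ) : ℂ :=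
  w (r • (u : Vec l)) / evalAt (u : Vec l) P

variable {P : MvPolynomial (Fin l) ℂ} {w : Vec l → ℂ} {y : ℝ → ℂ} {u : USphere l}

theorem norm_smul_sphere (r : ℝ) (u : USphere l) : ‖r • (u : Vec l)‖ = |r| := by
  rw [norm_smul, norm_eq_of_mem_sphere, mul_one, Real.norm_eq_abs]

namespace IsSeparatedEigen

theorem radialFactor_eq (h : IsSeparatedEigen l s R lam P w y) (hu : evalAt (u : Vec l) P ≠ 0)
    {r : ℝ} (hr : r ∈ Set.Icc 0 R) : radialFactor P w u r = y r := by
  rw [radialFactor, h.eq_mul r hr, mul_div_cancel_right₀ _ hu]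

theorem contDiffAt_radialFactor (h : IsSeparatedEigen l s R lam P w y) {r : ℝ} (hr : |r| ≤ R) :
    ContDiffAt ℝ 2 (radialFactor P w u) r := by
  have h1 : ContDiffAt ℝ 2 w (r • (u : Vec l)) :=
    h.contDiffAt _ (by rwa [mem_closedBall_zero_iff, norm_smul_sphere])
  have h2 : ContDiffAt ℝ 2 (fun r : ℝ => r • (u : Vec l)) r := by fun_prop
  exact (ContDiffAt.comp r h1 h2).div_const _

theorem hasDerivAt_radialFactor (h : IsSeparatedEigen l s R lam P w y) {r : ℝ} (hr : |r| ≤ R) :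
    HasDerivAt (radialFactor P w u)
      (fderiv ℝ w (r • (u : Vec l)) (u : Vec l) / evalAt (u : Vec l) P) r := by
  have h1 : ContDiffAt ℝ 2 w (r • (u : Vec l)) :=
    h.contDiffAt _ (by rwa [mem_closedBall_zero_iff, norm_smul_sphere])
  have h2 : HasDerivAt (fun r : ℝ => r • (u : Vec l)) (u : Vec l) r := by
    simpa using (hasDerivAt_id r).smul_const (u : Vec l)
  exact ((h1.differentiableAt (by simp)).hasFDerivAt.comp_hasDerivAt r h2).div_const _

/-- This is the parity `P(-u) = (-1)ˢ P(u)`, since `w(-r u) = w(r (-u))`. It controls the Wronskian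
at the origin. -/
theorem radialFactor_neg (h : IsSeparatedEigen l s R lam P w y) {r : ℝ} (hr : |r| ≤ R) :
    radialFactor P w u (-r) = (-1) ^ s * radialFactor P w u r := by
  have key : ∀ r ∈ Set.Icc 0 R, radialFactor P w u (-r) = (-1) ^ s * radialFactor P w u r := by
    intro r hr
    have h1 : evalAt ((-u : USphere l) : Vec l) P = (-1) ^ s * evalAt (u : Vec l) P := by
      have := evalAt_smul_homogeneous h.isHomogeneous (-1) (u : Vec l)
      simpa using this
    have h2 := h.eq_mul r hr (-u)
    rw [h1] at h2
    have h3 : (-r) • (u : Vec l) = r • ((-u : USphere l) : Vec l) := by simp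
    rw [radialFactor, radialFactor, h3, h2, h.eq_mul r hr]
    ring
  rcases le_total 0 r with h0 | h0
  · exact key r ⟨h0, by rwa [abs_of_nonneg h0] at hr⟩
  · have h1 := key (-r) ⟨by linarith, by rwa [abs_of_nonpos h0] at hr⟩
    rw [neg_neg] at h1
    rw [h1, ← mul_assoc, ← mul_pow]
    simp

/-- The radial factor satisfies the Bessel type equation. -/
theorem radial_ode_of_lt (h : IsSeparatedEigen l s R lam P w y) (hu : evalAt (u : Vec l) P ≠ 0)
    {r : ℝ} (h0 : 0 < r) (hr : r < R) :
    (r : ℂ) ^ 2 * iteratedDeriv 2 (radialFactor P w u) r +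
      (l - 1) * r * deriv (radialFactor P w u) r +
      (lam * (r : ℂ) ^ 2 - s * (s + l - 2)) * radialFactor P w u r = 0 := by
  set f := radialFactor P w u with hf
  have hfc : ContDiffAt ℝ 2 f r := h.contDiffAt_radialFactor (by rw [abs_of_pos h0]; exact hr.le)
  -- Away from the origin `w = g(‖x‖²) P(x)`, so the Laplacian of a radial multiple of a harmonic
  -- polynomial gives an equation for `g`; substituting `f(r) = rˢ g(r²)` gives the one for `f`.
  set g : ℝ → ℂ := fun t => f (Real.sqrt t) / ((Real.sqrt t : ℝ) : ℂ) ^ s with hg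
  have hgc : ContDiffAt ℝ 2 g (r ^ 2) := by
    have hsq : ContDiffAt ℝ 2 Real.sqrt (r ^ 2) := Real.contDiffAt_sqrt (by positivity)
    have hr2 : Real.sqrt (r ^ 2) = r := Real.sqrt_sq h0.le
    have a1 : ContDiffAt ℝ 2 (fun t => f (Real.sqrt t)) (r ^ 2) :=
      ContDiffAt.comp (g := f) (r ^ 2) (by rw [hr2]; exact hfc) hsq
    have a2 : ContDiffAt ℝ 2 (fun t : ℝ => ((Real.sqrt t : ℝ) : ℂ)) (r ^ 2) :=
      ContDiffAt.comp (g := ((↑) : ℝ → ℂ)) (r ^ 2) Complex.ofRealCLM.contDiff.contDiffAt hsq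
    simp only [hg, div_eq_mul_inv]
    refine a1.mul ((a2.pow s).inv ?_)
    simp only [hr2]
    exact pow_ne_zero _ (by exact_mod_cast h0.ne')
  have hx : ‖r • (u : Vec l)‖ = r := by rw [norm_smul_sphere, abs_of_pos h0]
  have hP : evalAt (r • (u : Vec l)) P ≠ 0 := by
    rw [evalAt_smul_homogeneous h.isHomogeneous]
    exact mul_ne_zero (pow_ne_zero _ (by simpa using h0.ne')) hu
  have hw : w =ᶠ[𝓝 (r • (u : Vec l))] fun x => g (‖x‖ ^ 2) * evalAt x P := by
    have e1 : ∀ᶠ x in 𝓝 (r • (u : Vec l)), ‖x‖ < R :=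
      continuous_norm.continuousAt.eventually (gt_mem_nhds (by simpa only [hx] using hr))
    have e2 : ∀ᶠ x in 𝓝 (r • (u : Vec l)), 0 < ‖x‖ :=
      continuous_norm.continuousAt.eventually (lt_mem_nhds (by simpa only [hx] using h0))
    filter_upwards [e1, e2] with x hx1 hx2
    obtain ⟨v, hv⟩ : ∃ v : USphere l, x = ‖x‖ • (v : Vec l) :=
      ⟨⟨‖x‖⁻¹ • x, by rw [mem_sphere_zero_iff_norm, norm_smul, norm_inv, norm_norm,
        inv_mul_cancel₀ hx2.ne']⟩, by simp [smul_smul, hx2.ne']⟩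
    have hx3 : ‖x‖ ∈ Set.Icc 0 R := ⟨hx2.le, hx1.le⟩
    have e3 := h.eq_mul ‖x‖ hx3 v
    have e4 := evalAt_smul_homogeneous h.isHomogeneous ‖x‖ (v : Vec l)
    rw [← hv] at e3 e4
    have hne : (‖x‖ : ℂ) ^ s ≠ 0 := pow_ne_zero _ (by exact_mod_cast hx2.ne')
    rw [e3, e4, hg]
    simp only [Real.sqrt_sq hx2.le]
    rw [hf, h.radialFactor_eq hu hx3]
    field_simp
  have hL := h.eigen (r • (u : Vec l)) (by rw [mem_ball_zero_iff, hx]; exact hr)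
  rw [InnerProductSpace.laplacian_congr_nhds hw |>.eq_of_nhds, hw.eq_of_nhds,
    laplacian_radial_mul_evalAt (by rw [hx]; exact hgc) h.isHomogeneous h.harmonic, hx] at hL
  have hode : 4 * (r : ℂ) ^ 2 * iteratedDeriv 2 g (r ^ 2) + (2 * l + 4 * s) * deriv g (r ^ 2) +
      lam * g (r ^ 2) = 0 := by
    refine mul_right_cancel₀ hP ?_
    linear_combination -hL
  have hfg : f =ᶠ[𝓝 r] fun ρ => (ρ : ℂ) ^ s * g (ρ ^ 2) := by
    filter_upwards [lt_mem_nhds h0] with ρ hρ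
    simp only [hg]
    rw [Real.sqrt_sq hρ.le]
    have : (ρ : ℂ) ^ s ≠ 0 := pow_ne_zero _ (by exact_mod_cast hρ.ne')
    field_simp
  have q1 : ∀ ρ : ℝ, HasDerivAt (fun ρ : ℝ => (ρ : ℂ) ^ s) (s * (ρ : ℂ) ^ (s - 1)) ρ := fun ρ => by
    simpa using (hasDerivAt_id ρ).ofReal_comp.fun_pow s
  have q2 : HasDerivAt (fun ρ : ℝ => (s : ℂ) * (ρ : ℂ) ^ (s - 1))
      (s * ((s - 1 : ℕ) * (r : ℂ) ^ (s - 1 - 1))) r := by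
    simpa using ((hasDerivAt_id r).ofReal_comp.fun_pow (s - 1)).const_mul (s : ℂ)
  have sq : ∀ ρ : ℝ, HasDerivAt (fun ρ : ℝ => ρ ^ 2) (2 * ρ) ρ := fun ρ => by
    simpa using hasDerivAt_pow 2 ρ
  have k1 : ∀ᶠ ρ in 𝓝 r, HasDerivAt (fun ρ : ℝ => g (ρ ^ 2)) ((2 * ρ : ℝ) • deriv g (ρ ^ 2)) ρ := by
    filter_upwards [(sq r).continuousAt.eventually hgc.eventually_hasDerivAt] with ρ hρ
    exact HasDerivAt.scomp (g₁ := g) (h := fun ρ : ℝ => ρ ^ 2) ρ hρ (sq ρ)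
  have lin : HasDerivAt (fun ρ : ℝ => 2 * ρ) 2 r := by simpa using (hasDerivAt_id r).const_mul 2
  have k2 : HasDerivAt (fun ρ : ℝ => (2 * ρ : ℝ) • deriv g (ρ ^ 2))
      ((2 * r) • ((2 * r) • iteratedDeriv 2 g (r ^ 2)) + (2 : ℝ) • deriv g (r ^ 2)) r :=
    lin.smul (HasDerivAt.scomp (g₁ := deriv g) (h := fun ρ : ℝ => ρ ^ 2) r hgc.hasDerivAt_deriv (sq r))
  have d1 : deriv f r = s * (r : ℂ) ^ (s - 1) * g (r ^ 2) +
      (r : ℂ) ^ s * ((2 * r : ℝ) • deriv g (r ^ 2)) := by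
    rw [hfg.deriv_eq]
    exact ((q1 r).mul k1.self_of_nhds).deriv
  have d2 : iteratedDeriv 2 f r = s * ((s - 1 : ℕ) * (r : ℂ) ^ (s - 1 - 1)) * g (r ^ 2) +
      2 * (s * (r : ℂ) ^ (s - 1) * ((2 * r : ℝ) • deriv g (r ^ 2))) +
      (r : ℂ) ^ s * ((2 * r) • ((2 * r) • iteratedDeriv 2 g (r ^ 2)) +
        (2 : ℝ) • deriv g (r ^ 2)) := by
    have k3 : ∀ᶠ ρ : ℝ in 𝓝 r, HasDerivAt f
        (s * (ρ : ℂ) ^ (s - 1) * g (ρ ^ 2) + (ρ : ℂ) ^ s * ((2 * ρ : ℝ) • deriv g (ρ ^ 2))) ρ := by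
      filter_upwards [k1, hfg.eventuallyEq_nhds] with ρ hρ hfρ
      exact ((q1 ρ).mul hρ).congr_of_eventuallyEq hfρ
    rw [iteratedDeriv_two_eq k3 ((q2.mul k1.self_of_nhds).add ((q1 r).mul k2))]
    ring
  have d0 : f r = (r : ℂ) ^ s * g (r ^ 2) := hfg.eq_of_nhds
  -- The factors `s` and `s - 1` vanish exactly where the exponents `s - 1` and `s - 1 - 1` are
  -- truncated.
  have p1 : (s : ℂ) * (r : ℂ) ^ (s - 1) * r = s * (r : ℂ) ^ s := by
    rcases s with _ | s
    · simp
    · rw [Nat.add_sub_cancel, pow_succ]; ring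
  have p2 : (s : ℂ) * ((s - 1 : ℕ) * (r : ℂ) ^ (s - 1 - 1)) * (r : ℂ) ^ 2 =
      s * (s - 1) * (r : ℂ) ^ s := by
    rcases s with _ | _ | s
    · simp
    · simp
    · rw [show s + 1 + 1 - 1 - 1 = s by omega, Nat.add_sub_cancel, pow_succ, pow_succ]
      push_cast; ring
  rw [d0, d1, d2]
  simp only [Complex.real_smul]
  push_cast
  linear_combination ((r : ℂ) ^ (s + 2)) * hode + g (r ^ 2) * p2 + 4 * (r : ℂ) ^ 2 * deriv g (r ^ 2) * p1 +
    (l - 1) * g (r ^ 2) * p1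

/-- The eigenvalue equation holds only in the open ball; at `r = R` the radial equation follows by
continuity, `w` being `C²` up to the boundary. -/
theorem radial_ode (h : IsSeparatedEigen l s R lam P w y) (hu : evalAt (u : Vec l) P ≠ 0)
    {r : ℝ} (h0 : 0 < r) (hr : r ≤ R) :
    (r : ℂ) ^ 2 * iteratedDeriv 2 (radialFactor P w u) r +
      (l - 1) * r * deriv (radialFactor P w u) r +
      (lam * (r : ℂ) ^ 2 - s * (s + l - 2)) * radialFactor P w u r = 0 := by
  rcases hr.eq_or_lt with rfl | hr
  · have hc := h.contDiffAt_radialFactor (u := u) (r := r) (by rw [abs_of_pos h0])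
    have c1 := hc.continuousAt
    have c2 := hc.deriv_one.continuousAt
    have c3 := hc.continuousAt_iteratedDeriv_two
    have hcont : ContinuousAt (fun r : ℝ => (r : ℂ) ^ 2 * iteratedDeriv 2 (radialFactor P w u) r +
      (l - 1) * r * deriv (radialFactor P w u) r +
      (lam * (r : ℂ) ^ 2 - s * (s + l - 2)) * radialFactor P w u r) r := by fun_prop
    refine tendsto_nhds_unique_of_eventuallyEq (hcont.tendsto.mono_left nhdsWithin_le_nhds)
      (tendsto_const_nhds (x := (0 : ℂ))) (f := fun r : ℝ => _) (l := 𝓝[<] r) ?_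
    filter_upwards [self_mem_nhdsWithin,
      (lt_mem_nhds h0).filter_mono nhdsWithin_le_nhds] with t ht ht0
    exact h.radial_ode_of_lt hu ht0 ht
  · exact h.radial_ode_of_lt hu h0 hr

/-- Two separated eigenfunctions of the same order have vanishing Wronskian. -/
theorem wronskian_eq_zero (hl : 0 < l) (hR : 0 < R) {P' : MvPolynomial (Fin l) ℂ} {w' : Vec l → ℂ}
    {y' : ℝ → ℂ} {u' : USphere l} (h : IsSeparatedEigen l s R lam P w y)
    (h' : IsSeparatedEigen l s R lam P' w' y') (hu : evalAt (u : Vec l) P ≠ 0)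
    (hu' : evalAt (u' : Vec l) P' ≠ 0) :
    radialFactor P w u R * deriv (radialFactor P' w' u') R -
      radialFactor P' w' u' R * deriv (radialFactor P w u) R = 0 := by
  set f := radialFactor P w u with hf
  set f' := radialFactor P' w' u' with hf'
  obtain ⟨d, rfl⟩ : ∃ d, l = d + 1 := ⟨l - 1, by omega⟩
  have cf : ∀ r, |r| ≤ R → ContDiffAt ℝ 2 f r := fun r hr => h.contDiffAt_radialFactor hr
  have cf' : ∀ r, |r| ≤ R → ContDiffAt ℝ 2 f' r := fun r hr => h'.contDiffAt_radialFactor hr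
  -- The weight `r^{l-1}` cancels the first-order term of the equation, so the weighted Wronskian is
  -- constant on `(0, R]`.
  set W : ℝ → ℂ := fun r => (r : ℂ) ^ d * (f r * deriv f' r - f' r * deriv f r) with hW
  have hWc : ∀ r, |r| ≤ R → ContinuousAt W r := fun r hr => by
    have c1 := (cf r hr).continuousAt
    have c2 := (cf r hr).deriv_one.continuousAt
    have c3 := (cf' r hr).continuousAt
    have c4 := (cf' r hr).deriv_one.continuousAt
    fun_prop
  have hWd : ∀ r, 0 < r → r ≤ R → HasDerivAt W 0 r := fun r h0 hr => by
    have hr' : |r| ≤ R := by rwa [abs_of_pos h0]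
    have a1 := (cf r hr').eventually_hasDerivAt.self_of_nhds
    have a2 := (cf r hr').hasDerivAt_deriv
    have b1 := (cf' r hr').eventually_hasDerivAt.self_of_nhds
    have b2 := (cf' r hr').hasDerivAt_deriv
    have q1 : HasDerivAt (fun ρ : ℝ => (ρ : ℂ) ^ d) (d * (r : ℂ) ^ (d - 1)) r := by
      simpa using (hasDerivAt_id r).ofReal_comp.fun_pow d
    refine (q1.mul ((a1.mul b2).sub (b1.mul a2))).congr_deriv ?_
    have o1 := h.radial_ode hu h0 hr
    have o2 := h'.radial_ode hu' h0 hr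
    rw [← hf] at o1
    rw [← hf'] at o2
    have hr0 : (r : ℂ) ≠ 0 := by exact_mod_cast h0.ne'
    refine (mul_eq_zero.1 (?_ : (r : ℂ) ^ 2 * _ = 0)).resolve_left (pow_ne_zero 2 hr0)
    have p1 : (d : ℂ) * (r : ℂ) ^ (d - 1) * r = d * (r : ℂ) ^ d := by
      rcases d with _ | d
      · simp
      · rw [Nat.add_sub_cancel, pow_succ]; ring
    simp only [Pi.sub_apply, Pi.mul_apply]
    push_cast at o1 o2 ⊢
    linear_combination (r : ℂ) ^ d * f r * o2 - (r : ℂ) ^ d * f' r * o1 +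
      (r * (f r * deriv f' r - f' r * deriv f r)) * p1
  have hconst : ∀ ε, 0 < ε → ε ≤ R → W R = W ε := fun ε h0 hε =>
    constant_of_has_deriv_right_zero (a := ε) (b := R)
      (fun r hr => (hWd r (h0.trans_le hr.1) hr.2).continuousAt.continuousWithinAt)
      (fun r hr => (hWd r (h0.trans_le hr.1) hr.2.le).hasDerivWithinAt) R ⟨hε, le_rfl⟩
  -- For `l = 1` the weight is `1` and does not vanish at the origin, so parity is used: both
  -- derivatives vanish there for even `s`, both values for odd `s`.
  have hW0 : W 0 = 0 := by
    have e0 : |(0 : ℝ)| ≤ R := by simpa using hR.le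
    have par : ∀ {g : ℝ → ℂ}, (∀ r, |r| ≤ R → g (-r) = (-1) ^ s * g r) →
        g 0 = (-1) ^ s * g 0 ∧ -deriv g 0 = (-1) ^ s * deriv g 0 := by
      intro g hg
      refine ⟨by simpa using hg 0 e0, ?_⟩
      have e1 : (fun r => g (-r)) =ᶠ[𝓝 0] fun r => (-1) ^ s * g r := by
        filter_upwards [Metric.ball_mem_nhds (0 : ℝ) hR] with r hr
        exact hg r (by simpa using (mem_ball_zero_iff.1 hr).le)
      have e2 := e1.deriv_eq
      rw [deriv_comp_neg, deriv_const_mul_field] at e2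
      simpa using e2
    obtain ⟨m1, m2⟩ := par fun r hr => h.radialFactor_neg (u := u) hr
    obtain ⟨m3, m4⟩ := par fun r hr => h'.radialFactor_neg (u := u') hr
    rw [← hf] at m1 m2
    rw [← hf'] at m3 m4
    simp only [hW]
    rcases neg_one_pow_eq_or ℂ s with hs | hs
    · rw [hs] at m2 m4
      have n2 : deriv f 0 = 0 := by linear_combination (-1 / 2 : ℂ) * m2
      have n4 : deriv f' 0 = 0 := by linear_combination (-1 / 2 : ℂ) * m4
      rw [n2, n4]; ring
    · rw [hs] at m1 m3
      have n1 : f 0 = 0 := by linear_combination (1 / 2 : ℂ) * m1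
      have n3 : f' 0 = 0 := by linear_combination (1 / 2 : ℂ) * m3
      rw [n1, n3]; ring
  have hWR : W R = 0 := by
    have t1 : Tendsto W (𝓝[>] 0) (𝓝 (W 0)) :=
      (hWc 0 (by simpa using hR.le)).tendsto.mono_left nhdsWithin_le_nhds
    rw [← hW0]
    refine tendsto_nhds_unique_of_eventuallyEq (tendsto_const_nhds (x := W R)) t1 ?_
    filter_upwards [self_mem_nhdsWithin,
      (gt_mem_nhds hR).filter_mono nhdsWithin_le_nhds] with ε h0 hε
    exact hconst ε h0 (le_of_lt hε)
  exact (mul_eq_zero.1 hWR).resolve_left (pow_ne_zero _ (by exact_mod_cast hR.ne'))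

/-- A separated eigenfunction with vanishing Cauchy data on the boundary vanishes. -/
theorem eq_zero_of_cauchy (hl : 0 < l) (hR : 0 < R) (h : IsSeparatedEigen l s R lam P w y)
    (hu : evalAt (u : Vec l) P ≠ 0) (h0 : radialFactor P w u R = 0)
    (h1 : deriv (radialFactor P w u) R = 0) : ∀ Z ∈ Metric.ball (0 : Vec l) R, w Z = 0 := by
  set f := radialFactor P w u with hf
  have cf : ∀ r, |r| ≤ R → ContDiffAt ℝ 2 f r := fun r hr => h.contDiffAt_radialFactor hr
  have hpos : ∀ ε, 0 < ε → ε ≤ R → f ε = 0 := by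
    intro ε hε hεR
    -- The equation as a linear system for `(f, f')`. Its coefficients may be singular at `0` but
    -- are bounded on `[ε, R]`, so uniqueness is applied backwards from `R` for each `ε > 0`.
    set A : ℝ → (ℂ × ℂ →L[ℝ] ℂ × ℂ) := fun t =>
      (ContinuousLinearMap.inl ℝ ℂ ℂ).comp (ContinuousLinearMap.snd ℝ ℂ ℂ) +
        (-(((l : ℝ) - 1) / t)) •
          (ContinuousLinearMap.inr ℝ ℂ ℂ).comp (ContinuousLinearMap.snd ℝ ℂ ℂ) +
        (-(lam - s * (s + l - 2) / t ^ 2)) •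
          (ContinuousLinearMap.inr ℝ ℂ ℂ).comp (ContinuousLinearMap.fst ℝ ℂ ℂ) with hA
    have hAc : ContinuousOn (fun t => ‖A t‖) (Set.Icc ε R) := by
      have hne : ∀ t ∈ Set.Icc ε R, t ≠ 0 := fun t ht => (hε.trans_le ht.1).ne'
      have hne2 : ∀ t ∈ Set.Icc ε R, t ^ 2 ≠ 0 := fun t ht => pow_ne_zero 2 (hne t ht)
      have c1 : ContinuousOn (fun t : ℝ => -(((l : ℝ) - 1) / t)) (Set.Icc ε R) :=
        (continuousOn_const.div continuousOn_id hne).neg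
      have c2 : ContinuousOn (fun t : ℝ => -(lam - s * (s + l - 2) / t ^ 2)) (Set.Icc ε R) :=
        (continuousOn_const.sub (continuousOn_const.div (by fun_prop) hne2)).neg
      exact ((continuousOn_const.add (c1.smul continuousOn_const)).add
        (c2.smul continuousOn_const)).norm
    obtain ⟨K, hK⟩ := isCompact_Icc.bddAbove_image hAc
    have hK' : ∀ t ∈ Set.Icc ε R, ‖A t‖ ≤ K := fun t ht => hK ⟨t, ht, rfl⟩
    have hdF : ∀ t ∈ Set.Icc ε R, HasDerivAt (fun t => (f t, deriv f t)) (A t (f t, deriv f t)) t := by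
      intro t ht
      have ht0 : 0 < t := hε.trans_le ht.1
      have hc := cf t (by rw [abs_of_pos ht0]; exact ht.2)
      have o := h.radial_ode hu ht0 ht.2
      rw [← hf] at o
      have ht1 : (t : ℂ) ≠ 0 := by exact_mod_cast ht0.ne'
      refine (hc.eventually_hasDerivAt.self_of_nhds.prodMk hc.hasDerivAt_deriv).congr_deriv ?_
      refine Prod.ext (by simp [hA]) ?_
      simp only [hA, add_apply, smul_apply, ContinuousLinearMap.comp_apply,
        ContinuousLinearMap.inl_apply, ContinuousLinearMap.inr_apply, Prod.snd_add, Prod.smul_snd,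
        ContinuousLinearMap.coe_snd', ContinuousLinearMap.coe_fst', Complex.real_smul]
      push_cast
      field_simp
      linear_combination o
    have := ODE_solution_unique_of_mem_Icc_left (v := fun t x => A t x) (s := fun _ => Set.univ)
      (K := K.toNNReal) (f := fun t => (f t, deriv f t)) (g := fun _ => (0 : ℂ × ℂ)) (a := ε) (b := R)
      (fun t ht => ((A t).lipschitz.weaken (by
        rw [← NNReal.coe_le_coe]
        exact (hK' t ⟨ht.1.le, ht.2⟩).trans (Real.le_coe_toNNReal K))).lipschitzOnWith)
      (fun t ht => (hdF t ht).continuousAt.continuousWithinAt)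
      (fun t ht => (hdF t ⟨ht.1.le, ht.2⟩).hasDerivWithinAt) (fun _ _ => Set.mem_univ _)
      continuousOn_const (fun t _ => by simpa using hasDerivWithinAt_const t _ (0 : ℂ × ℂ))
      (fun _ _ => Set.mem_univ _) (by simp [h0, h1])
    exact congrArg Prod.fst (this ⟨le_rfl, hεR⟩)
  have hzero : f 0 = 0 := by
    have t1 : Tendsto f (𝓝[>] 0) (𝓝 (f 0)) :=
      (cf 0 (by simpa using hR.le)).continuousAt.tendsto.mono_left nhdsWithin_le_nhds
    refine tendsto_nhds_unique_of_eventuallyEq t1 tendsto_const_nhds ?_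
    filter_upwards [self_mem_nhdsWithin,
      (gt_mem_nhds hR).filter_mono nhdsWithin_le_nhds] with ε h0 hε
    exact hpos ε h0 (le_of_lt hε)
  intro Z hZ
  rw [mem_ball_zero_iff] at hZ
  obtain ⟨v, hv⟩ := exists_unit_smul hl Z
  have hr : ‖Z‖ ∈ Set.Icc 0 R := ⟨norm_nonneg _, hZ.le⟩
  rw [hv, h.eq_mul _ hr, ← h.radialFactor_eq hu hr, ← hf]
  rcases (norm_nonneg Z).eq_or_lt with h2 | h2
  · rw [← h2, hzero, zero_mul]
  · rw [hpos _ h2 hZ.le, zero_mul]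

/-- Values and radial derivatives on the boundary are determined by those in one direction. -/
theorem boundary_eq (hR : 0 < R) (h : IsSeparatedEigen l s R lam P w y) (v : USphere l) :
    w (R • (v : Vec l)) * evalAt (u : Vec l) P = w (R • (u : Vec l)) * evalAt (v : Vec l) P ∧
    fderiv ℝ w (R • (v : Vec l)) (v : Vec l) * evalAt (u : Vec l) P =
      fderiv ℝ w (R • (u : Vec l)) (u : Vec l) * evalAt (v : Vec l) P := by
  have key : ∀ r ∈ Set.Icc 0 R, w (r • (v : Vec l)) * evalAt (u : Vec l) P =
      w (r • (u : Vec l)) * evalAt (v : Vec l) P := fun r hr => by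
    rw [h.eq_mul r hr, h.eq_mul r hr]; ring
  have hRm : R ∈ Set.Icc 0 R := ⟨hR.le, le_rfl⟩
  have hd : ∀ v : USphere l, HasDerivAt (fun r : ℝ => w (r • (v : Vec l)))
      (fderiv ℝ w (R • (v : Vec l)) (v : Vec l)) R := fun v => by
    have h1 : ContDiffAt ℝ 2 w (R • (v : Vec l)) :=
      h.contDiffAt _ (by rw [mem_closedBall_zero_iff, norm_smul_sphere, abs_of_pos hR])
    have h2 : HasDerivAt (fun r : ℝ => r • (v : Vec l)) (v : Vec l) R := by
      simpa using (hasDerivAt_id R).smul_const (v : Vec l)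
    exact (h1.differentiableAt (by simp)).hasFDerivAt.comp_hasDerivAt R h2
  refine ⟨key R hRm, ?_⟩
  -- The product form is known only for `r ≤ R`, so the derivatives at `R` are compared within `[0,
  -- R]`, where they are unique.
  have d1 := ((hd v).mul_const (evalAt (u : Vec l) P)).hasDerivWithinAt (s := Set.Icc 0 R)
  have d2 := (((hd u).mul_const (evalAt (v : Vec l) P)).hasDerivWithinAt
    (s := Set.Icc 0 R)).congr (fun r hr => key r hr) (key R hRm)
  exact (uniqueDiffOn_Icc hR R hRm).eq_deriv _ d1 d2

/-- A boundary condition on one nontrivial separated eigenfunction holds for all those with the same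
order and eigenvalue. -/
theorem boundaryCond (hl : 0 < l) (hR : 0 < R) {a b : ℝ} {P' : MvPolynomial (Fin l) ℂ}
    {w' : Vec l → ℂ} {y' : ℝ → ℂ} (h : IsSeparatedEigen l s R lam P w y)
    (h' : IsSeparatedEigen l s R lam P' w' y') (hne : ∃ Z ∈ Metric.ball (0 : Vec l) R, w Z ≠ 0)
    (hbc : BoundaryCond a b R w) : BoundaryCond a b R w' := by
  have hRm : R ∈ Set.Icc 0 R := ⟨hR.le, le_rfl⟩
  have hRa : |R| ≤ R := (abs_of_pos hR).le
  obtain ⟨u, hu⟩ : ∃ u : USphere l, evalAt (u : Vec l) P ≠ 0 := by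
    obtain ⟨Z, hZ, hZ0⟩ := hne
    obtain ⟨u, hu⟩ := exists_unit_smul hl Z
    refine ⟨u, fun h0 => hZ0 ?_⟩
    rw [hu, h.eq_mul _ ⟨norm_nonneg _, (mem_ball_zero_iff.1 hZ).le⟩, h0, mul_zero]
  intro v
  -- If `P'` vanishes on the sphere there is no radial factor; then `w'` is zero along each radius
  -- up to `R`, and so is its radial derivative there.
  by_cases hz : ∀ u' : USphere l, evalAt (u' : Vec l) P' = 0
  · have e1 : w' (R • (v : Vec l)) = 0 := by rw [h'.eq_mul R hRm, hz, mul_zero]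
    have h1 : ContDiffAt ℝ 2 w' (R • (v : Vec l)) :=
      h'.contDiffAt _ (by rw [mem_closedBall_zero_iff, norm_smul_sphere, abs_of_pos hR])
    have h2 : HasDerivAt (fun r : ℝ => r • (v : Vec l)) (v : Vec l) R := by
      simpa using (hasDerivAt_id R).smul_const (v : Vec l)
    have d1 := ((h1.differentiableAt (by simp)).hasFDerivAt.comp_hasDerivAt R h2).hasDerivWithinAt
      (s := Set.Icc 0 R)
    have d2 := (hasDerivWithinAt_const R (Set.Icc 0 R) (0 : ℂ)).congr
      (f₁ := fun r : ℝ => w' (r • (v : Vec l)))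
      (fun r hr => by rw [h'.eq_mul r hr, hz, mul_zero]) e1
    have e2 := (uniqueDiffOn_Icc hR R hRm).eq_deriv _ d1 d2
    rw [e1, e2, mul_zero, mul_zero, add_zero]
  push Not at hz
  obtain ⟨u', hu'⟩ := hz
  have hW := wronskian_eq_zero hl hR h h' hu hu'
  have dw := (h.hasDerivAt_radialFactor (u := u) hRa).deriv
  have dw' := (h'.hasDerivAt_radialFactor (u := u') hRa).deriv
  have hb1 : a * radialFactor P w u R + b * deriv (radialFactor P w u) R = 0 := by
    rw [dw, radialFactor, ← mul_div_assoc, ← mul_div_assoc, ← add_div, hbc u, zero_div]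
  -- The vanishing Wronskian makes the two pairs of Cauchy data linearly dependent. Those of `f` are
  -- not both zero by `eq_zero_of_cauchy`, so one divides by whichever is nonzero.
  have hb2 : a * radialFactor P' w' u' R + b * deriv (radialFactor P' w' u') R = 0 := by
    by_cases hf : radialFactor P w u R = 0
    · have hf1 : deriv (radialFactor P w u) R ≠ 0 := fun hf1 => by
        obtain ⟨Z, hZ, hZ0⟩ := hne
        exact hZ0 (h.eq_zero_of_cauchy hl hR hu hf hf1 Z hZ)
      refine (mul_eq_zero.1 (?_ : deriv (radialFactor P w u) R * _ = 0)).resolve_left hf1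
      linear_combination deriv (radialFactor P' w' u') R * hb1 - a * hW
    · refine (mul_eq_zero.1 (?_ : radialFactor P w u R * _ = 0)).resolve_left hf
      linear_combination radialFactor P' w' u' R * hb1 + b * hW
  obtain ⟨e1, e2⟩ := h'.boundary_eq hR (u := u') v
  rw [dw', radialFactor, ← mul_div_assoc, ← mul_div_assoc, ← add_div, div_eq_zero_iff] at hb2
  have hb3 := hb2.resolve_right hu'
  refine mul_right_cancel₀ hu' ?_
  linear_combination a * e1 + b * e2 + evalAt (v : Vec l) P' * hb3

end IsSeparatedEigen

end ball

/-! ### The twisted functions on the ball -/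

/-- A boundary condition of a ball eigenvalue holds for all twisted functions. -/
theorem IsBallEigenvalue.boundaryCond_twisted {k l s : ℕ} (hl : 0 < l) {a b R lam : ℝ} (hR : 0 < R)
    (hlam : 0 ≤ lam) (heig : IsBallEigenvalue l s a b R lam) {G : Vec k → USphere l → ℂ} {X : Vec k}
    (hG : Continuous (G X)) : BoundaryCond a b R (twisted s lam G X) := by
  obtain ⟨w, hwc, hne, hwe, hbc, y, _, ⟨P, hP, hP0, rfl⟩, hwy⟩ := heig
  have hg : Continuous (sphereProj l s (G X)) := continuous_sphereProj hG
  obtain ⟨y', _, ⟨P', hP', hP0', rfl⟩, hy'⟩ := zFourier_harmonic hl lam (sphereProj_mem (s := s) hG)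
  have h : IsSeparatedEigen l s R lam P w y := ⟨hwc, hwe, hP, hP0, hwy⟩
  have h' : IsSeparatedEigen l s R lam P' (zFourier lam (sphereProj l s (G X))) y' :=
    ⟨fun Z _ => (contDiff_zFourier lam hg 2).contDiffAt,
      fun Z _ => by rw [laplacian_zFourier hlam hg]; ring, hP', hP0', fun r _ u => hy' r u⟩
  exact h.boundaryCond hl hR h' hne hbc

end

/-! ### The theorem on Z-ball bundles of constant radius -/

theorem mainTheorem3 {k l : ℕ} (hk : 0 < k) (hl : 0 < l) (N : HType k l)
    -- the Z-ball bundle of constant radius, the boundary condition and a ball eigenvalue for it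
    (ρ : ENNReal) (R : ℝ) (hR : 0 < R) (a b : ℝ) (hab : a ≠ 0 ∨ b ≠ 0)
    (s : ℕ) (lam : ℝ) (hlam : 0 ≤ lam) (heig : IsBallEigenvalue l s a b R lam)
    -- the amplitude `φ(|X|²) F(X, K_u)`
    (n : ℕ) (m : ℤ) (F : Vec k → USphere l → ℂ) (hF : F ∈ N.amplitudes n m)
    (φ : ℝ → ℂ)
    (hφ : ∀ X : Vec k, ENNReal.ofReal ‖X‖ < ρ → ContDiffAt ℝ 2 φ (‖X‖ ^ 2)) :
    -- the twisted function satisfies the boundary condition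
    (∀ X : Vec k, ENNReal.ofReal ‖X‖ < ρ →
      BoundaryCond a b R (twisted s lam (fun X' u => φ (‖X'‖ ^ 2) * F X' u) X)) ∧
    -- the Laplacian is the sum of the exterior and the intrinsic spin operators
    (∀ X Z, (X, Z) ∈ zBallBundle k l ρ R →
      N.laplacian (twisted s lam (fun X' u => φ (‖X'‖ ^ 2) * F X' u)) X Z =
        N.exterior s lam (fun X' u => φ (‖X'‖ ^ 2) * F X' u) X Z +
        N.intrinsic s lam (fun X' u => φ (‖X'‖ ^ 2) * F X' u) X Z) ∧
    -- the exterior operator reduces to the radial operator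
    (∀ X Z, (X, Z) ∈ zBallBundle k l ρ R →
      N.exterior s lam (fun X' u => φ (‖X'‖ ^ 2) * F X' u) X Z =
        twisted s lam (fun X' u => radialExterior k n m lam φ (‖X'‖ ^ 2) * F X' u) X Z) ∧
    -- and so does its eigenvalue problem
    ((∃ X Z, (X, Z) ∈ zBallBundle k l ρ R ∧ twisted s lam F X Z ≠ 0) → ∀ ν : ℂ,
      ((∀ X Z, (X, Z) ∈ zBallBundle k l ρ R →
          N.exterior s lam (fun X' u => φ (‖X'‖ ^ 2) * F X' u) X Z =
            ν * twisted s lam (fun X' u => φ (‖X'‖ ^ 2) * F X' u) X Z) ↔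
        ∀ X : Vec k, ENNReal.ofReal ‖X‖ < ρ →
          radialExterior k n m lam φ (‖X‖ ^ 2) = ν * φ (‖X‖ ^ 2))) ∧
    -- the radial operator is the Ginsburg-Landau-Zeeman one with parameter `√(lam / 4)`,
    radialExterior k n m lam = radialGLZ k n m (Real.sqrt (lam / 4)) ∧
    -- which is the one to which the Laplacian reduces on Z-crystals, for the frequency vector
    -- `Z_γ = (μ / π) u`
    (∀ (μ : ℝ) (_ : 0 < μ) (u : USphere l) (X : Vec k) (Z : Vec l), ENNReal.ofReal ‖X‖ < ρ →
      N.laplacian (fun X' Z' => φ (‖X'‖ ^ 2) * F X' u *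
          Complex.exp (2 * Real.pi * Complex.I *
            (inner ℝ ((μ / Real.pi) • (u : Vec l)) Z' : ℝ))) X Z =
        radialGLZ k n m μ φ (‖X‖ ^ 2) * F X u *
          Complex.exp (2 * Real.pi * Complex.I *
            (inner ℝ ((μ / Real.pi) • (u : Vec l)) Z : ℝ))) := by
  obtain ⟨p, hp, rfl⟩ := N.exists_isHarmonicFamily hk hF
  refine ⟨fun X _ => ?_, fun X Z hXZ => hp.laplacian_twisted (hφ X hXZ.1) s lam Z,
    fun X Z hXZ => ?_, fun hne => hp.exterior_eigen_iff hk hφ s hlam hne,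
    radialExterior_eq_radialGLZ k n m hlam,
    fun μ _ u X Z hX => hp.laplacian_crystal (hφ X hX) μ u Z⟩
  · exact heig.boundaryCond_twisted hl hR hlam (continuous_const.mul (hp.continuous_evalAt X))
  · rw [hp.exterior_eq (hφ X hXZ.1) s hlam,
      hp.twisted_mul s lam fun X => radialExterior k n m lam φ (‖X‖ ^ 2)]
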